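/- Let $G=(V,E)$ be a finite connected graph with at least one edge (loops and multiple edges allowed). A metric on $G$ is a vector $g=(g_e)_{e\in E}\in(0,\infty)^E$: each edge $e$ is parametrised by $x\in[0,1]$ and has length $\ell_e=\sqrt{g_e}$. A density is a family $\rho=(\rho_e)_{e\in E}$ of positive functions $\rho_e\in C^\infty([0,1])$. For a function $f=(f_e)_{e\in E}$ on $G$ put $|\nabla_g f|_g^2=g_e^{-1}(f_e')^2$ and $\Delta_g f=-g_e^{-1}f_e''$ on $e$. Let $0=\lambda_0(g,\rho)<\lambda_1(g,\rho)\le\lambda_2(g,\rho)\le\cdots$ be the eigenvalues, repeated according to multiplicity, of the problem $$\Delta_g f=\lambda\rho f\ \text{ on the edges},\qquad f\ \text{continuous on } G,\qquad \sum_{e\sim v}\partial_e f(v)=0\ \text{ at every } v\in V,$$ where the sum runs over the edge ends at $v$ and $\partial_e f(v)$ is the arc-length derivative at $v$ in the direction pointing into $e$. For $\alpha\in\mathbb R$ let $$F_\alpha(g)=\sum_{e\in E}g_e^{1-\alpha},\qquad H_\alpha(g,\rho)=\sum_{e\in E}g_e^{\alpha}\int_0^1\rho_e\,dx,\qquad \overline{\lambda_k}^{(\alpha)}(g,\rho)=\lambda_k(g,\rho)\,F_\alpha(g)\,H_\alpha(g,\rho).$$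 A pair $(g_*,\rho_*)$ is extremal for a functional $\Phi$ on pairs if, for every smooth one-parameter family $(g(t),\rho(t))$ of pairs of a metric and a density with $(g(0),\rho(0))=(g_*,\rho_*)$, either $\Phi(g(t),\rho(t))\le\Phi(g_*,\rho_*)+o(t)$ or $\Phi(g(t),\rho(t))\ge\Phi(g_*,\rho_*)+o(t)$ as $t\to0$. **Theorem.** Let $k\ge1$ be an integer and $\alpha\in\mathbb R\setminus\{1/2,1\}$. (1) Suppose that $(g_*,\rho_*)$ is extremal for $\overline{\lambda_k}^{(\alpha)}$. Then all edges have the same length in $g_*$, $\rho_*$ is a constant function (with the same constant on all edges), and there are finitely many $\lambda_k(g_*,\rho_*)$-eigenfunctions $f_1,\dots,f_n$ such that, for $(g,\rho)=(g_*,\rho_*)$, at every point of every edge $e$, $$\sum_{i=1}^n|\nabla_g f_i|_g^2=1\qquad\text{and}\qquad \lambda_k(g,\rho)\sum_{i=1}^n f_i^2=\frac{g_e^{\alpha-1/2}F_\alpha(g)}{2(1-\alpha)\,g_e^{-\alpha+1/2}H_\alpha(g,\rho)+(2\alpha-1)\,\rho_e\,g_e^{\alpha-1/2}F_\alpha(g)}.\qquad(*)$$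 (2) Conversely, let $(g,\rho)$ be any pair of a metric and a density. If there are $\lambda_k(g,\rho)$-eigenfunctions $f_1,\dots,f_n$ satisfying $(*)$ at every point of every edge and, additionally, $\lambda_k(g,\rho)>\lambda_{k-1}(g,\rho)$ or $\lambda_k(g,\rho)<\lambda_{k+1}(g,\rho)$, then $(g,\rho)$ is extremal for $\overline{\lambda_k}^{(\alpha)}$. -/

import Mathlib

open Set Filter Topology Asymptotics

/-- A graph with vertex set `V` and edge set `E`; loops and parallel edges are allowed. Each edge
`e` carries an arbitrary reference orientation from `src e` to `tgt e`, which is used only to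
parametrise `e` by `[0, 1]`, with `0` at `src e` and `1` at `tgt e`. -/
structure DiscreteGraph (V E : Type*) where
  src : E → V
  tgt : E → V

namespace DiscreteGraph

/-- Any two vertices are joined by a path of edges, traversed in either direction. -/
def IsConnected {V E : Type*} (G : DiscreteGraph V E) : Prop :=
  ∀ u v : V, Relation.EqvGen (fun a b => ∃ e, G.src e = a ∧ G.tgt e = b) u v

/-- Functions on the graph are given edge by edge in the parameter `x ∈ [0, 1]`; only their values
on `[0, 1]` are meaningful. This is the derivative in that parameter, one-sided at `0` and `1`. -/
noncomputable def edgeDeriv {E : Type*} (f : E → ℝ → ℝ) (e : E) (x : ℝ) : ℝ :=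
  derivWithin (f e) (Icc 0 1) x

/-- The squared norm of the gradient in the metric `g e * dx ^ 2` (so `e` has length `√(g e)`). -/
noncomputable def gradSq {E : Type*} (g : E → ℝ) (f : E → ℝ → ℝ) (e : E) (x : ℝ) : ℝ :=
  edgeDeriv f e x ^ 2 / g e

/-- The (nonnegative) Laplacian, minus the second derivative in arc length. -/
noncomputable def laplacian {E : Type*} (g : E → ℝ) (f : E → ℝ → ℝ) (e : E) (x : ℝ) : ℝ :=
  -(edgeDeriv (edgeDeriv f) e x / g e)

/-- The sum, over the edge ends attached at `v`, of the arc-length derivatives pointing from `v`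
into the edge. A loop at `v` contributes both of its ends. -/
noncomputable def outwardDerivSum {V E : Type*} [Fintype E] [DecidableEq V]
    (G : DiscreteGraph V E) (g : E → ℝ) (f : E → ℝ → ℝ) (v : V) : ℝ :=
  ∑ e : E, ((if G.src e = v then edgeDeriv f e 0 / √(g e) else 0)
    + (if G.tgt e = v then -(edgeDeriv f e 1 / √(g e)) else 0))

/-- The pairs of a metric (a positive number `g e` for each edge) and a density that is positive
and smooth on each closed edge; densities need not be continuous at the vertices. -/
def IsMetricDensity {E : Type*} (g : E → ℝ) (ρ : E → ℝ → ℝ) : Prop :=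
  (∀ e, 0 < g e) ∧ (∀ e, ContDiffOn ℝ (⊤ : ℕ∞) (ρ e) (Icc 0 1)) ∧
    ∀ e, ∀ x ∈ Icc (0 : ℝ) 1, 0 < ρ e x

/-- `f` is an eigenfunction for the eigenvalue `μ`: it is nonzero, twice continuously
differentiable on the closed edges, continuous at the vertices, solves `Δ_g f = μ ρ f` on the
edges, and its outward derivatives add up to zero at every vertex. -/
structure IsEigenfunction {V E : Type*} [Fintype E] [DecidableEq V] (G : DiscreteGraph V E)
    (g : E → ℝ) (ρ : E → ℝ → ℝ) (μ : ℝ) (f : E → ℝ → ℝ) : Prop where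
  nonzero : ∃ e, ∃ x ∈ Icc (0 : ℝ) 1, f e x ≠ 0
  smooth : ∀ e, ContDiffOn ℝ 2 (f e) (Icc 0 1)
  continuous : ∃ φ : V → ℝ, ∀ e, f e 0 = φ (G.src e) ∧ f e 1 = φ (G.tgt e)
  equation : ∀ e, ∀ x ∈ Icc (0 : ℝ) 1, laplacian g f e x = μ * ρ e x * f e x
  vertex : ∀ v, outwardDerivSum G g f v = 0

/-- The `k`-th eigenvalue, `k = 0, 1, 2, …`, in increasing order and counted with multiplicity:
the least `Λ` such that there are `k + 1` linearly independent eigenfunctions (as functions on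
the closed edges) with eigenvalues at most `Λ`. -/
noncomputable def eigenvalue {V E : Type*} [Fintype E] [DecidableEq V] (G : DiscreteGraph V E)
    (k : ℕ) (g : E → ℝ) (ρ : E → ℝ → ℝ) : ℝ :=
  sInf {Λ : ℝ | ∃ (μ : Fin (k + 1) → ℝ) (f : Fin (k + 1) → E → ℝ → ℝ),
    (∀ i, μ i ≤ Λ ∧ IsEigenfunction G g ρ (μ i) (f i)) ∧
    LinearIndependent ℝ (fun i => (fun (e : E) (x : Icc (0 : ℝ) 1) => f i e x))}

/-- `F_α(g) = ∑ g_e ^ (1 - α)`. -/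
noncomputable def normF {E : Type*} [Fintype E] (α : ℝ) (g : E → ℝ) : ℝ :=
  ∑ e : E, g e ^ (1 - α)

/-- `H_α(g, ρ) = ∑ g_e ^ α * ∫ ρ_e`, the integrals being over `[0, 1]`. -/
noncomputable def normH {E : Type*} [Fintype E] (α : ℝ) (g : E → ℝ) (ρ : E → ℝ → ℝ) : ℝ :=
  ∑ e : E, g e ^ α * ∫ x in (0 : ℝ)..1, ρ e x

/-- The normalised eigenvalue `λ_k(g, ρ) * F_α(g) * H_α(g, ρ)`. -/
noncomputable def normalizedEigenvalue {V E : Type*} [Fintype E] [DecidableEq V]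
    (G : DiscreteGraph V E) (k : ℕ) (α : ℝ) (g : E → ℝ) (ρ : E → ℝ → ℝ) : ℝ :=
  eigenvalue G k g ρ * normF α g * normH α g ρ

/-- A smooth one-parameter family `(g t, ρ t)`, `-δ < t < δ`, of metrics and densities that starts
at `(g₀, ρ₀)` for `t = 0`; the densities are smooth jointly in `t` and the edge parameter. -/
structure IsSmoothFamily {E : Type*} (δ : ℝ) (g : ℝ → E → ℝ) (ρ : ℝ → E → ℝ → ℝ)
    (g₀ : E → ℝ) (ρ₀ : E → ℝ → ℝ) : Prop where
  mem : ∀ t ∈ Ioo (-δ) δ, IsMetricDensity (g t) (ρ t)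
  smooth_metric : ∀ e, ContDiffOn ℝ (⊤ : ℕ∞) (fun t => g t e) (Ioo (-δ) δ)
  smooth_density : ∀ e, ContDiffOn ℝ (⊤ : ℕ∞) (fun p : ℝ × ℝ => ρ p.1 e p.2)
    (Ioo (-δ) δ ×ˢ Icc (0 : ℝ) 1)
  metric_zero : g 0 = g₀
  density_zero : ∀ e, EqOn (ρ 0 e) (ρ₀ e) (Icc 0 1)

/-- `(g₀, ρ₀)` is extremal for `Φ`: along every smooth family through it, `Φ ≤ Φ(g₀, ρ₀) + o(t)`
as `t → 0`, or `Φ ≥ Φ(g₀, ρ₀) + o(t)` as `t → 0`. -/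
def IsExtremal {E : Type*} (Φ : (E → ℝ) → (E → ℝ → ℝ) → ℝ) (g₀ : E → ℝ) (ρ₀ : E → ℝ → ℝ) : Prop :=
  IsMetricDensity g₀ ρ₀ ∧
  ∀ (δ : ℝ) (g : ℝ → E → ℝ) (ρ : ℝ → E → ℝ → ℝ), 0 < δ → IsSmoothFamily δ g ρ g₀ ρ₀ →
    (∃ r : ℝ → ℝ, r =o[𝓝 0] (fun t : ℝ => t) ∧ ∀ᶠ t in 𝓝 (0 : ℝ), Φ (g t) (ρ t) ≤ Φ g₀ ρ₀ + r t) ∨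
    (∃ r : ℝ → ℝ, r =o[𝓝 0] (fun t : ℝ => t) ∧ ∀ᶠ t in 𝓝 (0 : ℝ), Φ g₀ ρ₀ + r t ≤ Φ (g t) (ρ t))

/-- The finitely many `λ_k(g, ρ)`-eigenfunctions `f 0, …, f (n - 1)` satisfy, everywhere on the
graph, `∑ |∇ f_i|² = 1` and
`λ_k ∑ f_i² = g^(α-1/2) F_α / (2(1-α) g^(1/2-α) H_α + (2α-1) ρ g^(α-1/2) F_α)`. -/
def IsGeneratingFamily {V E : Type*} [Fintype E] [DecidableEq V] (G : DiscreteGraph V E)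
    (k : ℕ) (α : ℝ) (g : E → ℝ) (ρ : E → ℝ → ℝ) {n : ℕ} (f : Fin n → E → ℝ → ℝ) : Prop :=
  (∀ i, IsEigenfunction G g ρ (eigenvalue G k g ρ) (f i)) ∧
  (∀ e, ∀ x ∈ Icc (0 : ℝ) 1, ∑ i, gradSq g (f i) e x = 1) ∧
  (∀ e, ∀ x ∈ Icc (0 : ℝ) 1, eigenvalue G k g ρ * ∑ i, f i e x ^ 2 =
    g e ^ (α - 1 / 2) * normF α g /
      (2 * (1 - α) * g e ^ (-α + 1 / 2) * normH α g ρ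
        + (2 * α - 1) * ρ e x * g e ^ (α - 1 / 2) * normF α g))

end DiscreteGraph

/-! In the edge parameter the problem is `a(f, h) = λ b(f, h)` for all test functions `h`, where `a
= ∑ g_e^(-1/2) ∫ f' h'` (`gradForm` with `conductance`) and `b = ∑ g_e^(1/2) ∫ ρ_e f h` (`massForm`
with `massDensity`). Hence the normalised eigenvalue is the `k`-th eigenvalue of the pair `(F_α H_α
a, b)`. Along a family its first variation is governed by the quadratic form `variationQuad` on the
`λ_k`-eigenspace, which depends linearly on the direction `(h, σ)`.

Necessity. If this form were positive definite on the eigenspace for some direction, the normalised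
eigenvalue would increase through `t = 0` at a linear rate on both sides, which extremality forbids
(`IsExtremal.not_definite`). So a linear space of quadratic forms on a finite-dimensional space has
no positive definite member, and separation of convex sets produces finitely many eigenfunctions on
which the first variations sum to zero in every direction (`exists_annihilating_vectors`). The
density component of this identity says that `∑ f_i²` is a fixed multiple of `g_e^(α-1/2)` on each
edge. By continuity and connectedness it is a global constant, so `α ≠ 1/2` gives equal lengths. The
differential equations for `∑ f_i²`, `∑ f_i f_i'`, `∑ f_i'²` then make `ρ` constant on each edge,
and the metric component with `α ≠ 1` equates these constants (`rigidity_of_gradient_eq_zero`). A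
rescaling yields the two identities.

Sufficiency. Conversely the two identities force the sum of the first variations over the family to
vanish (`gradient_eq_zero_of_isGeneratingFamily`). In every direction some `f_i` therefore has
nonpositive variation and some `f_j` nonnegative variation. When `λ_k` is separated from `λ_{k-1}`,
one such function together with the lower modes is an adequate test space for an upper bound up to
`o(t)`; a gap to `λ_{k+1}` gives the lower bound.

The spectral theory is built directly on functions that are `C¹` on the closed edges. A minimising
sequence for the Rayleigh quotient converges uniformly by Arzelà–Ascoli, and the limit is a
classical eigenfunction because the equation passes to the limit with all derivatives on the test
function (`exists_strong_of_veryWeak`). Eigenvalues along a family are compared through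
`eventually_nonneg_of_expansion`, which needs no differentiability of eigenvalues or eigenfunctions.
-/

namespace DiscreteGraph

/-! ### One-sided calculus on `[0, 1]` and the second-order du Bois-Reymond lemma. -/

section Calculus

theorem hasDerivAt_of_hasDerivWithinAt_Icc {F : ℝ → ℝ} {F' x : ℝ} (hx : x ∈ Ioo (0 : ℝ) 1)
    (h : HasDerivWithinAt F F' (Icc 0 1) x) : HasDerivAt F F' x :=
  h.hasDerivAt (Icc_mem_nhds hx.1 hx.2)

theorem integral_deriv_Icc {F F' : ℝ → ℝ} {x y : ℝ} (hx : 0 ≤ x) (hxy : x ≤ y) (hy : y ≤ 1)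
    (h : ∀ z ∈ Icc (0 : ℝ) 1, HasDerivWithinAt F (F' z) (Icc 0 1) z)
    (hF' : ContinuousOn F' (Icc 0 1)) : ∫ z in x..y, F' z = F y - F x := by
  have hsub : Icc x y ⊆ Icc (0 : ℝ) 1 := Icc_subset_Icc hx hy
  refine intervalIntegral.integral_eq_sub_of_hasDerivAt_of_le hxy
    (fun z hz => ((h z (hsub hz)).continuousWithinAt).mono hsub) (fun z hz => ?_) ?_
  · exact hasDerivAt_of_hasDerivWithinAt_Icc ⟨hx.trans_lt hz.1, hz.2.trans_le hy⟩
      (h z (hsub ⟨hz.1.le, hz.2.le⟩))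
  · exact (hF'.mono hsub).intervalIntegrable_of_Icc hxy

/-- Extending `w` by its end values makes it continuous on the line, so the fundamental theorem also
applies at the two endpoints. -/
theorem exists_primitive_Icc {w : ℝ → ℝ} (hw : ContinuousOn w (Icc 0 1)) :
    ∃ W : ℝ → ℝ, W 0 = 0 ∧ ∀ x ∈ Icc (0 : ℝ) 1, HasDerivWithinAt W (w x) (Icc 0 1) x := by
  have hc : Continuous (IccExtend (zero_le_one (α := ℝ)) (domRestrict (Icc (0 : ℝ) 1) w)) :=
    (continuousOn_iff_continuous_domRestrict.1 hw).Icc_extend'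
  refine ⟨fun x => ∫ z in (0 : ℝ)..x, IccExtend (zero_le_one (α := ℝ)) (domRestrict (Icc (0 : ℝ) 1) w) z,
    by simp, fun x hx => ?_⟩
  have := (hc.integral_hasStrictDerivAt 0 x).hasDerivAt
  rw [IccExtend_of_mem _ _ hx] at this
  exact this.hasDerivWithinAt

theorem continuousOn_of_hasDerivWithinAt {F F' : ℝ → ℝ}
    (h : ∀ z ∈ Icc (0 : ℝ) 1, HasDerivWithinAt F (F' z) (Icc 0 1) z) :
    ContinuousOn F (Icc 0 1) := fun z hz => (h z hz).continuousWithinAt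

theorem derivWithin_Icc_eq {F : ℝ → ℝ} {F' x : ℝ} (hx : x ∈ Icc (0 : ℝ) 1)
    (h : HasDerivWithinAt F F' (Icc 0 1) x) : derivWithin F (Icc 0 1) x = F' :=
  h.derivWithin (uniqueDiffOn_Icc zero_lt_one x hx)

theorem intervalIntegrable_Icc {w : ℝ → ℝ} (hw : ContinuousOn w (Icc 0 1)) :
    IntervalIntegrable w MeasureTheory.volume 0 1 :=
  hw.intervalIntegrable_of_Icc zero_le_one

theorem integral_congr_Icc {w w' : ℝ → ℝ} (h : ∀ x ∈ Icc (0 : ℝ) 1, w x = w' x) :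
    ∫ x in (0 : ℝ)..1, w x = ∫ x in (0 : ℝ)..1, w' x := by
  refine intervalIntegral.integral_congr fun x hx => h x ?_
  rwa [uIcc_of_le zero_le_one] at hx

theorem eq_zero_of_integral_mul_sq_eq_zero {m w : ℝ → ℝ} (hm : ContinuousOn m (Icc 0 1))
    (hm0 : ∀ x ∈ Icc (0 : ℝ) 1, 0 < m x) (hw : ContinuousOn w (Icc 0 1))
    (h : ∫ x in (0 : ℝ)..1, m x * w x ^ 2 = 0) : ∀ x ∈ Icc (0 : ℝ) 1, w x = 0 := by
  by_contra! hne
  obtain ⟨x, hx, hwx⟩ := hne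
  have : 0 < ∫ x in (0 : ℝ)..1, m x * w x ^ 2 := by
    refine intervalIntegral.integral_pos zero_lt_one (hm.mul (hw.pow 2))
      (fun y hy => mul_nonneg (hm0 y ⟨hy.1.le, hy.2⟩).le (sq_nonneg _)) ⟨x, hx, ?_⟩
    exact mul_pos (hm0 x hx) (by positivity)
  exact this.ne' h

/-- Integration by parts on `[0, 1]` for one-sided derivatives. -/
theorem integral_mul_deriv_Icc {u u' v v' : ℝ → ℝ}
    (hu : ∀ z ∈ Icc (0 : ℝ) 1, HasDerivWithinAt u (u' z) (Icc 0 1) z)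
    (hv : ∀ z ∈ Icc (0 : ℝ) 1, HasDerivWithinAt v (v' z) (Icc 0 1) z)
    (hu' : ContinuousOn u' (Icc 0 1)) (hv' : ContinuousOn v' (Icc 0 1)) :
    ∫ x in (0 : ℝ)..1, u' x * v x = u 1 * v 1 - u 0 * v 0 - ∫ x in (0 : ℝ)..1, u x * v' x := by
  have hcu := continuousOn_of_hasDerivWithinAt hu
  have hcv := continuousOn_of_hasDerivWithinAt hv
  have := integral_deriv_Icc le_rfl zero_le_one le_rfl (fun z hz => (hu z hz).mul (hv z hz))
    ((hu'.mul hcv).add (hcu.mul hv'))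
  have h2 : ∫ x in (0 : ℝ)..1, (u' x * v x + u x * v' x)
      = (∫ x in (0 : ℝ)..1, u' x * v x) + ∫ x in (0 : ℝ)..1, u x * v' x :=
    intervalIntegral.integral_add (intervalIntegrable_Icc (hu'.mul hcv))
      (intervalIntegrable_Icc (hcu.mul hv'))
  simp only [Pi.mul_apply] at this
  linarith

theorem hasDerivWithinAt_affine (A B x : ℝ) :
    HasDerivWithinAt (fun z => A + B * z) B (Icc 0 1) x := by
  have := ((hasDerivAt_id x).const_mul B).const_add A
  simpa using this.hasDerivWithinAt

/-- A continuous function is the sum of an affine function and a function orthogonal to the affine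
functions. -/
theorem exists_affine_projection {z : ℝ → ℝ} (hz : ContinuousOn z (Icc 0 1)) :
    ∃ A B : ℝ, ∫ x in (0 : ℝ)..1, (z x - (A + B * x)) = 0 ∧
      ∫ x in (0 : ℝ)..1, x * (z x - (A + B * x)) = 0 := by
  have I1 : ∀ A B : ℝ, ∫ x in (0 : ℝ)..1, (A + B * x) = A + B / 2 := fun A B => by
    rw [intervalIntegral.integral_add (by simp) (Continuous.intervalIntegrable (by fun_prop) _ _),
      intervalIntegral.integral_const_mul, integral_id]
    simp; ring
  have I2 : ∀ A B : ℝ, ∫ x in (0 : ℝ)..1, (A * x + B * x ^ 2) = A / 2 + B / 3 := fun A B => by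
    rw [intervalIntegral.integral_add (Continuous.intervalIntegrable (by fun_prop) _ _)
      (Continuous.intervalIntegrable (by fun_prop) _ _),
      intervalIntegral.integral_const_mul, intervalIntegral.integral_const_mul, integral_id,
      integral_pow]
    norm_num; ring
  obtain ⟨m0, hm0⟩ : ∃ m, m = ∫ x in (0 : ℝ)..1, z x := ⟨_, rfl⟩
  obtain ⟨m1, hm1⟩ : ∃ m, m = ∫ x in (0 : ℝ)..1, x * z x := ⟨_, rfl⟩
  have h1 := intervalIntegrable_Icc hz
  have h2 : IntervalIntegrable (fun x => x * z x) MeasureTheory.volume 0 1 :=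
    intervalIntegrable_Icc (continuousOn_id.mul hz)
  -- These coefficients solve the moment equations `A + B/2 = m0`, `A/2 + B/3 = m1`.
  refine ⟨4 * m0 - 6 * m1, 12 * m1 - 6 * m0, ?_, ?_⟩
  · rw [intervalIntegral.integral_sub h1 (Continuous.intervalIntegrable (by fun_prop) _ _), I1,
      ← hm0]
    ring
  · have : ∀ x : ℝ, x * (z x - (4 * m0 - 6 * m1 + (12 * m1 - 6 * m0) * x))
        = x * z x - ((4 * m0 - 6 * m1) * x + (12 * m1 - 6 * m0) * x ^ 2) := fun x => by ring
    simp only [this]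
    rw [intervalIntegral.integral_sub h2 (Continuous.intervalIntegrable (by fun_prop) _ _), I2,
      ← hm1]
    ring

/-- A continuous function whose second distributional derivative is `-q` is twice
differentiable. -/
theorem exists_hasDerivWithinAt_of_veryWeak {w q : ℝ → ℝ} (hw : ContinuousOn w (Icc 0 1))
    (hq : ContinuousOn q (Icc 0 1))
    (h : ∀ φ φ₁ φ₂ : ℝ → ℝ, (∀ x ∈ Icc (0 : ℝ) 1, HasDerivWithinAt φ (φ₁ x) (Icc 0 1) x) →
      (∀ x ∈ Icc (0 : ℝ) 1, HasDerivWithinAt φ₁ (φ₂ x) (Icc 0 1) x) →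
      ContinuousOn φ₂ (Icc 0 1) → φ 0 = 0 → φ 1 = 0 → φ₁ 0 = 0 → φ₁ 1 = 0 →
      ∫ x in (0 : ℝ)..1, w x * φ₂ x = -∫ x in (0 : ℝ)..1, q x * φ x) :
    ∃ w₁ : ℝ → ℝ, (∀ x ∈ Icc (0 : ℝ) 1, HasDerivWithinAt w (w₁ x) (Icc 0 1) x) ∧
      ∀ x ∈ Icc (0 : ℝ) 1, HasDerivWithinAt w₁ (-q x) (Icc 0 1) x := by
  obtain ⟨Q₁, -, hQ₁⟩ := exists_primitive_Icc hq
  have cQ₁ := continuousOn_of_hasDerivWithinAt hQ₁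
  obtain ⟨Q₂, -, hQ₂⟩ := exists_primitive_Icc cQ₁
  have cQ₂ := continuousOn_of_hasDerivWithinAt hQ₂
  -- `Q₂'' = q`, so `w + Q₂` has vanishing second derivative in the weak sense and should be affine.
  -- Let `z` be its deviation from its affine projection.
  obtain ⟨A, B, hA, hB⟩ := exists_affine_projection (hw.add cQ₂)
  set z : ℝ → ℝ := fun x => (w + Q₂) x - (A + B * x) with hz
  have cz : ContinuousOn z (Icc 0 1) := (hw.add cQ₂).sub (by fun_prop)
  obtain ⟨Z₁, hZ₁0, hZ₁⟩ := exists_primitive_Icc cz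
  have cZ₁ := continuousOn_of_hasDerivWithinAt hZ₁
  obtain ⟨Z₂, hZ₂0, hZ₂⟩ := exists_primitive_Icc cZ₁
  have cZ₂ := continuousOn_of_hasDerivWithinAt hZ₂
  -- Orthogonality of `z` to `1` and `x` is exactly what makes its double primitive `Z₂` vanish to
  -- first order at both ends. So `Z₂` is an admissible test function with second derivative `z`,
  -- and testing with it gives `∫ z² = 0`.
  have hZ₁1 : Z₁ 1 = 0 := by
    have := integral_deriv_Icc le_rfl zero_le_one le_rfl hZ₁ cz
    rw [hA, hZ₁0] at this; linarith
  have hid : ∀ x ∈ Icc (0 : ℝ) 1, HasDerivWithinAt (fun y : ℝ => y) 1 (Icc 0 1) x :=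
    fun x _ => hasDerivWithinAt_id x _
  have hZ₂1 : Z₂ 1 = 0 := by
    have e1 := integral_deriv_Icc le_rfl zero_le_one le_rfl hZ₂ cZ₁
    have e2 := integral_mul_deriv_Icc hid hZ₁ continuousOn_const cz
    rw [hB, hZ₁1, hZ₁0] at e2
    simp only [one_mul] at e2
    rw [e2, hZ₂0] at e1
    linarith
  have key := h Z₂ Z₁ z hZ₂ hZ₁ cz hZ₂0 hZ₂1 hZ₁0 hZ₁1
  have e3 := integral_mul_deriv_Icc hQ₁ hZ₂ hq cZ₁
  have e4 := integral_mul_deriv_Icc hQ₂ hZ₁ cQ₁ cz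
  have hsq : ∫ x in (0 : ℝ)..1, 1 * z x ^ 2 = 0 := by
    have e5 : ∫ x in (0 : ℝ)..1, 1 * z x ^ 2 = ∫ x in (0 : ℝ)..1,
        (w x * z x + Q₂ x * z x - (A * z x + B * (x * z x))) := by
      refine integral_congr_Icc fun x _ => ?_
      simp only [hz, Pi.add_apply]; ring
    rw [e5, intervalIntegral.integral_sub, intervalIntegral.integral_add,
      intervalIntegral.integral_add, intervalIntegral.integral_const_mul,
      intervalIntegral.integral_const_mul, hA, hB, key, e3]
    · rw [e4]
      simp only [hZ₂0, hZ₂1, hZ₁0, hZ₁1]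
      ring
    · exact intervalIntegrable_Icc (continuousOn_const.mul cz)
    · exact intervalIntegrable_Icc (continuousOn_const.mul (continuousOn_id.mul cz))
    · exact intervalIntegrable_Icc (hw.mul cz)
    · exact intervalIntegrable_Icc (cQ₂.mul cz)
    · exact intervalIntegrable_Icc ((hw.mul cz).add (cQ₂.mul cz))
    · exact intervalIntegrable_Icc
        ((continuousOn_const.mul cz).add (continuousOn_const.mul (continuousOn_id.mul cz)))
  have hz0 := eq_zero_of_integral_mul_sq_eq_zero continuousOn_const (fun _ _ => one_pos) cz hsq
  have hweq : ∀ x ∈ Icc (0 : ℝ) 1, w x = A + B * x - Q₂ x := fun x hx => by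
    have := hz0 x hx
    simp only [hz, Pi.add_apply] at this; linarith
  refine ⟨fun x => B - Q₁ x, fun x hx => ?_, fun x hx => ?_⟩
  · exact ((hasDerivWithinAt_affine A B x).sub (hQ₂ x hx)).congr hweq (hweq x hx)
  · simpa using (hQ₁ x hx).const_sub B

end Calculus

/-! ### The test space and its gradient and mass forms. -/

section Forms

variable {V E : Type*}

/-- The functions that are continuously differentiable on the closed edges and continuous at the
vertices. -/
def testSpace (G : DiscreteGraph V E) : Submodule ℝ (E → ℝ → ℝ) where
  carrier := {f | (∀ e, ContDiffOn ℝ 1 (f e) (Icc 0 1)) ∧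
    ∃ φ : V → ℝ, ∀ e, f e 0 = φ (G.src e) ∧ f e 1 = φ (G.tgt e)}
  add_mem' := by
    rintro f h ⟨hf, φ, hφ⟩ ⟨hh, ψ, hψ⟩
    exact ⟨fun e => (hf e).add (hh e), φ + ψ, fun e => by
      simp [(hφ e).1, (hφ e).2, (hψ e).1, (hψ e).2]⟩
  zero_mem' := ⟨fun e => contDiffOn_const, 0, fun e => by simp⟩
  smul_mem' := by
    rintro c f ⟨hf, φ, hφ⟩
    exact ⟨fun e => (hf e).const_smul c, c • φ, fun e => by
      simp [(hφ e).1, (hφ e).2]⟩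

variable {G : DiscreteGraph V E}

theorem hasDerivWithinAt_of_contDiffOn {f : ℝ → ℝ} (hf : ContDiffOn ℝ 1 f (Icc 0 1)) {x : ℝ}
    (hx : x ∈ Icc (0 : ℝ) 1) : HasDerivWithinAt f (derivWithin f (Icc 0 1) x) (Icc 0 1) x :=
  (hf.differentiableOn one_ne_zero x hx).hasDerivWithinAt

theorem testSpace_hasDerivWithinAt (f : testSpace G) (e : E) {x : ℝ} (hx : x ∈ Icc (0 : ℝ) 1) :
    HasDerivWithinAt (f.1 e) (edgeDeriv f.1 e x) (Icc 0 1) x :=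
  hasDerivWithinAt_of_contDiffOn (f.2.1 e) hx

theorem testSpace_continuousOn (f : testSpace G) (e : E) : ContinuousOn (f.1 e) (Icc 0 1) :=
  (f.2.1 e).continuousOn

theorem testSpace_continuousOn_edgeDeriv (f : testSpace G) (e : E) :
    ContinuousOn (edgeDeriv f.1 e) (Icc 0 1) :=
  (f.2.1 e).continuousOn_derivWithin (uniqueDiffOn_Icc zero_lt_one) le_rfl

theorem edgeDeriv_add (f h : testSpace G) (e : E) {x : ℝ} (hx : x ∈ Icc (0 : ℝ) 1) :
    edgeDeriv (f + h).1 e x = edgeDeriv f.1 e x + edgeDeriv h.1 e x :=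
  derivWithin_Icc_eq hx ((testSpace_hasDerivWithinAt f e hx).add (testSpace_hasDerivWithinAt h e hx))

theorem edgeDeriv_smul (c : ℝ) (f : testSpace G) (e : E) {x : ℝ} (hx : x ∈ Icc (0 : ℝ) 1) :
    edgeDeriv (c • f).1 e x = c * edgeDeriv f.1 e x :=
  derivWithin_Icc_eq hx ((testSpace_hasDerivWithinAt f e hx).const_smul c)

variable [Fintype E]

/-- The bilinear form `∑ p_e ∫ f_e' h_e'`. -/
noncomputable def gradForm (G : DiscreteGraph V E) (p : E → ℝ) :
    testSpace G →ₗ[ℝ] testSpace G →ₗ[ℝ] ℝ :=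
  LinearMap.mk₂ ℝ
    (fun f h => ∑ e, p e * ∫ x in (0 : ℝ)..1, edgeDeriv f.1 e x * edgeDeriv h.1 e x)
    (fun f f' h => by
      rw [← Finset.sum_add_distrib]
      refine Finset.sum_congr rfl fun e _ => ?_
      rw [← mul_add, ← intervalIntegral.integral_add]
      · congr 1
        refine integral_congr_Icc fun x hx => ?_
        rw [edgeDeriv_add f f' e hx, add_mul]
      · exact intervalIntegrable_Icc
          ((testSpace_continuousOn_edgeDeriv _ e).mul (testSpace_continuousOn_edgeDeriv _ e))
      · exact intervalIntegrable_Icc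
          ((testSpace_continuousOn_edgeDeriv _ e).mul (testSpace_continuousOn_edgeDeriv _ e)))
    (fun c f h => by
      rw [smul_eq_mul, Finset.mul_sum]
      refine Finset.sum_congr rfl fun e _ => ?_
      rw [mul_left_comm, ← intervalIntegral.integral_const_mul c]
      congr 1
      refine integral_congr_Icc fun x hx => ?_
      rw [edgeDeriv_smul c f e hx, mul_assoc])
    (fun f h h' => by
      rw [← Finset.sum_add_distrib]
      refine Finset.sum_congr rfl fun e _ => ?_
      rw [← mul_add, ← intervalIntegral.integral_add]
      · congr 1
        refine integral_congr_Icc fun x hx => ?_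
        rw [edgeDeriv_add h h' e hx, mul_add]
      · exact intervalIntegrable_Icc
          ((testSpace_continuousOn_edgeDeriv _ e).mul (testSpace_continuousOn_edgeDeriv _ e))
      · exact intervalIntegrable_Icc
          ((testSpace_continuousOn_edgeDeriv _ e).mul (testSpace_continuousOn_edgeDeriv _ e)))
    (fun c f h => by
      rw [smul_eq_mul, Finset.mul_sum]
      refine Finset.sum_congr rfl fun e _ => ?_
      rw [mul_left_comm, ← intervalIntegral.integral_const_mul c]
      congr 1
      refine integral_congr_Icc fun x hx => ?_
      rw [edgeDeriv_smul c h e hx, mul_left_comm])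

theorem gradForm_apply (p : E → ℝ) (f h : testSpace G) : gradForm G p f h =
    ∑ e, p e * ∫ x in (0 : ℝ)..1, edgeDeriv f.1 e x * edgeDeriv h.1 e x := rfl

omit [Fintype E] in
theorem continuousOn_mass_mul {m : E → ℝ → ℝ} (hm : ∀ e, ContinuousOn (m e) (Icc 0 1))
    (f h : testSpace G) (e : E) :
    ContinuousOn (fun x => m e x * (f.1 e x * h.1 e x)) (Icc 0 1) :=
  (hm e).mul ((testSpace_continuousOn f e).mul (testSpace_continuousOn h e))

/-- The bilinear form `∑ ∫ m_e f_e h_e`. -/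
noncomputable def massForm (G : DiscreteGraph V E) (m : E → ℝ → ℝ)
    (hm : ∀ e, ContinuousOn (m e) (Icc 0 1)) :
    testSpace G →ₗ[ℝ] testSpace G →ₗ[ℝ] ℝ :=
  LinearMap.mk₂ ℝ
    (fun f h => ∑ e, ∫ x in (0 : ℝ)..1, m e x * (f.1 e x * h.1 e x))
    (fun f f' h => by
      rw [← Finset.sum_add_distrib]
      refine Finset.sum_congr rfl fun e _ => ?_
      rw [← intervalIntegral.integral_add (intervalIntegrable_Icc (continuousOn_mass_mul hm _ _ e))
        (intervalIntegrable_Icc (continuousOn_mass_mul hm _ _ e))]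
      refine integral_congr_Icc fun x hx => ?_
      simp only [Submodule.coe_add, Pi.add_apply]; ring)
    (fun c f h => by
      rw [smul_eq_mul, Finset.mul_sum]
      refine Finset.sum_congr rfl fun e _ => ?_
      rw [← intervalIntegral.integral_const_mul]
      refine integral_congr_Icc fun x hx => ?_
      simp only [Submodule.coe_smul, Pi.smul_apply, smul_eq_mul]; ring)
    (fun f h h' => by
      rw [← Finset.sum_add_distrib]
      refine Finset.sum_congr rfl fun e _ => ?_
      rw [← intervalIntegral.integral_add (intervalIntegrable_Icc (continuousOn_mass_mul hm _ _ e))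
        (intervalIntegrable_Icc (continuousOn_mass_mul hm _ _ e))]
      refine integral_congr_Icc fun x hx => ?_
      simp only [Submodule.coe_add, Pi.add_apply]; ring)
    (fun c f h => by
      rw [smul_eq_mul, Finset.mul_sum]
      refine Finset.sum_congr rfl fun e _ => ?_
      rw [← intervalIntegral.integral_const_mul]
      refine integral_congr_Icc fun x hx => ?_
      simp only [Submodule.coe_smul, Pi.smul_apply, smul_eq_mul]; ring)

theorem massForm_apply (m : E → ℝ → ℝ) (hm : ∀ e, ContinuousOn (m e) (Icc 0 1))
    (f h : testSpace G) : massForm G m hm f h =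
    ∑ e, ∫ x in (0 : ℝ)..1, m e x * (f.1 e x * h.1 e x) := rfl

theorem gradForm_comm (p : E → ℝ) (f h : testSpace G) : gradForm G p f h = gradForm G p h f := by
  simp only [gradForm_apply, mul_comm (edgeDeriv f.1 _ _)]

theorem massForm_comm (m : E → ℝ → ℝ) (hm : ∀ e, ContinuousOn (m e) (Icc 0 1))
    (f h : testSpace G) : massForm G m hm f h = massForm G m hm h f := by
  simp only [massForm_apply, mul_comm (f.1 _ _)]

theorem integral_mul_self_nonneg (f : ℝ → ℝ) : 0 ≤ ∫ x in (0 : ℝ)..1, f x * f x :=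
  intervalIntegral.integral_nonneg zero_le_one fun _ _ => mul_self_nonneg _

theorem gradForm_nonneg {p : E → ℝ} (h : ∀ e, 0 ≤ p e) (f : testSpace G) :
    0 ≤ gradForm G p f f :=
  Finset.sum_nonneg fun e _ => mul_nonneg (h e) (integral_mul_self_nonneg _)

theorem massForm_nonneg {m : E → ℝ → ℝ} {hm : ∀ e, ContinuousOn (m e) (Icc 0 1)}
    (h : ∀ e, ∀ x ∈ Icc (0 : ℝ) 1, 0 ≤ m e x) (f : testSpace G) : 0 ≤ massForm G m hm f f :=
  Finset.sum_nonneg fun e _ => intervalIntegral.integral_nonneg zero_le_one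
    fun x hx => mul_nonneg (h e x hx) (mul_self_nonneg _)

/-- Test functions are arbitrary outside `[0, 1]`, so the mass form is only semidefinite on the test
space. This identifies its null vectors as those vanishing on the closed edges. -/
theorem massForm_eq_zero {m : E → ℝ → ℝ} {hm : ∀ e, ContinuousOn (m e) (Icc 0 1)}
    (h : ∀ e, ∀ x ∈ Icc (0 : ℝ) 1, 0 < m e x) {f : testSpace G} (hf : massForm G m hm f f = 0)
    (e : E) {x : ℝ} (hx : x ∈ Icc (0 : ℝ) 1) : f.1 e x = 0 := by
  have h0 := (Finset.sum_eq_zero_iff_of_nonneg fun e _ =>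
    intervalIntegral.integral_nonneg zero_le_one
      fun x hx => mul_nonneg (h e x hx).le (mul_self_nonneg (f.1 e x))).1 hf e (Finset.mem_univ e)
  refine eq_zero_of_integral_mul_sq_eq_zero (hm e) (h e) (testSpace_continuousOn f e) ?_ x hx
  simpa only [pow_two] using h0

theorem gradForm_eq_zero {p : E → ℝ} (h : ∀ e, 0 < p e) {f : testSpace G}
    (hf : gradForm G p f f = 0) (e : E) {x : ℝ} (hx : x ∈ Icc (0 : ℝ) 1) :
    edgeDeriv f.1 e x = 0 := by
  have h0 := (Finset.sum_eq_zero_iff_of_nonneg fun e _ =>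
    mul_nonneg (h e).le (integral_mul_self_nonneg (edgeDeriv f.1 e))).1 hf e (Finset.mem_univ e)
  refine eq_zero_of_integral_mul_sq_eq_zero continuousOn_const (fun _ _ => one_pos)
    (testSpace_continuousOn_edgeDeriv f e) ?_ x hx
  simpa [pow_two, (h e).ne'] using h0

end Forms

/-! ### Very weak, weak and classical eigenfunctions. -/

section Regularity

variable {V E : Type*} {G : DiscreteGraph V E}

theorem contDiffOn_one_of_hasDerivWithinAt {f f₁ : ℝ → ℝ}
    (h : ∀ x ∈ Icc (0 : ℝ) 1, HasDerivWithinAt f (f₁ x) (Icc 0 1) x)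
    (hc : ContinuousOn f₁ (Icc 0 1)) : ContDiffOn ℝ 1 f (Icc 0 1) := by
  rw [show (1 : WithTop ℕ∞) = 0 + 1 from (zero_add 1).symm,
    contDiffOn_succ_iff_derivWithin (uniqueDiffOn_Icc zero_lt_one)]
  refine ⟨fun x hx => (h x hx).differentiableWithinAt, by simp, ?_⟩
  exact contDiffOn_zero.2 (hc.congr fun x hx => derivWithin_Icc_eq hx (h x hx))

theorem contDiffOn_two_of_hasDerivWithinAt {f f₁ f₂ : ℝ → ℝ}
    (h : ∀ x ∈ Icc (0 : ℝ) 1, HasDerivWithinAt f (f₁ x) (Icc 0 1) x)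
    (h₁ : ∀ x ∈ Icc (0 : ℝ) 1, HasDerivWithinAt f₁ (f₂ x) (Icc 0 1) x)
    (hc : ContinuousOn f₂ (Icc 0 1)) : ContDiffOn ℝ 2 f (Icc 0 1) := by
  rw [show (2 : WithTop ℕ∞) = 1 + 1 from one_add_one_eq_two.symm,
    contDiffOn_succ_iff_derivWithin (uniqueDiffOn_Icc zero_lt_one)]
  refine ⟨fun x hx => (h x hx).differentiableWithinAt, by simp, ?_⟩
  exact (contDiffOn_one_of_hasDerivWithinAt h₁ hc).congr
    fun x hx => derivWithin_Icc_eq hx (h x hx)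

variable [Fintype E] [DecidableEq V]

/-- A continuous function that satisfies the eigenvalue equation when tested against twice
differentiable functions, all derivatives being on the test function, is a classical solution that
satisfies the vertex condition. -/
theorem exists_strong_of_veryWeak {p : E → ℝ} {m F : E → ℝ → ℝ} {μ : ℝ} (hp : ∀ e, 0 < p e)
    (hm : ∀ e, ContinuousOn (m e) (Icc 0 1)) (hF : ∀ e, ContinuousOn (F e) (Icc 0 1))
    (h : ∀ φ φ₁ φ₂ : E → ℝ → ℝ,
      (∀ e, ∀ x ∈ Icc (0 : ℝ) 1, HasDerivWithinAt (φ e) (φ₁ e x) (Icc 0 1) x) →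
      (∀ e, ∀ x ∈ Icc (0 : ℝ) 1, HasDerivWithinAt (φ₁ e) (φ₂ e x) (Icc 0 1) x) →
      (∀ e, ContinuousOn (φ₂ e) (Icc 0 1)) →
      (∃ ψ : V → ℝ, ∀ e, φ e 0 = ψ (G.src e) ∧ φ e 1 = ψ (G.tgt e)) →
      ∑ e, p e * (F e 1 * φ₁ e 1 - F e 0 * φ₁ e 0 - ∫ x in (0 : ℝ)..1, F e x * φ₂ e x)
        = μ * ∑ e, ∫ x in (0 : ℝ)..1, m e x * (F e x * φ e x)) :
    ∃ F₁ : E → ℝ → ℝ,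
      (∀ e, ∀ x ∈ Icc (0 : ℝ) 1, HasDerivWithinAt (F e) (F₁ e x) (Icc 0 1) x) ∧
      (∀ e, ∀ x ∈ Icc (0 : ℝ) 1,
        HasDerivWithinAt (F₁ e) (-(μ * m e x * F e x / p e)) (Icc 0 1) x) ∧
      ∀ v, ∑ e, ((if G.src e = v then p e * F₁ e 0 else 0)
        - (if G.tgt e = v then p e * F₁ e 1 else 0)) = 0 := by
  classical
  have hq : ∀ e, ContinuousOn (fun x => μ * m e x * F e x / p e) (Icc 0 1) := fun e =>
    (((continuousOn_const.mul (hm e)).mul (hF e)).div_const _)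
  have hedge : ∀ e, ∃ w₁ : ℝ → ℝ,
      (∀ x ∈ Icc (0 : ℝ) 1, HasDerivWithinAt (F e) (w₁ x) (Icc 0 1) x) ∧
      ∀ x ∈ Icc (0 : ℝ) 1, HasDerivWithinAt w₁ (-(μ * m e x * F e x / p e)) (Icc 0 1) x := by
    intro e
    -- Test functions living on a single edge and flat at its ends see only the differential
    -- equation there.
    refine exists_hasDerivWithinAt_of_veryWeak (hF e) (hq e)
      fun φ φ₁ φ₂ hφ hφ₁ hφ₂ h0 h1 h2 h3 => ?_
    have hz : ∀ e' (x : ℝ), e' ≠ e → ∀ k : ℝ → ℝ, (Pi.single e k : E → ℝ → ℝ) e' x = 0 :=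
      fun e' x hne k => by rw [Pi.single_eq_of_ne hne]; rfl
    have := h (Pi.single e φ) (Pi.single e φ₁) (Pi.single e φ₂) ?_ ?_ ?_ ⟨0, fun e' => ?_⟩
    · rw [Finset.sum_eq_single e, Finset.sum_eq_single e] at this
      · simp only [Pi.single_eq_same, h2, h3] at this
        have e1 : ∫ x in (0 : ℝ)..1, μ * m e x * F e x / p e * φ x
            = μ / p e * ∫ x in (0 : ℝ)..1, m e x * (F e x * φ x) := by
          rw [← intervalIntegral.integral_const_mul]
          refine integral_congr_Icc fun x _ => by ring
        rw [e1]
        have this2 := this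
        have := hp e
        field_simp
        simp only [mul_zero, sub_zero, zero_sub, mul_assoc] at this2 ⊢
        linarith
      · intro e' _ hne
        simp [hz e' _ hne]
      · simp
      · intro e' _ hne
        simp [hz e' _ hne]
      · simp
    · intro e' x hx
      by_cases hne : e' = e
      · subst hne; simpa using hφ x hx
      · simp only [Pi.single_eq_of_ne hne]; exact hasDerivWithinAt_const x (Icc 0 1) (0 : ℝ)
    · intro e' x hx
      by_cases hne : e' = e
      · subst hne; simpa using hφ₁ x hx
      · simp only [Pi.single_eq_of_ne hne]; exact hasDerivWithinAt_const x (Icc 0 1) (0 : ℝ)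
    · intro e'
      by_cases hne : e' = e
      · subst hne; simpa using hφ₂
      · simp only [Pi.single_eq_of_ne hne]; exact continuousOn_const (c := (0 : ℝ))
    · by_cases hne : e' = e
      · subst hne; simp [h0, h1]
      · simp [hz e' _ hne]
  choose F₁ hF₁ hF₂ using hedge
  refine ⟨F₁, hF₁, hF₂, fun v => ?_⟩
  -- The test function that is affine on edges, `1` at `v` and `0` at the other vertices extracts
  -- the vertex condition at `v`; on a loop at `v` it is constantly `1`.
  set a : E → ℝ := fun e => if G.src e = v then 1 else 0 with ha
  set b : E → ℝ := fun e => if G.tgt e = v then 1 else 0 with hb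
  have key := h (fun e x => a e + (b e - a e) * x) (fun e _ => b e - a e) (fun e _ => 0)
    (fun e x hx => hasDerivWithinAt_affine _ _ _) (fun e x hx => hasDerivWithinAt_const _ _ _)
    (fun e => continuousOn_const) ⟨fun u => if u = v then 1 else 0, fun e => by simp [ha, hb]⟩
  rw [Finset.mul_sum, ← sub_eq_zero, ← Finset.sum_sub_distrib, ← neg_eq_zero,
    ← Finset.sum_neg_distrib] at key
  refine (Finset.sum_congr rfl fun e _ => ?_).trans key
  have hc₁ := continuousOn_of_hasDerivWithinAt (hF₂ e)
  have e1 := integral_mul_deriv_Icc (hF₂ e)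
    (fun x _ => hasDerivWithinAt_affine (a e) (b e - a e) x) (hq e).neg continuousOn_const
  have e2 := integral_deriv_Icc le_rfl zero_le_one le_rfl (hF₁ e) hc₁
  have e3 : ∫ x in (0 : ℝ)..1, -(μ * m e x * F e x / p e) * (a e + (b e - a e) * x)
      = - (μ / p e) * ∫ x in (0 : ℝ)..1, m e x * (F e x * (a e + (b e - a e) * x)) := by
    rw [← intervalIntegral.integral_const_mul]
    refine integral_congr_Icc fun x _ => by ring
  have e4 : μ * ∫ x in (0 : ℝ)..1, m e x * (F e x * (a e + (b e - a e) * x))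
      = - p e * ∫ x in (0 : ℝ)..1, -(μ * m e x * F e x / p e) * (a e + (b e - a e) * x) := by
    rw [e3]
    have := hp e
    field_simp
  rw [e4, e1, intervalIntegral.integral_mul_const (b e - a e), e2]
  have ia : (if G.src e = v then p e * F₁ e 0 else 0) = a e * (p e * F₁ e 0) := by simp [ha]
  have ib : (if G.tgt e = v then p e * F₁ e 1 else 0) = b e * (p e * F₁ e 1) := by simp [hb]
  rw [ia, ib]
  simp only [mul_zero, intervalIntegral.integral_zero]
  ring

/-- Weak solutions of the eigenvalue equation. -/
noncomputable def weakEigenspace (G : DiscreteGraph V E) (p : E → ℝ) (m : E → ℝ → ℝ)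
    (hm : ∀ e, ContinuousOn (m e) (Icc 0 1)) (μ : ℝ) : Submodule ℝ (testSpace G) :=
  LinearMap.ker (gradForm G p - μ • massForm G m hm)

omit [DecidableEq V] in
theorem mem_weakEigenspace {p : E → ℝ} {m : E → ℝ → ℝ} {hm : ∀ e, ContinuousOn (m e) (Icc 0 1)}
    {μ : ℝ} {f : testSpace G} : f ∈ weakEigenspace G p m hm μ ↔
      ∀ h, gradForm G p f h = μ * massForm G m hm f h := by
  rw [weakEigenspace, LinearMap.mem_ker, LinearMap.ext_iff]
  simp [sub_eq_zero]

/-- The conductances `1 / √g` of a metric. -/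
noncomputable def conductance (g : E → ℝ) (e : E) : ℝ := (√(g e))⁻¹

/-- The mass density `√g ρ` with respect to the edge parameter. -/
noncomputable def massDensity (g : E → ℝ) (ρ : E → ℝ → ℝ) (e : E) (x : ℝ) : ℝ := √(g e) * ρ e x

omit [Fintype E] in
theorem continuousOn_massDensity {g : E → ℝ} {ρ : E → ℝ → ℝ} (h : IsMetricDensity g ρ) (e : E) :
    ContinuousOn (massDensity g ρ e) (Icc 0 1) :=
  continuousOn_const.mul (h.2.1 e).continuousOn

omit [Fintype E] in
theorem conductance_pos {g : E → ℝ} {ρ : E → ℝ → ℝ} (h : IsMetricDensity g ρ) (e : E) :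
    0 < conductance g e := inv_pos.2 (Real.sqrt_pos.2 (h.1 e))

omit [Fintype E] in
theorem massDensity_pos {g : E → ℝ} {ρ : E → ℝ → ℝ} (h : IsMetricDensity g ρ) (e : E) (x : ℝ)
    (hx : x ∈ Icc (0 : ℝ) 1) : 0 < massDensity g ρ e x :=
  mul_pos (Real.sqrt_pos.2 (h.1 e)) (h.2.2 e x hx)

/-- With conductance `1/√g` and mass `√g ρ` their quotient is `g ρ`, so the equation becomes `f'' =
-g μ ρ f`, and the weighted derivatives at the ends are the arc-length derivatives. -/
theorem isEigenfunction_of_strong {g : E → ℝ} {ρ : E → ℝ → ℝ} (hgρ : IsMetricDensity g ρ) {μ : ℝ}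
    {F F₁ : E → ℝ → ℝ} (h0 : ∃ e, ∃ x ∈ Icc (0 : ℝ) 1, F e x ≠ 0)
    (hv : ∃ φ : V → ℝ, ∀ e, F e 0 = φ (G.src e) ∧ F e 1 = φ (G.tgt e))
    (h₁ : ∀ e, ∀ x ∈ Icc (0 : ℝ) 1, HasDerivWithinAt (F e) (F₁ e x) (Icc 0 1) x)
    (h₂ : ∀ e, ∀ x ∈ Icc (0 : ℝ) 1, HasDerivWithinAt (F₁ e)
      (-(μ * massDensity g ρ e x * F e x / conductance g e)) (Icc 0 1) x)
    (hK : ∀ v, ∑ e, ((if G.src e = v then conductance g e * F₁ e 0 else 0)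
        - (if G.tgt e = v then conductance g e * F₁ e 1 else 0)) = 0) :
    IsEigenfunction G g ρ μ F := by
  have hd : ∀ e, ∀ x ∈ Icc (0 : ℝ) 1, edgeDeriv F e x = F₁ e x :=
    fun e x hx => derivWithin_Icc_eq hx (h₁ e x hx)
  refine ⟨h0, fun e => contDiffOn_two_of_hasDerivWithinAt (h₁ e) (h₂ e) ?_, hv, fun e x hx => ?_,
    fun v => ?_⟩
  · exact (((continuousOn_const.mul (continuousOn_massDensity hgρ e)).mul
      (continuousOn_of_hasDerivWithinAt (h₁ e))).div_const _).neg
  · have : edgeDeriv (edgeDeriv F) e x = -(μ * massDensity g ρ e x * F e x / conductance g e) :=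
      derivWithin_Icc_eq hx ((h₂ e x hx).congr (hd e) (hd e x hx))
    rw [laplacian, this, massDensity, conductance]
    have h3 := hgρ.1 e
    have h4 := Real.sqrt_pos.2 h3
    field_simp
    rw [Real.sq_sqrt h3.le]
    ring
  · refine (Finset.sum_congr rfl fun e _ => ?_).trans (hK v)
    rw [hd e 0 (by simp), hd e 1 (by simp), conductance]
    split_ifs <;> simp [div_eq_inv_mul, sub_eq_add_neg]

theorem strong_of_isEigenfunction {g : E → ℝ} {ρ : E → ℝ → ℝ} (hgρ : IsMetricDensity g ρ) {μ : ℝ}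
    {F : E → ℝ → ℝ} (hF : IsEigenfunction G g ρ μ F) :
    (∀ e, ∀ x ∈ Icc (0 : ℝ) 1, HasDerivWithinAt (F e) (edgeDeriv F e x) (Icc 0 1) x) ∧
    (∀ e, ∀ x ∈ Icc (0 : ℝ) 1,
      HasDerivWithinAt (edgeDeriv F e) (-(g e * μ * ρ e x * F e x)) (Icc 0 1) x) := by
  refine ⟨fun e x hx => hasDerivWithinAt_of_contDiffOn ((hF.smooth e).of_le one_le_two) hx,
    fun e x hx => ?_⟩
  have h1 : ContDiffOn ℝ 1 (edgeDeriv F e) (Icc 0 1) :=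
    (hF.smooth e).derivWithin (uniqueDiffOn_Icc zero_lt_one) (by norm_num)
  have h2 := hasDerivWithinAt_of_contDiffOn h1 hx
  have h3 := hF.equation e x hx
  rw [laplacian] at h3
  change -(derivWithin (edgeDeriv F e) (Icc 0 1) x / g e) = _ at h3
  have h4 := hgρ.1 e
  convert h2 using 1
  field_simp at h3
  linarith

/-- The element of the test space given by an eigenfunction. -/
def IsEigenfunction.toTest {g : E → ℝ} {ρ : E → ℝ → ℝ} {μ : ℝ} {F : E → ℝ → ℝ}
    (hF : IsEigenfunction G g ρ μ F) : testSpace G :=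
  ⟨F, fun e => (hF.smooth e).of_le one_le_two, hF.continuous⟩

/-- Integrating by parts leaves boundary terms. Grouped by vertex, they are the vertex values of the
test function times the outward derivative sums, which vanish. -/
theorem IsEigenfunction.mem_weakEigenspace {g : E → ℝ} {ρ : E → ℝ → ℝ}
    (hgρ : IsMetricDensity g ρ) {μ : ℝ} {F : E → ℝ → ℝ} [Fintype V]
    (hF : IsEigenfunction G g ρ μ F) :
    hF.toTest ∈ weakEigenspace G (conductance g) (massDensity g ρ)
      (continuousOn_massDensity hgρ) μ := by
  rw [DiscreteGraph.mem_weakEigenspace]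
  intro h
  obtain ⟨h₁, h₂⟩ := strong_of_isEigenfunction hgρ hF
  obtain ⟨ψ, hψ⟩ := h.2.2
  have hK : ∑ v, ψ v * outwardDerivSum G g F v = 0 :=
    Finset.sum_eq_zero fun v _ => by rw [hF.vertex v, mul_zero]
  simp only [outwardDerivSum, Finset.mul_sum] at hK
  rw [Finset.sum_comm] at hK
  rw [gradForm_apply, massForm_apply, Finset.mul_sum, ← sub_eq_zero, ← Finset.sum_sub_distrib,
    ← neg_eq_zero, ← Finset.sum_neg_distrib]
  refine (Finset.sum_congr rfl fun e _ => ?_).trans hK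
  simp only [mul_add, Finset.sum_add_distrib, mul_ite, mul_zero, Finset.sum_ite_eq,
    Finset.mem_univ, if_true]
  rw [← (hψ e).1, ← (hψ e).2]
  have c₂ : ContinuousOn (fun x => -(g e * μ * ρ e x * F e x)) (Icc 0 1) :=
    ((continuousOn_const.mul (hgρ.2.1 e).continuousOn).mul (hF.smooth e).continuousOn).neg
  have ibp := integral_mul_deriv_Icc (h₂ e)
    (fun x hx => testSpace_hasDerivWithinAt h e hx) c₂ (testSpace_continuousOn_edgeDeriv h e)
  have e1 : ∫ x in (0 : ℝ)..1, -(g e * μ * ρ e x * F e x) * h.1 e x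
      = -(√(g e) * μ) * ∫ x in (0 : ℝ)..1, massDensity g ρ e x * (F e x * h.1 e x) := by
    rw [← intervalIntegral.integral_const_mul]
    refine integral_congr_Icc fun x _ => ?_
    rw [massDensity]
    linear_combination (μ * ρ e x * F e x * h.1 e x) * (Real.mul_self_sqrt (hgρ.1 e).le)
  rw [e1] at ibp
  have h4 := Real.sqrt_pos.2 (hgρ.1 e)
  rw [conductance]
  change -((√(g e))⁻¹ * (∫ x in (0 : ℝ)..1, edgeDeriv F e x * edgeDeriv h.1 e x) -
    μ * ∫ x in (0 : ℝ)..1, massDensity g ρ e x * (F e x * h.1 e x)) = _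
  have e2 : ∫ x in (0 : ℝ)..1, edgeDeriv F e x * edgeDeriv h.1 e x = edgeDeriv F e 1 * h.1 e 1
      - edgeDeriv F e 0 * h.1 e 0
      + √(g e) * μ * ∫ x in (0 : ℝ)..1, massDensity g ρ e x * (F e x * h.1 e x) := by
    linarith
  rw [e2]
  field_simp
  ring

/-- One integration by parts moves the remaining derivative to a twice differentiable test function,
and the regularity theorem for very weak solutions applies. -/
theorem isEigenfunction_of_mem_weakEigenspace {g : E → ℝ} {ρ : E → ℝ → ℝ}
    (hgρ : IsMetricDensity g ρ) {μ : ℝ} {f : testSpace G}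
    (hf : f ∈ weakEigenspace G (conductance g) (massDensity g ρ)
      (continuousOn_massDensity hgρ) μ) (h0 : ∃ e, ∃ x ∈ Icc (0 : ℝ) 1, f.1 e x ≠ 0) :
    IsEigenfunction G g ρ μ f.1 := by
  rw [mem_weakEigenspace] at hf
  obtain ⟨F₁, h₁, h₂, h₃⟩ := exists_strong_of_veryWeak (G := G) (F := f.1) (μ := μ)
    (conductance_pos hgρ) (continuousOn_massDensity hgρ) (testSpace_continuousOn f) (by
      intro φ φ₁ φ₂ hφ hφ₁ hφ₂ hψ
      have hc := fun e => continuousOn_of_hasDerivWithinAt (hφ₁ e)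
      have := hf ⟨φ, fun e => contDiffOn_one_of_hasDerivWithinAt (hφ e) (hc e), hψ⟩
      rw [gradForm_apply, massForm_apply] at this
      rw [← this]
      refine Finset.sum_congr rfl fun e _ => ?_
      have ibp := integral_mul_deriv_Icc (fun x hx => testSpace_hasDerivWithinAt f e hx)
        (hφ₁ e) (testSpace_continuousOn_edgeDeriv f e) (hφ₂ e)
      rw [← ibp]
      congr 1
      refine integral_congr_Icc fun x hx => ?_
      rw [show edgeDeriv φ e x = φ₁ e x from derivWithin_Icc_eq hx (hφ e x hx)])
  exact isEigenfunction_of_strong hgρ h0 f.2.2 h₁ h₂ h₃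

end Regularity

/-! ### Compactness of energy-bounded sets in the uniform topology. -/

section Compactness

/-- Cauchy-Schwarz for the increments of a function in terms of its Dirichlet integral. -/
theorem sq_sub_le_mul_integral {f f₁ : ℝ → ℝ} {x y : ℝ} (hx : 0 ≤ x) (hxy : x ≤ y) (hy : y ≤ 1)
    (h : ∀ z ∈ Icc (0 : ℝ) 1, HasDerivWithinAt f (f₁ z) (Icc 0 1) z)
    (hc : ContinuousOn f₁ (Icc 0 1)) :
    (f y - f x) ^ 2 ≤ (y - x) * ∫ z in (0 : ℝ)..1, f₁ z * f₁ z := by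
  have hsub : Icc x y ⊆ Icc (0 : ℝ) 1 := Icc_subset_Icc hx hy
  have hc' : ContinuousOn f₁ (Icc x y) := hc.mono hsub
  have i1 : IntervalIntegrable f₁ MeasureTheory.volume x y := hc'.intervalIntegrable_of_Icc hxy
  have i2 : IntervalIntegrable (fun z => f₁ z * f₁ z) MeasureTheory.volume x y :=
    (hc'.mul hc').intervalIntegrable_of_Icc hxy
  have hmono : ∫ z in x..y, f₁ z * f₁ z ≤ ∫ z in (0 : ℝ)..1, f₁ z * f₁ z :=
    intervalIntegral.integral_mono_interval hx hxy hy
      (Eventually.of_forall fun z => mul_self_nonneg _) (intervalIntegrable_Icc (hc.mul hc))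
  rcases hxy.eq_or_lt with rfl | hlt
  · simp
  · have hd : 0 < y - x := sub_pos.2 hlt
    -- The inequality is `∫ (f₁ - s)² ≥ 0` for the mean slope `s`.
    set s := (f y - f x) / (y - x)
    have h0 : 0 ≤ ∫ z in x..y, (f₁ z * f₁ z - (2 * s * f₁ z - s ^ 2)) := by
      refine intervalIntegral.integral_nonneg hxy fun z _ => ?_
      nlinarith [sq_nonneg (f₁ z - s)]
    rw [intervalIntegral.integral_sub i2 ((i1.const_mul _).sub (by simp)),
      intervalIntegral.integral_sub (i1.const_mul _) (by simp),
      intervalIntegral.integral_const_mul, integral_deriv_Icc hx hxy hy h hc,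
      intervalIntegral.integral_const] at h0
    have hs : f y - f x = s * (y - x) := by simp only [s]; field_simp
    rw [hs] at h0 ⊢
    simp only [smul_eq_mul] at h0
    calc (s * (y - x)) ^ 2 = (y - x) * (s * s * (y - x)) := by ring
      _ ≤ _ := mul_le_mul_of_nonneg_left (by nlinarith) hd.le

/-- Since `f(x)² ≤ 2 f(y)² + 2 (f(x) - f(y))²` and squared increments are at most `C`, averaging
over `y` gives `2C + 2C`. -/
theorem sq_le_of_integral_le {f f₁ : ℝ → ℝ} {C : ℝ}
    (h : ∀ z ∈ Icc (0 : ℝ) 1, HasDerivWithinAt f (f₁ z) (Icc 0 1) z)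
    (hc : ContinuousOn f₁ (Icc 0 1)) (h1 : ∫ z in (0 : ℝ)..1, f₁ z * f₁ z ≤ C)
    (h2 : ∫ z in (0 : ℝ)..1, f z * f z ≤ C) {x : ℝ} (hx : x ∈ Icc (0 : ℝ) 1) :
    f x ^ 2 ≤ 4 * C := by
  have hcf := continuousOn_of_hasDerivWithinAt h
  have hCn : 0 ≤ C := (integral_mul_self_nonneg f₁).trans h1
  have hinc : ∀ y ∈ Icc (0 : ℝ) 1, (f x - f y) ^ 2 ≤ C := by
    intro y hy
    rcases le_total x y with hxy | hxy
    · have := sq_sub_le_mul_integral hx.1 hxy hy.2 h hc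
      nlinarith [hx.1, hy.2]
    · have := sq_sub_le_mul_integral hy.1 hxy hx.2 h hc
      nlinarith [hy.1, hx.2]
  have : ∫ y in (0 : ℝ)..1, f x ^ 2 ≤ ∫ y in (0 : ℝ)..1, (2 * (f y * f y) + 2 * C) := by
    refine intervalIntegral.integral_mono_on zero_le_one (by simp)
      (intervalIntegrable_Icc
        ((continuousOn_const.mul (hcf.mul hcf)).add continuousOn_const)) fun y hy => ?_
    nlinarith [hinc y hy, sq_nonneg (f x - 2 * f y)]
  have i1 : IntervalIntegrable (fun y => 2 * (f y * f y)) MeasureTheory.volume 0 1 :=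
    intervalIntegrable_Icc (continuousOn_const.mul (hcf.mul hcf))
  rw [intervalIntegral.integral_add i1 (by simp),
    intervalIntegral.integral_const_mul] at this
  simp only [intervalIntegral.integral_const, sub_zero, one_smul] at this
  linarith

/-- Arzelà–Ascoli: the second condition is a Hölder bound of exponent `1/2`, hence equicontinuity,
and both conditions are closed. -/
theorem isCompact_bounded_holder (M : ℝ) :
    IsCompact {h : C(Icc (0 : ℝ) 1, ℝ) | (∀ x, h x ^ 2 ≤ M) ∧
      ∀ x y, (h x - h y) ^ 2 ≤ M * dist x y} := by
  set S := {h : C(Icc (0 : ℝ) 1, ℝ) | (∀ x, h x ^ 2 ≤ M) ∧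
      ∀ x y, (h x - h y) ^ 2 ≤ M * dist x y}
  have hS : IsClosed S := by
    refine IsClosed.inter ?_ ?_
    · change IsClosed {h : C(Icc (0 : ℝ) 1, ℝ) | ∀ x, h x ^ 2 ≤ M}
      simp only [ofPred_forall]
      exact isClosed_iInter fun x => isClosed_le (by fun_prop) continuous_const
    · change IsClosed {h : C(Icc (0 : ℝ) 1, ℝ) | ∀ x y, (h x - h y) ^ 2 ≤ M * dist x y}
      simp only [ofPred_forall]
      exact isClosed_iInter fun x => isClosed_iInter fun y =>
        isClosed_le (by fun_prop) continuous_const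
  let e := ContinuousMap.isometryEquivBoundedOfCompact (Icc (0 : ℝ) 1) ℝ
  have key : IsCompact (e.symm ⁻¹' S) := by
    refine BoundedContinuousFunction.arzela_ascoli₂ (Icc (-√M) (√M)) isCompact_Icc _
      (hS.preimage e.symm.continuous) (fun f x hf => ?_) ?_
    · have := hf.1 x
      exact abs_le.1 (Real.abs_le_sqrt this)
    · refine Metric.equicontinuous_of_continuity_modulus (fun d => √(M * d)) ?_ _ ?_
      · have : Continuous fun d : ℝ => √(M * d) := by fun_prop
        simpa using this.tendsto 0
      · rintro x y ⟨f, hf⟩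
        rw [Real.dist_eq]
        exact Real.abs_le_sqrt (hf.2 x y)
  have := key.image e.symm.continuous
  rwa [image_preimage_eq _ e.symm.surjective] at this

variable {V E : Type*} {G : DiscreteGraph V E}

/-- The restrictions of a test function to the closed edges. -/
noncomputable def toEdges (f : testSpace G) (e : E) : C(Icc (0 : ℝ) 1, ℝ) :=
  ⟨domRestrict (Icc (0 : ℝ) 1) (f.1 e),
    continuousOn_iff_continuous_domRestrict.1 (testSpace_continuousOn f e)⟩

theorem toEdges_apply (f : testSpace G) (e : E) (x : Icc (0 : ℝ) 1) :
    toEdges f e x = f.1 e x := rfl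

theorem exists_pos_lower_bound [Fintype E] {p : E → ℝ} {m : E → ℝ → ℝ} (hp : ∀ e, 0 < p e)
    (hm : ∀ e, ContinuousOn (m e) (Icc 0 1)) (hm0 : ∀ e, ∀ x ∈ Icc (0 : ℝ) 1, 0 < m e x) :
    ∃ s : ℝ, 0 < s ∧ (∀ e, s ≤ p e) ∧ ∀ e, ∀ x ∈ Icc (0 : ℝ) 1, s ≤ m e x := by
  have h1 : ∀ e, ∃ s : ℝ, 0 < s ∧ s ≤ p e ∧ ∀ x ∈ Icc (0 : ℝ) 1, s ≤ m e x := by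
    intro e
    obtain ⟨x₀, hx₀, hmin⟩ := isCompact_Icc.exists_isMinOn (nonempty_Icc.2 zero_le_one) (hm e)
    exact ⟨min (p e) (m e x₀), lt_min (hp e) (hm0 e x₀ hx₀), min_le_left _ _,
      fun x hx => (min_le_right _ _).trans (hmin hx)⟩
  choose s hs0 hsp hsm using h1
  rcases isEmpty_or_nonempty E with hE | hE
  · exact ⟨1, one_pos, fun e => isEmptyElim e, fun e => isEmptyElim e⟩
  · obtain ⟨e₀, he₀⟩ := Finite.exists_min s
    exact ⟨s e₀, hs0 e₀, fun e => (he₀ e).trans (hsp e),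
      fun e x hx => (he₀ e).trans (hsm e x hx)⟩

/-- This plays the part of the compact embedding of `H¹` into the continuous functions: positive
lower bounds on the coefficients turn the form bound into a sup bound and a Hölder bound on each
edge. -/
theorem exists_compact_toEdges_mem [Fintype E] {p : E → ℝ} {m : E → ℝ → ℝ} (hp : ∀ e, 0 < p e)
    (hm : ∀ e, ContinuousOn (m e) (Icc 0 1)) (hm0 : ∀ e, ∀ x ∈ Icc (0 : ℝ) 1, 0 < m e x)
    (C : ℝ) : ∃ K : Set (E → C(Icc (0 : ℝ) 1, ℝ)), IsCompact K ∧
      ∀ f : testSpace G, gradForm G p f f + massForm G m hm f f ≤ C → toEdges f ∈ K := by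
  obtain ⟨s, hs, hsp, hsm⟩ := exists_pos_lower_bound hp hm hm0
  refine ⟨_, isCompact_univ_pi fun e : E => isCompact_bounded_holder (4 * (C / s)), ?_⟩
  intro f hf e _
  have hg := gradForm_nonneg (fun e => (hp e).le) f
  have hmn := massForm_nonneg (hm := hm) (fun e x hx => (hm0 e x hx).le) f
  have hd := fun x (hx : x ∈ Icc (0 : ℝ) 1) => testSpace_hasDerivWithinAt f e hx
  have hcd := testSpace_continuousOn_edgeDeriv f e
  have b1 : ∫ x in (0 : ℝ)..1, edgeDeriv f.1 e x * edgeDeriv f.1 e x ≤ C / s := by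
    rw [le_div_iff₀' hs]
    have h1 := Finset.single_le_sum (fun e _ => mul_nonneg (hp e).le
      (integral_mul_self_nonneg (edgeDeriv f.1 e))) (Finset.mem_univ e)
    have h2 := mul_le_mul_of_nonneg_right (hsp e) (integral_mul_self_nonneg (edgeDeriv f.1 e))
    rw [gradForm_apply] at hf
    linarith
  have b2 : ∫ x in (0 : ℝ)..1, f.1 e x * f.1 e x ≤ C / s := by
    rw [le_div_iff₀' hs, ← intervalIntegral.integral_const_mul]
    have h1 := Finset.single_le_sum (f := fun e => ∫ x in (0 : ℝ)..1, m e x * (f.1 e x * f.1 e x))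
      (fun e _ => intervalIntegral.integral_nonneg zero_le_one
        fun x hx => mul_nonneg (hm0 e x hx).le (mul_self_nonneg (f.1 e x))) (Finset.mem_univ e)
    have hcf := testSpace_continuousOn f e
    have h2 : ∫ x in (0 : ℝ)..1, s * (f.1 e x * f.1 e x) ≤
        ∫ x in (0 : ℝ)..1, m e x * (f.1 e x * f.1 e x) :=
      intervalIntegral.integral_mono_on zero_le_one
        (intervalIntegrable_Icc (continuousOn_const.mul (hcf.mul hcf)))
        (intervalIntegrable_Icc (continuousOn_mass_mul hm f f e))
        fun x hx => mul_le_mul_of_nonneg_right (hsm e x hx) (mul_self_nonneg _)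
    rw [massForm_apply] at hf
    linarith
  have hCs : 0 ≤ C / s := (integral_mul_self_nonneg _).trans b1
  have main : ∀ x y : Icc (0 : ℝ) 1, x ≤ y →
      (f.1 e y - f.1 e x) ^ 2 ≤ 4 * (C / s) * dist x y := by
    intro x y hxy
    have hxy' : (x : ℝ) ≤ y := hxy
    have h1 := sq_sub_le_mul_integral x.2.1 hxy' y.2.2 hd hcd
    rw [Subtype.dist_eq, Real.dist_eq, abs_sub_comm, abs_of_nonneg (sub_nonneg.2 hxy')]
    have h2 := mul_le_mul_of_nonneg_left b1 (sub_nonneg.2 hxy')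
    have h3 : 0 ≤ ((y : ℝ) - x) * (C / s) := mul_nonneg (sub_nonneg.2 hxy') hCs
    nlinarith
  refine ⟨fun x => sq_le_of_integral_le hd hcd b1 b2 x.2, fun x y => ?_⟩
  rcases le_total x y with h | h
  · have := main x y h
    rw [toEdges_apply, toEdges_apply]
    nlinarith
  · rw [dist_comm]
    exact main y x h

/-- The integral of a continuous function on the closed edges. -/
noncomputable def edgeIntegral [Fintype E] (h : E → C(Icc (0 : ℝ) 1, ℝ)) : ℝ :=
  ∑ e, ∫ x in (0 : ℝ)..1, h e (projIcc 0 1 zero_le_one x)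

theorem continuous_edgeIntegral [Fintype E] :
    Continuous (edgeIntegral : (E → C(Icc (0 : ℝ) 1, ℝ)) → ℝ) := by
  refine continuous_finsetSum _ fun e _ => ?_
  refine intervalIntegral.continuous_parametric_intervalIntegral_of_continuous' ?_ 0 1
  have h1 : Continuous fun q : (E → C(Icc (0 : ℝ) 1, ℝ)) × ℝ => q.1 e :=
    (continuous_apply e).comp continuous_fst
  have h2 : Continuous fun q : (E → C(Icc (0 : ℝ) 1, ℝ)) × ℝ =>
    projIcc (0 : ℝ) 1 zero_le_one q.2 := continuous_projIcc.comp continuous_snd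
  exact h1.eval h2

theorem edgeIntegral_eq [Fintype E] {h : E → C(Icc (0 : ℝ) 1, ℝ)} {w : E → ℝ → ℝ}
    (hw : ∀ e (x : Icc (0 : ℝ) 1), h e x = w e x) :
    edgeIntegral h = ∑ e, ∫ x in (0 : ℝ)..1, w e x := by
  refine Finset.sum_congr rfl fun e _ => integral_congr_Icc fun x hx => ?_
  rw [projIcc_of_mem _ hx, hw]

/-- The bundled restriction to `[0, 1]` of functions that are continuous there. -/
def restrictEdges (w : E → ℝ → ℝ) (hw : ∀ e, ContinuousOn (w e) (Icc 0 1)) (e : E) :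
    C(Icc (0 : ℝ) 1, ℝ) :=
  ⟨domRestrict (Icc (0 : ℝ) 1) (w e), continuousOn_iff_continuous_domRestrict.1 (hw e)⟩

theorem massForm_eq_edgeIntegral [Fintype E] {m : E → ℝ → ℝ}
    (hm : ∀ e, ContinuousOn (m e) (Icc 0 1)) (f h : testSpace G) :
    massForm G m hm f h = edgeIntegral (restrictEdges m hm * (toEdges f * toEdges h)) :=
  (edgeIntegral_eq fun _ _ => rfl).symm

end Compactness

/-! ### Existence of the next eigenfunction by the direct method. -/

section Attainment

variable {V E : Type*} {G : DiscreteGraph V E} [Fintype V] [Fintype E] [DecidableEq V]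

/-- `y` is a next mode after `e 0, …, e (n - 1)`: a normalised weak eigenvector orthogonal to them
that minimises the Rayleigh quotient of `a` and `b` among the vectors orthogonal to them. -/
structure IsNextMode {X : Type*} [AddCommGroup X] [Module ℝ X] (a b : X →ₗ[ℝ] X →ₗ[ℝ] ℝ) {n : ℕ}
    (e : Fin n → X) (y : X) : Prop where
  normalized : b y y = 1
  orthogonal : ∀ i, b (e i) y = 0
  weak : ∀ h, a y h = a y y * b y h
  minimal : ∀ f, (∀ i, b (e i) f = 0) → a y y * b f f ≤ a f f

/-- The test functions `x (1 - x) q(x)` on all edges, `q` a polynomial. -/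
noncomputable def bubble (G : DiscreteGraph V E) : Polynomial ℝ →ₗ[ℝ] testSpace G where
  toFun q := ⟨fun _ x => x * (1 - x) * q.eval x, fun e => by
    have h1 : ContDiff ℝ 1 fun x : ℝ => x * (1 - x) := by fun_prop
    have h2 : ContDiff ℝ 1 fun x : ℝ => q.eval x := by
      simpa [Polynomial.aeval_def] using q.contDiff_aeval (𝕜 := ℝ) 1
    exact (h1.mul h2).contDiffOn, 0, fun e => by simp⟩
  map_add' q r := by ext e x; simp [mul_add]
  map_smul' c q := by ext e x; simp; ring

omit [Fintype V] [DecidableEq V] in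
-- The `n` orthogonality conditions have a nonzero solution among the `n + 1` dimensions of bubbles
-- with polynomial factor of degree at most `n`. Bubbles vanish at all vertices, so they are test
-- functions on any graph.
theorem exists_orthogonal_normalized [Nonempty E] {m : E → ℝ → ℝ}
    (hm : ∀ e, ContinuousOn (m e) (Icc 0 1)) (hm0 : ∀ e, ∀ x ∈ Icc (0 : ℝ) 1, 0 < m e x)
    {n : ℕ} (e : Fin n → testSpace G) :
    ∃ f, massForm G m hm f f = 1 ∧ ∀ i, massForm G m hm (e i) f = 0 := by
  let T : Polynomial.degreeLT ℝ (n + 1) →ₗ[ℝ] (Fin n → ℝ) :=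
    LinearMap.pi fun i => (massForm G m hm (e i)).comp ((bubble G).comp (Submodule.subtype _))
  have hker : LinearMap.ker T ≠ ⊥ := by
    refine LinearMap.ker_ne_bot_of_finrank_lt ?_
    rw [(Polynomial.degreeLTEquiv ℝ (n + 1)).finrank_eq]
    simp
  obtain ⟨⟨q, hq⟩, hqT, hq0⟩ := (Submodule.ne_bot_iff _).1 hker
  have hq0 : q ≠ 0 := fun h => hq0 (by simpa using h)
  set f := bubble G q
  have horth : ∀ i, massForm G m hm (e i) f = 0 := fun i => congrFun (LinearMap.mem_ker.1 hqT) i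
  have hpos : 0 < massForm G m hm f f := by
    refine (massForm_nonneg (fun e x hx => (hm0 e x hx).le) f).lt_of_ne' fun h0 => ?_
    obtain ⟨e₀⟩ := ‹Nonempty E›
    -- On `(0, 1)` the factor `x (1 - x)` is nonzero, so a bubble of zero mass forces `q` to vanish
    -- at infinitely many points.
    refine hq0 (Polynomial.eq_zero_of_infinite_isRoot q
      ((Ioo_infinite (zero_lt_one (α := ℝ))).mono fun x hx => ?_))
    have := massForm_eq_zero hm0 h0 e₀ (x := x) ⟨hx.1.le, hx.2.le⟩
    have h2 : x * (1 - x) * q.eval x = 0 := this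
    have h3 : 0 < x * (1 - x) := mul_pos hx.1 (sub_pos.2 hx.2)
    exact (mul_eq_zero.1 h2).resolve_left h3.ne'
  refine ⟨(√(massForm G m hm f f))⁻¹ • f, ?_, fun i => by simp [horth i]⟩
  have h4 := Real.sqrt_pos.2 hpos
  simp only [map_smul, LinearMap.smul_apply, smul_eq_mul]
  field_simp
  rw [Real.sq_sqrt hpos.le]

/-- Cauchy-Schwarz for a symmetric form that is nonnegative on a subspace. -/
theorem sq_apply_le_of_nonneg {X : Type*} [AddCommGroup X] [Module ℝ X]
    (B : X →ₗ[ℝ] X →ₗ[ℝ] ℝ) (hB : ∀ x y, B x y = B y x) (Y : Submodule ℝ X)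
    (hY : ∀ x ∈ Y, 0 ≤ B x x) {x y : X} (hx : x ∈ Y) (hy : y ∈ Y) :
    B x y ^ 2 ≤ B x x * B y y := by
  have := LinearMap.BilinForm.apply_mul_apply_le_of_forall_zero_le
    (B.domRestrict₁₂ Y Y) (fun z => hY z z.2) ⟨x, hx⟩ ⟨y, hy⟩
  simp only [LinearMap.domRestrict₁₂_apply] at this
  rw [hB y x] at this
  linarith [pow_two (B x y)]

omit [Fintype V] [Fintype E] [DecidableEq V] in
/-- A uniform limit of test functions is continuous at the vertices. -/
theorem exists_vertex_values_of_tendsto {u : ℕ → testSpace G} {F : E → C(Icc (0 : ℝ) 1, ℝ)}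
    (hu : Tendsto (fun j => toEdges (u j)) atTop (𝓝 F)) :
    ∃ ψ : V → ℝ, ∀ e, F e ⟨0, by simp⟩ = ψ (G.src e) ∧ F e ⟨1, by simp⟩ = ψ (G.tgt e) := by
  choose ψ hψ using fun j => (u j).2.2
  have hev : ∀ e (x : Icc (0 : ℝ) 1), Tendsto (fun j => (u j).1 e x) atTop (𝓝 (F e x)) := by
    intro e x
    have h1 := (tendsto_pi_nhds.1 hu) e
    exact ((continuous_eval_const x).tendsto (F e)).comp h1
  -- At a vertex that meets no edge the values need not converge; `limUnder` then returns an
  -- arbitrary number, which no edge end refers to.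
  refine ⟨fun v => limUnder atTop fun j => ψ j v, fun e => ⟨?_, ?_⟩⟩
  · refine (Tendsto.limUnder_eq ?_).symm
    refine (hev e ⟨0, by simp⟩).congr fun j => (hψ j e).1
  · refine (Tendsto.limUnder_eq ?_).symm
    refine (hev e ⟨1, by simp⟩).congr fun j => (hψ j e).2

/-- A uniform limit of approximate weak solutions is an eigenfunction. -/
theorem exists_weak_of_tendsto {g : E → ℝ} {ρ : E → ℝ → ℝ} (hgρ : IsMetricDensity g ρ) {μ : ℝ}
    {u : ℕ → testSpace G} {F : E → C(Icc (0 : ℝ) 1, ℝ)}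
    (hu : Tendsto (fun j => toEdges (u j)) atTop (𝓝 F)) (hF : F ≠ 0)
    (hlim : ∀ h, Tendsto (fun j => gradForm G (conductance g) (u j) h
      - μ * massForm G (massDensity g ρ) (continuousOn_massDensity hgρ) (u j) h) atTop (𝓝 0)) :
    ∃ y ∈ weakEigenspace G (conductance g) (massDensity g ρ) (continuousOn_massDensity hgρ) μ,
      toEdges y = F := by
  set hm := continuousOn_massDensity hgρ
  set W : E → ℝ → ℝ := fun e x => F e (projIcc 0 1 zero_le_one x) with hW
  have hWF : ∀ e (x : Icc (0 : ℝ) 1), W e x = F e x := fun e x => by simp [hW]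
  have hWc : ∀ e, Continuous (W e) := fun e => (F e).continuous.comp continuous_projIcc
  have hWr : restrictEdges W (fun e => (hWc e).continuousOn) = F := by
    ext e x; exact hWF e x
  have hW0 : ∃ e, ∃ x ∈ Icc (0 : ℝ) 1, W e x ≠ 0 := by
    by_contra! h
    exact hF (by ext e x; rw [← hWF]; exact h e x x.2)
  have hWv : ∃ ψ : V → ℝ, ∀ e, W e 0 = ψ (G.src e) ∧ W e 1 = ψ (G.tgt e) := by
    obtain ⟨ψ, hψ⟩ := exists_vertex_values_of_tendsto hu
    exact ⟨ψ, fun e => ⟨(hWF e ⟨0, by simp⟩).trans (hψ e).1, (hWF e ⟨1, by simp⟩).trans (hψ e).2⟩⟩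
  have hev : ∀ e (x : Icc (0 : ℝ) 1), Tendsto (fun j => (u j).1 e x) atTop (𝓝 (W e x)) := by
    intro e x
    rw [hWF]
    exact ((continuous_eval_const x).tendsto (F e)).comp ((tendsto_pi_nhds.1 hu) e)
  -- Only the values of `u j` are known to converge, not the derivatives. Each pairing is therefore
  -- rewritten with both derivatives on the test function before passing to the limit.
  obtain ⟨F₁, h₁, h₂, h₃⟩ := exists_strong_of_veryWeak (G := G) (F := W) (μ := μ)
    (conductance_pos hgρ) hm (fun e => (hWc e).continuousOn) (by
      intro φ φ₁ φ₂ hφ hφ₁ hφ₂ hψ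
      have hc := fun e => continuousOn_of_hasDerivWithinAt (hφ₁ e)
      have hcφ := fun e => continuousOn_of_hasDerivWithinAt (hφ e)
      set h : testSpace G := ⟨φ, fun e => contDiffOn_one_of_hasDerivWithinAt (hφ e) (hc e), hψ⟩
      have lim1 : Tendsto (fun j => gradForm G (conductance g) (u j) h) atTop
          (𝓝 (∑ e, conductance g e * (W e 1 * φ₁ e 1 - W e 0 * φ₁ e 0
            - ∫ x in (0 : ℝ)..1, W e x * φ₂ e x))) := by
        have e1 : ∀ j, gradForm G (conductance g) (u j) h = ∑ e, conductance g e *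
            ((u j).1 e 1 * φ₁ e 1 - (u j).1 e 0 * φ₁ e 0
              - ∫ x in (0 : ℝ)..1, (u j).1 e x * φ₂ e x) := by
          intro j
          refine Finset.sum_congr rfl fun e _ => ?_
          rw [← integral_mul_deriv_Icc (fun x hx => testSpace_hasDerivWithinAt (u j) e hx)
            (hφ₁ e) (testSpace_continuousOn_edgeDeriv (u j) e) (hφ₂ e)]
          congr 1
          refine integral_congr_Icc fun x hx => ?_
          rw [show edgeDeriv h.1 e x = φ₁ e x from derivWithin_Icc_eq hx (hφ e x hx)]
        have lim2 : Tendsto (fun j => ∑ e, ∫ x in (0 : ℝ)..1,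
            (conductance g e * φ₂ e x) * (u j).1 e x) atTop
            (𝓝 (∑ e, ∫ x in (0 : ℝ)..1, (conductance g e * φ₂ e x) * W e x)) := by
          have hcw : ∀ e, ContinuousOn (fun x => conductance g e * φ₂ e x) (Icc 0 1) :=
            fun e => continuousOn_const.mul (hφ₂ e)
          have h5 := ((continuous_edgeIntegral.comp (continuous_const_mul
            (restrictEdges _ hcw))).tendsto F).comp hu
          have h6 := edgeIntegral_eq (h := restrictEdges _ hcw * F)
            (w := fun e x => (conductance g e * φ₂ e x) * W e x) (fun e x => by
              rw [hWF]; rfl)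
          rw [← h6]
          refine h5.congr fun j => ?_
          exact edgeIntegral_eq fun e x => rfl
        have lim3 : Tendsto (fun j => ∑ e, conductance g e *
            ((u j).1 e 1 * φ₁ e 1 - (u j).1 e 0 * φ₁ e 0)) atTop
            (𝓝 (∑ e, conductance g e * (W e 1 * φ₁ e 1 - W e 0 * φ₁ e 0))) := by
          refine tendsto_finsetSum _ fun e _ => ?_
          have h7 := hev e ⟨0, by simp⟩
          have h8 := hev e ⟨1, by simp⟩
          exact ((h8.mul_const _).sub (h7.mul_const _)).const_mul _
        have e2 : ∀ w : E → ℝ → ℝ, ∑ e, conductance g e * (w e 1 * φ₁ e 1 - w e 0 * φ₁ e 0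
            - ∫ x in (0 : ℝ)..1, w e x * φ₂ e x) =
            (∑ e, conductance g e * (w e 1 * φ₁ e 1 - w e 0 * φ₁ e 0))
            - ∑ e, ∫ x in (0 : ℝ)..1, (conductance g e * φ₂ e x) * w e x := by
          intro w
          rw [← Finset.sum_sub_distrib]
          refine Finset.sum_congr rfl fun e _ => ?_
          rw [mul_sub, ← intervalIntegral.integral_const_mul]
          congr 1
          exact integral_congr_Icc fun x _ => by ring
        rw [e2 W]
        refine (lim3.sub lim2).congr fun j => ?_
        rw [e1 j, e2 (u j).1]
      have lim4 : Tendsto (fun j => massForm G (massDensity g ρ) hm (u j) h) atTop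
          (𝓝 (∑ e, ∫ x in (0 : ℝ)..1, massDensity g ρ e x * (W e x * φ e x))) := by
        have h5 := ((continuous_edgeIntegral.comp ((continuous_const_mul
          (restrictEdges _ hm)).comp (continuous_mul_const (toEdges h)))).tendsto F).comp hu
        have h6 := edgeIntegral_eq (h := restrictEdges _ hm * (F * toEdges h))
          (w := fun e x => massDensity g ρ e x * (W e x * φ e x)) (fun e x => by
            rw [hWF]; rfl)
        rw [← h6]
        refine h5.congr fun j => ?_
        rw [massForm_eq_edgeIntegral]; rfl
      have := tendsto_nhds_unique (hlim h) (lim1.sub (lim4.const_mul μ))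
      linarith)
  have heig := isEigenfunction_of_strong hgρ hW0 hWv h₁ h₂ h₃
  refine ⟨heig.toTest, heig.mem_weakEigenspace hgρ, ?_⟩
  ext e x
  exact hWF e x

/-- Direct method: minimise the Rayleigh quotient on the orthogonal complement `Y` of the given
modes. Near-minimisers almost satisfy the Euler–Lagrange equation, so a uniform limit is a weak
eigenvector, although energy itself is not known in advance to pass to the limit. -/
theorem exists_isNextMode [Nonempty E] {g : E → ℝ} {ρ : E → ℝ → ℝ} (hgρ : IsMetricDensity g ρ)
    {n : ℕ} (e : Fin n → testSpace G)
    (he : ∀ i j, massForm G (massDensity g ρ) (continuousOn_massDensity hgρ) (e i) (e j)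
      = if i = j then 1 else 0)
    (hw : ∀ i h, gradForm G (conductance g) (e i) h = gradForm G (conductance g) (e i) (e i)
      * massForm G (massDensity g ρ) (continuousOn_massDensity hgρ) (e i) h) :
    ∃ y, IsNextMode (gradForm G (conductance g))
      (massForm G (massDensity g ρ) (continuousOn_massDensity hgρ)) e y := by
  set hm := continuousOn_massDensity hgρ
  set a := gradForm G (conductance g)
  set b := massForm G (massDensity g ρ) hm
  have hm0 := massDensity_pos hgρ
  have ha0 : ∀ f, 0 ≤ a f f := gradForm_nonneg fun e => (conductance_pos hgρ e).le
  have hb0 : ∀ f, 0 ≤ b f f := massForm_nonneg fun e x hx => (hm0 e x hx).le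
  let Y : Submodule ℝ (testSpace G) := ⨅ i, LinearMap.ker (b (e i))
  have hY : ∀ f, f ∈ Y ↔ ∀ i, b (e i) f = 0 := fun f => by simp [Y]
  set S : Set ℝ := {r | ∃ f, b f f = 1 ∧ (∀ i, b (e i) f = 0) ∧ a f f = r}
  have hSne : S.Nonempty := by
    obtain ⟨f, hf, hf'⟩ := exists_orthogonal_normalized hm hm0 e
    exact ⟨_, f, hf, hf', rfl⟩
  have hSb : BddBelow S := ⟨0, by rintro r ⟨f, -, -, rfl⟩; exact ha0 f⟩
  set Λ := sInf S
  have hmin : ∀ f ∈ Y, Λ * b f f ≤ a f f := by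
    intro f hf
    rcases (hb0 f).eq_or_lt' with h0 | h0
    · rw [h0, mul_zero]; exact ha0 f
    · have h4 := Real.sqrt_pos.2 h0
      have : Λ ≤ a ((√(b f f))⁻¹ • f) ((√(b f f))⁻¹ • f) := by
        refine csInf_le hSb ⟨_, ?_, fun i => ?_, rfl⟩
        · simp only [map_smul, LinearMap.smul_apply, smul_eq_mul]
          field_simp
          rw [Real.sq_sqrt h0.le]
        · simp [(hY f).1 hf i]
      simp only [map_smul, LinearMap.smul_apply, smul_eq_mul] at this
      rw [← mul_assoc, ← mul_inv, Real.mul_self_sqrt h0.le, inv_mul_eq_div, le_div_iff₀ h0] at this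
      exact this
  have hseq : ∀ j : ℕ, ∃ f, b f f = 1 ∧ (∀ i, b (e i) f = 0) ∧ a f f < Λ + 1 / (j + 1) := by
    intro j
    obtain ⟨r, ⟨f, h1, h2, rfl⟩, h3⟩ := exists_lt_of_csInf_lt hSne
      (show sInf S < Λ + 1 / ((j : ℝ) + 1) from lt_add_of_pos_right _ (by positivity))
    exact ⟨f, h1, h2, h3⟩
  choose u hu1 hu2 hu3 using hseq
  have hinv : ∀ j : ℕ, 1 / ((j : ℝ) + 1) ≤ 1 := fun j => by
    rw [div_le_one (by positivity)]; linarith [(Nat.cast_nonneg j : (0 : ℝ) ≤ j)]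
  -- The bound is energy at most `Λ + 1` plus mass `1`.
  obtain ⟨K, hK, hKmem⟩ := exists_compact_toEdges_mem (G := G) (conductance_pos hgρ) hm hm0
    (Λ + 2)
  obtain ⟨F, -, φ, hφ, hlimF⟩ := hK.tendsto_subseq (x := fun j => toEdges (u j)) fun j =>
    hKmem _ (by have := hu3 j; have := hu1 j; have := hinv j; change a _ _ + b _ _ ≤ _; linarith)
  have hdef : ∀ h, Tendsto (fun j => a (u j) h - Λ * b (u j) h) atTop (𝓝 0) := by
    intro h
    -- The form `a - Λ b` is known to be nonnegative only on `Y`. Since the previous modes are weak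
    -- eigenvectors orthogonal to `u j`, replacing `h` by its projection to `Y` does not change the
    -- pairing, and Cauchy–Schwarz on `Y` bounds its square by `O(1/(j + 1))`.
    set h' := h - ∑ i, b (e i) h • e i
    have hh' : h' ∈ Y := by
      rw [hY]
      intro i
      simp [h', he]
    have heq : ∀ j, a (u j) h - Λ * b (u j) h = (a - Λ • b) (u j) h' := by
      intro j
      have z1 : ∀ i, b (u j) (e i) = 0 := fun i => (massForm_comm _ _ _ _).trans (hu2 j i)
      have z2 : ∀ i, a (u j) (e i) = 0 := fun i => by
        rw [show a (u j) (e i) = a (e i) (u j) from gradForm_comm _ _ _, hw i, hu2 j i, mul_zero]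
      simp [h', z1, z2]
    have hbound : ∀ j, ((a - Λ • b) (u j) h') ^ 2 ≤
        1 / ((j : ℝ) + 1) * (a - Λ • b) h' h' := by
      intro j
      have h6 := sq_apply_le_of_nonneg (a - Λ • b)
        (fun x y => by
          simp only [LinearMap.sub_apply, LinearMap.smul_apply]
          rw [show a x y = a y x from gradForm_comm _ _ _,
            show b x y = b y x from massForm_comm _ _ _ _]) Y
        (fun x hx => by simpa using hmin x hx) ((hY _).2 (hu2 j)) hh'
      refine h6.trans (mul_le_mul_of_nonneg_right ?_ (by simpa using hmin h' hh'))
      have := hu3 j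
      simp only [LinearMap.sub_apply, LinearMap.smul_apply, smul_eq_mul, hu1 j]
      linarith
    have hsq : Tendsto (fun j => ((a - Λ • b) (u j) h') ^ 2) atTop (𝓝 0) := by
      refine squeeze_zero (fun j => sq_nonneg _) hbound ?_
      simpa using (tendsto_one_div_add_atTop_nhds_zero_nat (𝕜 := ℝ)).mul_const
        ((a - Λ • b) h' h')
    have habs : Tendsto (fun j => |(a - Λ • b) (u j) h'|) atTop (𝓝 0) := by
      have := (Real.continuous_sqrt.tendsto 0).comp hsq
      simpa [Function.comp_def, Real.sqrt_sq_eq_abs] using this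
    simpa only [heq] using (tendsto_zero_iff_abs_tendsto_zero _).2 habs
  have hmF : ∀ h : E → C(Icc (0 : ℝ) 1, ℝ), Tendsto
      (fun j => edgeIntegral (restrictEdges _ hm * (h * toEdges (u (φ j))))) atTop
      (𝓝 (edgeIntegral (restrictEdges _ hm * (h * F)))) := fun h =>
    ((continuous_edgeIntegral.comp ((continuous_const_mul _).comp
      (continuous_const_mul h))).tendsto F).comp hlimF
  have hnorm : edgeIntegral (restrictEdges _ hm * (F * F)) = 1 := by
    have h1 : Tendsto
        (fun j => edgeIntegral (restrictEdges _ hm * (toEdges (u (φ j)) * toEdges (u (φ j)))))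
        atTop (𝓝 (edgeIntegral (restrictEdges _ hm * (F * F)))) :=
      ((continuous_edgeIntegral.comp (continuous_const_mul _)).tendsto (F * F)).comp
        (hlimF.mul hlimF)
    refine tendsto_nhds_unique h1 (tendsto_const_nhds.congr fun j => ?_)
    rw [← massForm_eq_edgeIntegral]
    exact (hu1 _).symm
  have hF0 : F ≠ 0 := by
    rintro rfl
    simp [edgeIntegral] at hnorm
  obtain ⟨y, hy, rfl⟩ := exists_weak_of_tendsto hgρ hlimF hF0
    fun h => (hdef h).comp hφ.tendsto_atTop
  rw [mem_weakEigenspace] at hy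
  have hy1 : b y y = 1 := (massForm_eq_edgeIntegral hm y y).trans hnorm
  -- The energy of the limit is read off from its own weak equation tested with `y`.
  have hay : a y y = Λ := by
    have := hy y
    rw [show massForm G (massDensity g ρ) _ y y = 1 from hy1, mul_one] at this
    exact this
  refine ⟨y, hy1, fun i => ?_, fun h => by rw [hay]; exact hy h, fun f hf => ?_⟩
  · have h2 := hmF (toEdges (e i))
    rw [← massForm_eq_edgeIntegral] at h2
    refine tendsto_nhds_unique h2 (tendsto_const_nhds.congr fun j => ?_)
    rw [← massForm_eq_edgeIntegral]
    exact (hu2 _ i).symm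
  · rw [hay]
    exact hmin f ((hY f).2 hf)

end Attainment

/-! ### Abstract spectral sequences and min-max. -/

section Abstract

variable {X : Type*} [AddCommGroup X] [Module ℝ X]

/-- Dependent choice where each term depends on the whole history; used to choose the modes one
after another. -/
theorem exists_seq_of_forall_initial {α : Type*} [Nonempty α] {P : (n : ℕ) → (Fin n → α) → α → Prop}
    (h : ∀ n (e : Fin n → α),
      (∀ i : Fin n, P i (fun j : Fin i => e ⟨j, j.2.trans i.2⟩) (e i)) → ∃ y, P n e y) :
    ∃ f : ℕ → α, ∀ n, P n (fun i => f i) (f n) := by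
  classical
  -- Histories without a valid continuation get an arbitrary value; the induction below shows that
  -- they do not occur.
  let next : (n : ℕ) → (Fin n → α) → α := fun n e =>
    if hy : ∃ y, P n e y then hy.choose else Classical.arbitrary α
  let f : ℕ → α := fun n => Nat.strongRec (motive := fun _ => α) (fun n ih => next n fun i => ih i i.2) n
  have hf : ∀ n, f n = next n fun i => f i := fun n => by
    change Nat.strongRec (motive := fun _ => α) (fun n ih => next n fun i => ih i i.2) n = _
    rw [Nat.strongRec_eq]
  refine ⟨f, fun n => ?_⟩
  induction n using Nat.strong_induction_on with
  | _ n ih =>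
    have hex : ∃ y, P n (fun i => f i) y := h n _ fun i => ih i i.2
    have : f n = hex.choose := by rw [hf n]; exact dif_pos hex
    rw [this]
    exact hex.choose_spec

/-- `k + 1` vectors in `ℝ ^ k` are linearly dependent. -/
theorem exists_ne_zero_sum_mul_eq_zero {k : ℕ} (M : Fin (k + 1) → Fin k → ℝ) :
    ∃ d : Fin (k + 1) → ℝ, d ≠ 0 ∧ ∀ j, ∑ i, d i * M i j = 0 := by
  have : LinearMap.ker (Matrix.vecMulLinear (Matrix.of M)) ≠ ⊥ :=
    LinearMap.ker_ne_bot_of_finrank_lt (by simp)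
  obtain ⟨d, hd, hd0⟩ := (Submodule.ne_bot_iff _).1 this
  exact ⟨d, hd0, fun j => congrFun (LinearMap.mem_ker.1 hd) j⟩

/-- The weak eigenvectors `e n`, with eigenvalues `lam n` in increasing order, of a form `a`
relative to a form `b`. -/
structure IsSpectralSequence (a b : X →ₗ[ℝ] X →ₗ[ℝ] ℝ) (e : ℕ → X) (lam : ℕ → ℝ) : Prop where
  orthonormal : ∀ i j, b (e i) (e j) = if i = j then 1 else 0
  weak : ∀ i h, a (e i) h = lam i * b (e i) h
  mono : Monotone lam
  minimal : ∀ n f, (∀ i < n, b (e i) f = 0) → lam n * b f f ≤ a f f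
  tendsto : Tendsto lam atTop atTop

namespace IsSpectralSequence

variable {a b : X →ₗ[ℝ] X →ₗ[ℝ] ℝ} {e : ℕ → X} {lam : ℕ → ℝ}

theorem mass_sum (h : IsSpectralSequence a b e lam) {s : Finset ℕ} (c : ℕ → ℝ) (j : ℕ) :
    b (e j) (∑ i ∈ s, c i • e i) = if j ∈ s then c j else 0 := by
  simp [h.orthonormal]

theorem mass_sum_self (h : IsSpectralSequence a b e lam) (s : Finset ℕ) (c : ℕ → ℝ) :
    b (∑ i ∈ s, c i • e i) (∑ i ∈ s, c i • e i) = ∑ i ∈ s, c i ^ 2 := by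
  rw [map_sum b, LinearMap.sum_apply]
  refine Finset.sum_congr rfl fun i hi => ?_
  rw [map_smul, LinearMap.smul_apply, h.mass_sum, if_pos hi, smul_eq_mul, pow_two]

theorem energy_sum_self (h : IsSpectralSequence a b e lam) (s : Finset ℕ) (c : ℕ → ℝ) :
    a (∑ i ∈ s, c i • e i) (∑ i ∈ s, c i • e i) = ∑ i ∈ s, lam i * c i ^ 2 := by
  rw [map_sum a, LinearMap.sum_apply]
  refine Finset.sum_congr rfl fun i hi => ?_
  rw [map_smul, LinearMap.smul_apply, h.weak, h.mass_sum, if_pos hi, smul_eq_mul]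
  ring

/-- A weak eigenvector with eigenvalue below `lam k` agrees with its projection to the first `k`
eigenvectors. -/
theorem mass_sub_projection (h : IsSpectralSequence a b e lam) (hb : ∀ x y, b x y = b y x)
    (ha : ∀ x y, a x y = a y x) (hb0 : ∀ x, 0 ≤ b x x) {μ : ℝ} {k : ℕ} (hk : μ < lam k) {F : X}
    (hF : ∀ x, a F x = μ * b F x) :
    b (F - ∑ j ∈ Finset.range k, b (e j) F • e j) (F - ∑ j ∈ Finset.range k, b (e j) F • e j)
      = 0 := by
  set r := F - ∑ j ∈ Finset.range k, b (e j) F • e j with hr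
  -- By symmetry `F` has nonzero coefficients only along modes with eigenvalue `μ`. Hence the
  -- remainder `r` solves the same equation and is orthogonal to the first `k` modes, so `lam k * b
  -- r r ≤ a r r = μ * b r r` with `μ < lam k`.
  have h1 : ∀ j, (lam j - μ) * b (e j) F = 0 := fun j => by
    have e1 := hF (e j)
    rw [ha, h.weak, hb F] at e1
    linarith
  have h2 : ∀ x, a r x = μ * b r x := by
    intro x
    have e2 : ∀ j, b (e j) F * (lam j * b (e j) x) = μ * (b (e j) F * b (e j) x) := fun j => by
      linear_combination b (e j) x * h1 j
    simp only [hr, map_sub, map_sum, map_smul, LinearMap.sub_apply, LinearMap.sum_apply,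
      LinearMap.smul_apply, smul_eq_mul, hF, h.weak, e2, mul_sub, Finset.mul_sum]
  have h3 : ∀ i < k, b (e i) r = 0 := by
    intro i hi
    rw [hr, map_sub, h.mass_sum, if_pos (Finset.mem_range.2 hi), sub_self]
  have h4 := h.minimal k r h3
  rw [h2] at h4
  have h5 := hb0 r
  nlinarith

/-- The easy half of the min-max principle. -/
theorem le_of_test (h : IsSpectralSequence a b e lam) {k : ℕ} {w : Fin (k + 1) → X} {Λ : ℝ}
    (hpos : ∀ c : Fin (k + 1) → ℝ, c ≠ 0 → 0 < b (∑ i, c i • w i) (∑ i, c i • w i))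
    (hle : ∀ c : Fin (k + 1) → ℝ,
      a (∑ i, c i • w i) (∑ i, c i • w i) ≤ Λ * b (∑ i, c i • w i) (∑ i, c i • w i)) :
    lam k ≤ Λ := by
  -- Among `k + 1` directions there is a nonzero combination orthogonal to the first `k` modes.
  obtain ⟨c, hc, hc0⟩ := exists_ne_zero_sum_mul_eq_zero fun i (j : Fin k) => b (e j) (w i)
  have h1 := h.minimal k (∑ i, c i • w i) fun j hj => by
    have := hc0 ⟨j, hj⟩
    simpa using this
  exact le_of_mul_le_mul_right (h1.trans (hle c)) (hpos c hc)

theorem energy_le (h : IsSpectralSequence a b e lam) {k : ℕ} (c : Fin (k + 1) → ℝ) :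
    a (∑ i, c i • e i) (∑ i, c i • e i) ≤ lam k * b (∑ i, c i • e i) (∑ i, c i • e i) := by
  set c' : ℕ → ℝ := fun i => if hi : i < k + 1 then c ⟨i, hi⟩ else 0
  have hc : ∑ i, c i • e i = ∑ i ∈ Finset.range (k + 1), c' i • e i := by
    rw [Finset.sum_range]
    exact Finset.sum_congr rfl fun i _ => by simp only [c', i.2, dif_pos]
  rw [hc, h.energy_sum_self, h.mass_sum_self, Finset.mul_sum]
  refine Finset.sum_le_sum fun i hi => mul_le_mul_of_nonneg_right (h.mono ?_) (sq_nonneg _)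
  exact Nat.lt_succ_iff.1 (Finset.mem_range.1 hi)

theorem mass_pos (h : IsSpectralSequence a b e lam) {k : ℕ} {c : Fin (k + 1) → ℝ} (hc : c ≠ 0) :
    0 < b (∑ i, c i • e i) (∑ i, c i • e i) := by
  set c' : ℕ → ℝ := fun i => if hi : i < k + 1 then c ⟨i, hi⟩ else 0
  have hc' : ∑ i, c i • e i = ∑ i ∈ Finset.range (k + 1), c' i • e i := by
    rw [Finset.sum_range]
    exact Finset.sum_congr rfl fun i _ => by simp only [c', i.2, dif_pos]
  rw [hc', h.mass_sum_self]
  obtain ⟨i, hi⟩ := Function.ne_iff.1 hc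
  refine Finset.sum_pos' (fun _ _ => sq_nonneg _) ⟨i, Finset.mem_range.2 i.2, ?_⟩
  have : c i ≠ 0 := hi
  simp only [c', i.2, dif_pos]
  positivity

end IsSpectralSequence

end Abstract

/-! ### The spectral sequence of a metric graph and its eigenvalues. -/

section Spectral

variable {V E : Type*} {G : DiscreteGraph V E} [Fintype V] [Fintype E] [DecidableEq V]

omit [Fintype V] [Fintype E] [DecidableEq V] in
theorem toEdges_sub (f h : testSpace G) : toEdges (f - h) = toEdges f - toEdges h := by
  ext e x; rfl

theorem exists_isSpectralSequence (G : DiscreteGraph V E) [Nonempty E] {g : E → ℝ}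
    {ρ : E → ℝ → ℝ} (hgρ : IsMetricDensity g ρ) :
    ∃ (e : ℕ → testSpace G) (lam : ℕ → ℝ), IsSpectralSequence (gradForm G (conductance g))
      (massForm G (massDensity g ρ) (continuousOn_massDensity hgρ)) e lam := by
  set hm := continuousOn_massDensity hgρ
  set a := gradForm G (conductance g)
  set b := massForm G (massDensity g ρ) hm
  have hb : ∀ x y, b x y = b y x := massForm_comm _ _
  have hseq : ∃ e : ℕ → testSpace G, ∀ n, IsNextMode a b (fun i : Fin n => e i) (e n) := by
    refine exists_seq_of_forall_initial (P := fun n => IsNextMode a b (n := n)) fun n e he => ?_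
    refine exists_isNextMode hgρ e (fun i j => ?_) fun i => (he i).weak
    rcases lt_trichotomy i j with hij | rfl | hij
    · rw [if_neg hij.ne]; exact (he j).orthogonal ⟨i, hij⟩
    · rw [if_pos rfl]; exact (he i).normalized
    · rw [if_neg hij.ne']; exact (hb _ _).trans ((he i).orthogonal ⟨j, hij⟩)
  obtain ⟨e, he⟩ := hseq
  have hon : ∀ i j, b (e i) (e j) = if i = j then 1 else 0 := by
    intro i j
    rcases lt_trichotomy i j with hij | rfl | hij
    · rw [if_neg hij.ne]; exact (he j).orthogonal ⟨i, hij⟩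
    · rw [if_pos rfl]; exact (he i).normalized
    · rw [if_neg hij.ne', hb]; exact (he i).orthogonal ⟨j, hij⟩
  have hmin : ∀ n f, (∀ i < n, b (e i) f = 0) → a (e n) (e n) * b f f ≤ a f f :=
    fun n f hf => (he n).minimal f fun i => hf i i.2
  have hmono : Monotone fun n => a (e n) (e n) := monotone_nat_of_le_succ fun n => by
    have := hmin n (e (n + 1)) fun i hi => by rw [hon, if_neg (by omega)]
    rwa [hon, if_pos rfl, mul_one] at this
  refine ⟨e, fun n => a (e n) (e n), hon, fun i => (he i).weak, hmono, hmin, ?_⟩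
  -- Were the eigenvalues bounded, the orthonormal modes would have a uniformly convergent
  -- subsequence, although the difference of two distinct modes has mass `2`.
  refine (tendsto_atTop_of_monotone hmono).resolve_right ?_
  rintro ⟨l, hl⟩
  obtain ⟨K, hK, hKmem⟩ := exists_compact_toEdges_mem (G := G) (conductance_pos hgρ) hm
    (massDensity_pos hgρ) (l + 1)
  obtain ⟨F, -, φ, hφ, hlim⟩ := hK.tendsto_subseq (x := fun j => toEdges (e j)) fun j =>
    hKmem _ (add_le_add (hmono.ge_of_tendsto hl j) (by
      change b _ _ ≤ 1; rw [hon, if_pos rfl]))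
  have hc : Continuous fun q : E → C(Icc (0 : ℝ) 1, ℝ) =>
      edgeIntegral (restrictEdges _ hm * (q * q)) := continuous_edgeIntegral.comp
    ((continuous_const_mul _).comp (continuous_id.mul continuous_id))
  have hlim' : Tendsto (fun j => toEdges (e (φ j)) - toEdges (e (φ (j + 1)))) atTop (𝓝 (F - F)) :=
    hlim.sub (hlim.comp (tendsto_add_atTop_nat 1))
  have h1 := (hc.tendsto (F - F)).comp hlim'
  have h0 : edgeIntegral (restrictEdges (massDensity g ρ) hm * ((F - F) * (F - F))) = 0 := by
    simp [edgeIntegral]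
  rw [h0] at h1
  have h2 : Tendsto (fun _ : ℕ => (2 : ℝ)) atTop (𝓝 0) := by
    refine h1.congr fun j => ?_
    have h3 : b (e (φ j) - e (φ (j + 1))) (e (φ j) - e (φ (j + 1))) = 2 := by
      have hne : φ j ≠ φ (j + 1) := (hφ (Nat.lt_succ_self j)).ne
      simp only [map_sub, LinearMap.sub_apply, hon, if_neg hne, if_neg hne.symm, if_true]
      norm_num
    have h4 := massForm_eq_edgeIntegral hm (e (φ j) - e (φ (j + 1))) (e (φ j) - e (φ (j + 1)))
    rw [toEdges_sub] at h4
    exact h4.symm.trans h3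
  exact two_ne_zero (tendsto_nhds_unique tendsto_const_nhds h2)

omit [Fintype V] [DecidableEq V] in
theorem massForm_eq_zero_of_vanish {m : E → ℝ → ℝ} {hm : ∀ e, ContinuousOn (m e) (Icc 0 1)}
    {f : testSpace G} (hf : ∀ e, ∀ x ∈ Icc (0 : ℝ) 1, f.1 e x = 0) (h : testSpace G) :
    massForm G m hm f h = 0 := by
  refine Finset.sum_eq_zero fun e _ => ?_
  rw [integral_congr_Icc (w' := fun _ => 0) fun x hx => by rw [hf e x hx, zero_mul, mul_zero]]
  simp

omit [Fintype V] [Fintype E] [DecidableEq V] in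
theorem testSpace_sum_apply {ι : Type*} (s : Finset ι) (c : ι → ℝ) (f : ι → testSpace G) (e : E)
    (x : ℝ) : (∑ i ∈ s, c i • f i).1 e x = ∑ i ∈ s, c i * (f i).1 e x := by
  rw [AddSubmonoidClass.coe_finsetSum, Finset.sum_apply, Finset.sum_apply]
  rfl

/-- The infimum is attained by the first `k + 1` modes. Conversely, eigenfunctions with eigenvalues
below `lam k` agree on the closed edges with combinations of the first `k` modes, so `k + 1` of them
are dependent. -/
theorem eigenvalue_eq {g : E → ℝ} {ρ : E → ℝ → ℝ} (hgρ : IsMetricDensity g ρ)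
    {e : ℕ → testSpace G} {lam : ℕ → ℝ}
    (h : IsSpectralSequence (gradForm G (conductance g))
      (massForm G (massDensity g ρ) (continuousOn_massDensity hgρ)) e lam) (k : ℕ) :
    eigenvalue G k g ρ = lam k := by
  set hm := continuousOn_massDensity hgρ
  have hm0 := massDensity_pos hgρ
  refine IsLeast.csInf_eq ⟨?_, ?_⟩
  · refine ⟨fun i => lam i, fun i => (e i).1, fun i => ⟨h.mono (Nat.lt_succ_iff.1 i.2), ?_⟩, ?_⟩
    · refine isEigenfunction_of_mem_weakEigenspace hgρ (mem_weakEigenspace.2 (h.weak i)) ?_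
      by_contra! h0
      have h1 := h.orthonormal i i
      rw [if_pos rfl, massForm_eq_zero_of_vanish h0] at h1
      exact zero_ne_one h1
    · rw [Fintype.linearIndependent_iff]
      intro c hc
      by_contra! hne
      refine (h.mass_pos (c := c) (Function.ne_iff.2 hne)).ne'
        (massForm_eq_zero_of_vanish (fun e' x hx => ?_) _)
      rw [testSpace_sum_apply]
      have := congrFun (congrFun hc e') ⟨x, hx⟩
      simpa using this
  · rintro Λ ⟨μ, f, hf, hind⟩
    by_contra! hlt
    set F : Fin (k + 1) → testSpace G := fun i => (hf i).2.toTest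
    obtain ⟨d, hd, hd0⟩ := exists_ne_zero_sum_mul_eq_zero
      fun i (j : Fin k) => massForm G _ hm (e j) (F i)
    rw [Fintype.linearIndependent_iff] at hind
    refine hd (funext (hind d ?_))
    funext e' x
    have hr : ∀ i, f i e' x = ∑ j ∈ Finset.range k, massForm G _ hm (e j) (F i) * (e j).1 e' x := by
      intro i
      have h1 := h.mass_sub_projection (massForm_comm _ _) (gradForm_comm _)
        (massForm_nonneg fun e x hx => (hm0 e x hx).le) ((hf i).1.trans_lt hlt)
        (mem_weakEigenspace.1 ((hf i).2.mem_weakEigenspace hgρ))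
      have h2 := massForm_eq_zero hm0 h1 e' x.2
      rw [← testSpace_sum_apply, ← sub_eq_zero]
      exact h2
    simp only [Finset.sum_apply, Pi.smul_apply, smul_eq_mul, Pi.zero_apply, hr, Finset.mul_sum]
    rw [Finset.sum_comm, Finset.sum_range]
    refine Finset.sum_eq_zero fun j _ => ?_
    have := hd0 j
    refine Eq.trans ?_ ((congrArg (fun z => (e j).1 e' x * z) this).trans (mul_zero _))
    rw [Finset.mul_sum]
    exact Finset.sum_congr rfl fun i _ => by ring

end Spectral

/-! ### First-order perturbation of quadratic forms. -/

section AbstractPerturbation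

variable {X : Type*} [AddCommGroup X] [Module ℝ X]

theorem two_mul_abs_apply_le {n T : X →ₗ[ℝ] X →ₗ[ℝ] ℝ} (hT : ∀ x y, T x y = T y x)
    (hn : ∀ x y, n x y = n y x) {C θ : ℝ} (hC : ∀ x, |T x x| ≤ C * n x x) (hθ : 0 < θ) (u v : X) :
    2 * |T u v| ≤ C * (θ * n u u + n v v / θ) := by
  have h1 := abs_le.1 (hC (θ • u + v))
  have h2 := abs_le.1 (hC (θ • u - v))
  simp only [map_add, map_sub, map_smul, LinearMap.add_apply, LinearMap.sub_apply,
    LinearMap.smul_apply, smul_eq_mul, hT v u, hn v u] at h1 h2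
  have h3 : θ * (2 * |T u v|) ≤ C * (θ * (θ * n u u) + n v v) := by
    rcases abs_cases (T u v) with ⟨h, -⟩ | ⟨h, -⟩ <;> rw [h] <;> linarith
  have h4 : C * (θ * n u u + n v v / θ) = C * (θ * (θ * n u u) + n v v) / θ := by
    field_simp
  rw [h4, le_div_iff₀ hθ]
  linarith

/-- First-order perturbation: if the unperturbed form vanishes on `A` and is coercive on `B`, and
its first variation is positive on `A`, then the perturbed form is nonnegative on `A + B`. -/
theorem eventually_nonneg_of_expansion {n S₀ T : X →ₗ[ℝ] X →ₗ[ℝ] ℝ} {S : ℝ → X → ℝ}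
    (hn : ∀ x y, n x y = n y x) (hn0 : ∀ x, 0 ≤ n x x) (hS₀ : ∀ x y, S₀ x y = S₀ y x)
    (hT : ∀ x y, T x y = T y x) {A B : Set X} {C γ ε : ℝ} (hγ : 0 < γ) (hε : 0 < ε)
    (hexp : ∀ η > 0, ∀ᶠ t in 𝓝[>] (0 : ℝ), ∀ f, |S t f - S₀ f f - t * T f f| ≤ η * |t| * n f f)
    (hC : ∀ x, |T x x| ≤ C * n x x) (hA : ∀ u ∈ A, ∀ x, S₀ u x = 0)
    (hA' : ∀ u ∈ A, ε * n u u ≤ T u u) (hB : ∀ v ∈ B, γ * n v v ≤ S₀ v v) :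
    ∀ᶠ t in 𝓝[>] (0 : ℝ), ∀ u ∈ A, ∀ v ∈ B, 0 ≤ S t (u + v) := by
  have hC' : ∀ x, |T x x| ≤ (|C| + 1) * n x x := fun x =>
    (hC x).trans (mul_le_mul_of_nonneg_right (by linarith [le_abs_self C]) (hn0 x))
  set D := |C| + 1
  have hD : 0 < D := by positivity
  -- Weight in Young's inequality: the cross term `2 T(u, v)` costs only `ε/2` on `u`. The Taylor
  -- error costs another `ε/4`, which leaves `ε/4`. The constant `L` collects all coefficients of `n
  -- v v`, and `t L ≤ γ` absorbs them into the coercive term.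
  set θ := ε / (2 * D)
  have hθ : 0 < θ := by positivity
  have hDθ : D * θ = ε / 2 := by simp only [θ]; field_simp
  set L := D / θ + D + ε / 4
  have hL : 0 < L := by positivity
  have hsmall : ∀ᶠ t in 𝓝[>] (0 : ℝ), t < γ / L :=
    (eventually_lt_nhds (by positivity)).filter_mono nhdsWithin_le_nhds
  filter_upwards [hexp (ε / 8) (by positivity), hsmall, self_mem_nhdsWithin]
    with t ht htL ht0 u hu v hv
  have ht0 : 0 < t := ht0
  have h1 := (abs_le.1 (ht (u + v))).1
  rw [abs_of_pos ht0] at h1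
  have h2 : S₀ (u + v) (u + v) = S₀ v v := by
    simp [hA u hu, hS₀ v u]
  have h3 : T (u + v) (u + v) = T u u + 2 * T u v + T v v := by
    simp only [map_add, LinearMap.add_apply, hT v u]; ring
  have h4 : n (u + v) (u + v) ≤ 2 * (n u u + n v v) := by
    have := hn0 (u - v)
    simp only [map_add, map_sub, LinearMap.add_apply, LinearMap.sub_apply, hn v u] at this ⊢
    linarith
  have h5 := two_mul_abs_apply_le hT hn hC' hθ u v
  have h6 := (abs_le.1 (hC' v)).1
  have h7 := hA' u hu
  have h8 := hB v hv
  have h9 : D * (θ * n u u + n v v / θ) = ε / 2 * n u u + D / θ * n v v := by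
    rw [← hDθ]; ring
  rw [h9] at h5
  have h10 := neg_abs_le (T u v)
  have h11 : t * L ≤ γ := ((lt_div_iff₀ hL).1 htL).le
  have h12 : ε / 4 * n u u - L * n v v ≤
      T u u + 2 * T u v + T v v - ε / 8 * (2 * (n u u + n v v)) := by
    simp only [L]
    linarith
  have h13 := mul_le_mul_of_nonneg_left h12 ht0.le
  have h14 := mul_le_mul_of_nonneg_right h11 (hn0 v)
  have h15 : 0 ≤ t * (ε / 4 * n u u) :=
    mul_nonneg ht0.le (mul_nonneg (by positivity) (hn0 u))
  have h16 := mul_le_mul_of_nonneg_left h4 (show 0 ≤ ε / 8 * t by positivity)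
  rw [h2, h3] at h1
  linarith

end AbstractPerturbation

/-! ### Uniform differentiability of coefficients in the family parameter. -/

section Coefficients

/-- The functions `κ t` on `[0, 1]` are differentiable in `t` at `t = 0`, uniformly on `[0, 1]`. -/
def HasUniformDerivAtZero (κ : ℝ → ℝ → ℝ) (κ' : ℝ → ℝ) : Prop :=
  ∀ ε > 0, ∀ᶠ t in 𝓝 (0 : ℝ), ∀ x ∈ Icc (0 : ℝ) 1, |κ t x - κ 0 x - t * κ' x| ≤ ε * |t|

theorem HasUniformDerivAtZero.comp_neg {κ : ℝ → ℝ → ℝ} {κ' : ℝ → ℝ}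
    (h : HasUniformDerivAtZero κ κ') :
    HasUniformDerivAtZero (fun t => κ (-t)) (fun x => -κ' x) := fun ε hε => by
  have : Tendsto (fun t : ℝ => -t) (𝓝 0) (𝓝 0) := by
    simpa using (continuous_neg.tendsto (0 : ℝ))
  filter_upwards [this.eventually (h ε hε)] with t ht x hx
  have := ht x hx
  rw [abs_neg] at this
  simpa using this

theorem eventually_abs_le_of_hasDerivAt {s : ℝ → ℝ} {s' : ℝ} (h : HasDerivAt s s' 0) {ε : ℝ}
    (hε : 0 < ε) : ∀ᶠ t in 𝓝 (0 : ℝ), |s t - s 0 - t * s'| ≤ ε * |t| := by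
  have := (hasDerivAt_iff_isLittleO.1 h).def hε
  filter_upwards [this] with t ht
  simpa [mul_comm] using ht

theorem hasDerivAt_of_eventually_abs_le {s : ℝ → ℝ} {s' : ℝ}
    (h : ∀ ε > 0, ∀ᶠ t in 𝓝 (0 : ℝ), |s t - s 0 - t * s'| ≤ ε * |t|) : HasDerivAt s s' 0 := by
  rw [hasDerivAt_iff_isLittleO]
  refine IsLittleO.of_bound fun ε hε => ?_
  filter_upwards [h ε hε] with t ht
  simpa [mul_comm] using ht

theorem exists_bound_Icc {w : ℝ → ℝ} (hw : ContinuousOn w (Icc 0 1)) :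
    ∃ M > 0, ∀ x ∈ Icc (0 : ℝ) 1, |w x| ≤ M := by
  obtain ⟨M, hM⟩ := isCompact_Icc.exists_bound_of_continuousOn hw
  exact ⟨|M| + 1, by positivity, fun x hx => (hM x hx).trans (by linarith [le_abs_self M])⟩

/-- Product rule with uniform remainder; the three error terms receive `ε/3` each. -/
theorem HasUniformDerivAtZero.smul {κ : ℝ → ℝ → ℝ} {κ' : ℝ → ℝ} {s : ℝ → ℝ} {s' : ℝ}
    (h : HasUniformDerivAtZero κ κ') (hs : HasDerivAt s s' 0)
    (hκ : ContinuousOn (κ 0) (Icc 0 1)) (hκ' : ContinuousOn κ' (Icc 0 1)) :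
    HasUniformDerivAtZero (fun t x => s t * κ t x) (fun x => s' * κ 0 x + s 0 * κ' x) := by
  obtain ⟨M, hM0, hM⟩ := exists_bound_Icc hκ
  obtain ⟨M', hM'0, hM'⟩ := exists_bound_Icc hκ'
  intro ε hε
  set R := |s 0| + 1
  have hR : 0 < R := by positivity
  have hcont := hs.continuousAt
  have c1 : ∀ᶠ t in 𝓝 (0 : ℝ), |s t| < R :=
    (hcont.abs).eventually (gt_mem_nhds (by simp [R]))
  have c2 : ∀ᶠ t in 𝓝 (0 : ℝ), |s t - s 0| < ε / (3 * M') := by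
    have : Tendsto (fun t => |s t - s 0|) (𝓝 0) (𝓝 |s 0 - s 0|) :=
      (hcont.sub continuousAt_const).abs
    rw [sub_self, abs_zero] at this
    exact this.eventually (gt_mem_nhds (by positivity))
  filter_upwards [h (ε / (3 * R)) (by positivity),
    eventually_abs_le_of_hasDerivAt hs (show 0 < ε / (3 * M) by positivity), c1, c2]
    with t h1 h2 h3 h4 x hx
  have e1 : s t * κ t x - s 0 * κ 0 x - t * (s' * κ 0 x + s 0 * κ' x) =
      s t * (κ t x - κ 0 x - t * κ' x) + (s t - s 0 - t * s') * κ 0 x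
        + (s t - s 0) * (t * κ' x) := by ring
  rw [e1]
  refine (abs_add_three _ _ _).trans ?_
  simp only [abs_mul]
  have b1 : |s t| * |κ t x - κ 0 x - t * κ' x| ≤ R * (ε / (3 * R) * |t|) :=
    mul_le_mul h3.le (h1 x hx) (abs_nonneg _) hR.le
  have b2 : |s t - s 0 - t * s'| * |κ 0 x| ≤ ε / (3 * M) * |t| * M :=
    mul_le_mul h2 (hM x hx) (abs_nonneg _) (by positivity)
  have b3 : |s t - s 0| * (|t| * |κ' x|) ≤ ε / (3 * M') * (|t| * M') :=
    mul_le_mul h4.le (mul_le_mul_of_nonneg_left (hM' x hx) (abs_nonneg _)) (by positivity)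
      (by positivity)
  have e2 : R * (ε / (3 * R) * |t|) = ε / 3 * |t| := by field_simp
  have e3 : ε / (3 * M) * |t| * M = ε / 3 * |t| := by field_simp
  have e4 : ε / (3 * M') * (|t| * M') = ε / 3 * |t| := by field_simp
  linarith

theorem integral_sub_sub_mul {u v w : ℝ → ℝ} (hu : ContinuousOn u (Icc 0 1))
    (hv : ContinuousOn v (Icc 0 1)) (hw : ContinuousOn w (Icc 0 1)) (t : ℝ) :
    ∫ x in (0 : ℝ)..1, (u x - v x - t * w x) = (∫ x in (0 : ℝ)..1, u x)
      - (∫ x in (0 : ℝ)..1, v x) - t * ∫ x in (0 : ℝ)..1, w x := by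
  have i1 : IntervalIntegrable (fun x => u x - v x) MeasureTheory.volume 0 1 :=
    intervalIntegrable_Icc (hu.sub hv)
  have i2 : IntervalIntegrable (fun x => t * w x) MeasureTheory.volume 0 1 :=
    intervalIntegrable_Icc (continuousOn_const.mul hw)
  rw [intervalIntegral.integral_sub i1 i2, intervalIntegral.integral_sub
    (intervalIntegrable_Icc hu) (intervalIntegrable_Icc hv), intervalIntegral.integral_const_mul]

theorem HasUniformDerivAtZero.hasDerivAt_integral {κ : ℝ → ℝ → ℝ} {κ' : ℝ → ℝ}
    (h : HasUniformDerivAtZero κ κ') (hκ : ∀ᶠ t in 𝓝 (0 : ℝ), ContinuousOn (κ t) (Icc 0 1))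
    (hκ' : ContinuousOn κ' (Icc 0 1)) :
    HasDerivAt (fun t => ∫ x in (0 : ℝ)..1, κ t x) (∫ x in (0 : ℝ)..1, κ' x) 0 := by
  refine hasDerivAt_of_eventually_abs_le fun ε hε => ?_
  have h0 := hκ.self_of_nhds
  filter_upwards [h ε hε, hκ] with t ht hct
  rw [← integral_sub_sub_mul hct h0 hκ']
  have := intervalIntegral.norm_integral_le_of_norm_le_const (a := (0 : ℝ)) (b := 1)
    (f := fun x => κ t x - κ 0 x - t * κ' x) (C := ε * |t|) fun x hx => by
      rw [uIoc_of_le zero_le_one] at hx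
      exact ht x ⟨hx.1.le, hx.2⟩
  simpa using this

/-- A density that depends smoothly on `t` and the edge parameter jointly is differentiable in
`t`, uniformly in the edge parameter. -/
theorem exists_hasUniformDerivAtZero {δ : ℝ} (hδ : 0 < δ) {ρ : ℝ → ℝ → ℝ}
    (h : ContDiffOn ℝ 1 (fun q : ℝ × ℝ => ρ q.1 q.2) (Ioo (-δ) δ ×ˢ Icc (0 : ℝ) 1)) :
    ∃ ρ' : ℝ → ℝ, ContinuousOn ρ' (Icc 0 1) ∧ HasUniformDerivAtZero ρ ρ' := by
  set S := Ioo (-δ) δ ×ˢ Icc (0 : ℝ) 1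
  have hS : UniqueDiffOn ℝ S := (uniqueDiffOn_Ioo _ _).prod (uniqueDiffOn_Icc zero_lt_one)
  set D : ℝ × ℝ → ℝ := fun q => fderivWithin ℝ (fun q : ℝ × ℝ => ρ q.1 q.2) S q (1, 0)
  have hD : ContinuousOn D S := (h.continuousOn_fderivWithin hS le_rfl).clm_apply continuousOn_const
  have hderiv : ∀ x ∈ Icc (0 : ℝ) 1, ∀ t ∈ Ioo (-δ) δ, HasDerivAt (fun t => ρ t x) (D (t, x)) t := by
    intro x hx t ht
    have h1 := (h.differentiableOn one_ne_zero (t, x) ⟨ht, hx⟩).hasFDerivWithinAt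
    have h2 : HasDerivWithinAt (fun s : ℝ => (s, x)) ((1 : ℝ), (0 : ℝ)) (Ioo (-δ) δ) t :=
      ((hasDerivAt_id t).prodMk (hasDerivAt_const t x)).hasDerivWithinAt
    have hmaps : MapsTo (fun s : ℝ => (s, x)) (Ioo (-δ) δ) S := fun s hs => ⟨hs, hx⟩
    have h3 := h1.comp_hasDerivWithinAt t h2 hmaps
    exact h3.hasDerivAt (Ioo_mem_nhds ht.1 ht.2)
  have h0 : (0 : ℝ) ∈ Ioo (-δ) δ := ⟨neg_lt_zero.2 hδ, hδ⟩
  have hD0 : ContinuousOn (fun x => D (0, x)) (Icc 0 1) :=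
    hD.comp (t := S) (f := fun x : ℝ => ((0 : ℝ), x)) (by fun_prop) fun x hx => ⟨h0, hx⟩
  refine ⟨fun x => D (0, x), hD0, fun ε hε => ?_⟩
  set K := Icc (-(δ / 2)) (δ / 2) ×ˢ Icc (0 : ℝ) 1
  have hKS : K ⊆ S := prod_mono (fun t ht => ⟨by linarith [ht.1], by linarith [ht.2]⟩) Subset.rfl
  have hunif : UniformContinuousOn D K :=
    (isCompact_Icc.prod isCompact_Icc).uniformContinuousOn_of_continuous (hD.mono hKS)
  obtain ⟨r, hr, hclose⟩ := Metric.uniformContinuousOn_iff.1 hunif ε hε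
  filter_upwards [Metric.ball_mem_nhds (0 : ℝ) (lt_min hr (half_pos hδ))] with t ht x hx
  have ht' : |t| < min r (δ / 2) := by simpa using ht
  have htr := ht'.trans_le (min_le_left _ _)
  have htδ := ht'.trans_le (min_le_right _ _)
  have hseg : ∀ s ∈ segment ℝ 0 t, |s| ≤ |t| := by
    intro s hs
    rw [segment_eq_uIcc] at hs
    rcases le_total 0 t with h' | h'
    · rw [uIcc_of_le h'] at hs
      rw [abs_of_nonneg hs.1, abs_of_nonneg h']; exact hs.2
    · rw [uIcc_of_ge h'] at hs
      rw [abs_of_nonpos hs.2, abs_of_nonpos h']; linarith [hs.1]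
  have hK : ∀ s, |s| ≤ |t| → (s, x) ∈ K := fun s hs => by
    have := abs_le.1 (hs.trans htδ.le)
    exact ⟨this, hx⟩
  -- Mean value inequality after removing the linear part at `0`: the derivative is then `D (s, x) -
  -- D (0, x)`, uniformly small in `x` by uniform continuity on the compact set `K`.
  have := Convex.norm_image_sub_le_of_norm_hasDerivWithin_le (𝕜 := ℝ)
    (f := fun s => ρ s x - s * D (0, x)) (f' := fun s => D (s, x) - D (0, x)) (C := ε)
    (s := segment ℝ 0 t) (x := 0) (y := t)
    (fun s hs => by
      have hs' := hK s (hseg s hs)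
      have := ((hderiv x hx s (hKS hs').1).sub ((hasDerivAt_id s).mul_const (D (0, x))))
      rw [one_mul] at this
      exact this.hasDerivWithinAt)
    (fun s hs => by
      have := hclose (s, x) (hK s (hseg s hs)) (0, x) (hK 0 (by simp))
        (by
          rw [Prod.dist_eq, dist_self, max_eq_left dist_nonneg, Real.dist_eq, sub_zero]
          exact (hseg s hs).trans_lt htr)
      exact this.le)
    (convex_segment _ _) (left_mem_segment _ _ _) (right_mem_segment _ _ _)
  simp only [zero_mul, sub_zero, Real.norm_eq_abs] at this
  convert this using 2
  ring

end Coefficients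

/-! ### Expansion of the quadratic forms along a family. -/

section FormExpansion

variable {V E : Type*} {G : DiscreteGraph V E} [Fintype E]

/-- The quadratic form `∑ p_e ∫ (f_e')² - ∑ ∫ m_e f_e²`. -/
noncomputable def coefQuad (p : E → ℝ) (m : E → ℝ → ℝ) (f : testSpace G) : ℝ :=
  (∑ e, p e * ∫ x in (0 : ℝ)..1, edgeDeriv f.1 e x * edgeDeriv f.1 e x)
    - ∑ e, ∫ x in (0 : ℝ)..1, m e x * (f.1 e x * f.1 e x)

theorem coefQuad_eq (p : E → ℝ) {m : E → ℝ → ℝ} (hm : ∀ e, ContinuousOn (m e) (Icc 0 1))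
    (f : testSpace G) : coefQuad p m f = gradForm G p f f - massForm G m hm f f := rfl

theorem abs_coefQuad_le {p p₀ : E → ℝ} {m m₀ : E → ℝ → ℝ}
    (hm : ∀ e, ContinuousOn (m e) (Icc 0 1)) (hm₀ : ∀ e, ContinuousOn (m₀ e) (Icc 0 1)) {η : ℝ}
    (h1 : ∀ e, |p e| ≤ η * p₀ e) (h2 : ∀ e, ∀ x ∈ Icc (0 : ℝ) 1, |m e x| ≤ η * m₀ e x)
    (f : testSpace G) :
    |coefQuad p m f| ≤ η * (gradForm G p₀ f f + massForm G m₀ hm₀ f f) := by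
  have b1 : |∑ e, p e * ∫ x in (0 : ℝ)..1, edgeDeriv f.1 e x * edgeDeriv f.1 e x| ≤
      η * gradForm G p₀ f f := by
    rw [gradForm_apply, Finset.mul_sum]
    refine (Finset.abs_sum_le_sum_abs _ _).trans (Finset.sum_le_sum fun e _ => ?_)
    rw [abs_mul, abs_of_nonneg (integral_mul_self_nonneg _), ← mul_assoc]
    exact mul_le_mul_of_nonneg_right (h1 e) (integral_mul_self_nonneg _)
  have b2 : |∑ e, ∫ x in (0 : ℝ)..1, m e x * (f.1 e x * f.1 e x)| ≤
      η * massForm G m₀ hm₀ f f := by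
    rw [massForm_apply, Finset.mul_sum]
    refine (Finset.abs_sum_le_sum_abs _ _).trans (Finset.sum_le_sum fun e _ => ?_)
    have hc := continuousOn_mass_mul hm f f e
    refine (intervalIntegral.abs_integral_le_integral_abs zero_le_one).trans ?_
    rw [← intervalIntegral.integral_const_mul]
    refine intervalIntegral.integral_mono_on zero_le_one (intervalIntegrable_Icc hc.abs)
      (intervalIntegrable_Icc (continuousOn_const.mul (continuousOn_mass_mul hm₀ f f e)))
      fun x hx => ?_
    rw [abs_mul, abs_of_nonneg (mul_self_nonneg (f.1 e x)), ← mul_assoc η]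
    exact mul_le_mul_of_nonneg_right (h2 e x hx) (mul_self_nonneg _)
  rw [coefQuad, mul_add]
  exact (abs_sub _ _).trans (add_le_add b1 b2)

theorem exists_abs_coefQuad_le {p p₀ : E → ℝ} {m m₀ : E → ℝ → ℝ}
    (hm : ∀ e, ContinuousOn (m e) (Icc 0 1)) (hm₀ : ∀ e, ContinuousOn (m₀ e) (Icc 0 1))
    (hp₀ : ∀ e, 0 < p₀ e) (hm₀0 : ∀ e, ∀ x ∈ Icc (0 : ℝ) 1, 0 < m₀ e x) :
    ∃ C, ∀ f : testSpace G, |coefQuad p m f| ≤ C * (gradForm G p₀ f f + massForm G m₀ hm₀ f f) := by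
  obtain ⟨s, hs, hsp, hsm⟩ := exists_pos_lower_bound hp₀ hm₀ hm₀0
  choose M hM0 hM using fun e => exists_bound_Icc (hm e)
  set R := ∑ e, (|p e| + M e)
  have hR : ∀ e, |p e| + M e ≤ R := fun e =>
    Finset.single_le_sum (f := fun e => |p e| + M e)
      (fun e _ => add_nonneg (abs_nonneg _) (hM0 e).le) (Finset.mem_univ e)
  refine ⟨R / s, abs_coefQuad_le hm hm₀ (fun e => ?_) fun e x hx => ?_⟩
  · have h1 := hR e
    have h2 := hM0 e
    calc |p e| ≤ R := by linarith
      _ = R / s * s := by field_simp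
      _ ≤ _ := mul_le_mul_of_nonneg_left (hsp e)
        (div_nonneg (by linarith [abs_nonneg (p e)]) hs.le)
  · have h1 := hR e
    have h2 := hM e x hx
    calc |m e x| ≤ R := by linarith [abs_nonneg (p e)]
      _ = R / s * s := by field_simp
      _ ≤ _ := mul_le_mul_of_nonneg_left (hsm e x hx)
        (div_nonneg (by linarith [abs_nonneg (p e), abs_nonneg (m e x)]) hs.le)

/-- The Taylor remainders of the coefficients are uniformly `o(t)`, and `p₀`, `m₀` are bounded
below, so the remainder of the form is `o(t)` relative to the fixed norm, uniformly in the test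
function. -/
theorem coefQuad_expansion {p₀ : E → ℝ} {m₀ : E → ℝ → ℝ}
    (hm₀ : ∀ e, ContinuousOn (m₀ e) (Icc 0 1)) (hp₀ : ∀ e, 0 < p₀ e)
    (hm₀0 : ∀ e, ∀ x ∈ Icc (0 : ℝ) 1, 0 < m₀ e x)
    {p : ℝ → E → ℝ} {p' : E → ℝ} {m : ℝ → E → ℝ → ℝ} {m' : E → ℝ → ℝ}
    (hp : ∀ e, HasDerivAt (fun t => p t e) (p' e) 0)
    (hm : ∀ e, HasUniformDerivAtZero (fun t => m t e) (m' e))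
    (hmc : ∀ᶠ t in 𝓝 (0 : ℝ), ∀ e, ContinuousOn (m t e) (Icc 0 1))
    (hm'c : ∀ e, ContinuousOn (m' e) (Icc 0 1)) {η : ℝ} (hη : 0 < η) :
    ∀ᶠ t in 𝓝 (0 : ℝ), ∀ f : testSpace G,
      |coefQuad (p t) (m t) f - coefQuad (p 0) (m 0) f - t * coefQuad p' m' f| ≤
        η * |t| * (gradForm G p₀ f f + massForm G m₀ hm₀ f f) := by
  obtain ⟨s, hs, hsp, hsm⟩ := exists_pos_lower_bound hp₀ hm₀ hm₀0
  have h0 := hmc.self_of_nhds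
  have hpe : ∀ᶠ t in 𝓝 (0 : ℝ), ∀ e, |p t e - p 0 e - t * p' e| ≤ η * s * |t| :=
    eventually_all.2 fun e => eventually_abs_le_of_hasDerivAt (hp e) (by positivity)
  have hme : ∀ᶠ t in 𝓝 (0 : ℝ), ∀ e, ∀ x ∈ Icc (0 : ℝ) 1,
      |m t e x - m 0 e x - t * m' e x| ≤ η * s * |t| :=
    eventually_all.2 fun e => hm e _ (by positivity)
  filter_upwards [hpe, hme, hmc] with t h1 h2 h3 f
  have hc : ∀ e, ContinuousOn (fun x => m t e x - m 0 e x - t * m' e x) (Icc 0 1) := fun e =>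
    ((h3 e).sub (h0 e)).sub (continuousOn_const.mul (hm'c e))
  have key := abs_coefQuad_le (p := fun e => p t e - p 0 e - t * p' e) hc hm₀ (η := η * |t|)
    (fun e => (h1 e).trans (by
      have := mul_le_mul_of_nonneg_left (hsp e) (show 0 ≤ η * |t| by positivity); linarith))
    (fun e x hx => (h2 e x hx).trans (by
      have := mul_le_mul_of_nonneg_left (hsm e x hx) (show 0 ≤ η * |t| by positivity); linarith)) f
  have e1 : coefQuad (fun e => p t e - p 0 e - t * p' e)
      (fun e x => m t e x - m 0 e x - t * m' e x) f =
      coefQuad (p t) (m t) f - coefQuad (p 0) (m 0) f - t * coefQuad p' m' f := by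
    have e2 : ∀ e, ∫ x in (0 : ℝ)..1, (m t e x - m 0 e x - t * m' e x) * (f.1 e x * f.1 e x) =
        (∫ x in (0 : ℝ)..1, m t e x * (f.1 e x * f.1 e x))
        - (∫ x in (0 : ℝ)..1, m 0 e x * (f.1 e x * f.1 e x))
        - t * ∫ x in (0 : ℝ)..1, m' e x * (f.1 e x * f.1 e x) := by
      intro e
      rw [← integral_sub_sub_mul (continuousOn_mass_mul h3 f f e) (continuousOn_mass_mul h0 f f e)
        (continuousOn_mass_mul hm'c f f e)]
      exact integral_congr_Icc fun x _ => by ring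
    simp only [coefQuad, e2]
    simp only [sub_mul, Finset.sum_sub_distrib, mul_sub, Finset.mul_sum, mul_assoc]
    ring
  rw [← e1]
  exact key

end FormExpansion

/-! ### First variations of metric, density and normalisation. -/

section FirstVariation

variable {V E : Type*}

/-- The pairs `(g t, ρ t)` of a metric and a density have the first variation `(h, σ)` at
`t = 0`. -/
structure HasFirstVariation (g : ℝ → E → ℝ) (ρ : ℝ → E → ℝ → ℝ) (h : E → ℝ) (σ : E → ℝ → ℝ) :
    Prop where
  mem : ∀ᶠ t in 𝓝 (0 : ℝ), IsMetricDensity (g t) (ρ t)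
  metric : ∀ e, HasDerivAt (fun t => g t e) (h e) 0
  density : ∀ e, HasUniformDerivAtZero (fun t => ρ t e) (σ e)
  continuousOn : ∀ e, ContinuousOn (σ e) (Icc 0 1)

theorem HasFirstVariation.comp_neg {g : ℝ → E → ℝ} {ρ : ℝ → E → ℝ → ℝ} {h : E → ℝ}
    {σ : E → ℝ → ℝ} (hv : HasFirstVariation g ρ h σ) :
    HasFirstVariation (fun t => g (-t)) (fun t => ρ (-t)) (fun e => -h e) (fun e x => -σ e x) where
  mem := by
    have : Tendsto (fun t : ℝ => -t) (𝓝 0) (𝓝 0) := by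
      simpa using (continuous_neg.tendsto (0 : ℝ))
    exact this.eventually hv.mem
  metric e := by
    have h1 : HasDerivAt (fun t => g t e) (h e) (-0) := by rw [neg_zero]; exact hv.metric e
    exact (h1.comp (0 : ℝ) (hasDerivAt_neg 0)).congr_deriv (by ring)
  density e := (hv.density e).comp_neg
  continuousOn e := (hv.continuousOn e).neg

theorem IsSmoothFamily.exists_hasFirstVariation {δ : ℝ} (hδ : 0 < δ) {g : ℝ → E → ℝ}
    {ρ : ℝ → E → ℝ → ℝ} {g₀ : E → ℝ} {ρ₀ : E → ℝ → ℝ} (hf : IsSmoothFamily δ g ρ g₀ ρ₀) :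
    ∃ (h : E → ℝ) (σ : E → ℝ → ℝ), HasFirstVariation g ρ h σ := by
  have h0 : Ioo (-δ) δ ∈ 𝓝 (0 : ℝ) := Ioo_mem_nhds (neg_lt_zero.2 hδ) hδ
  choose σ hσc hσ using fun e => exists_hasUniformDerivAtZero (ρ := fun t => ρ t e) hδ
    ((hf.smooth_density e).of_le (show (1 : WithTop ℕ∞) ≤ ((⊤ : ℕ∞) : WithTop ℕ∞) by
      exact_mod_cast le_top))
  refine ⟨fun e => deriv (fun t => g t e) 0, σ, ?_, fun e => ?_, hσ, hσc⟩
  · filter_upwards [h0] with t ht using hf.mem t ht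
  · exact (((hf.smooth_metric e).contDiffAt h0).differentiableAt (by simp)).hasDerivAt

variable [Fintype E]

theorem normF_pos [Nonempty E] (α : ℝ) {g : E → ℝ} {ρ : E → ℝ → ℝ} (hgρ : IsMetricDensity g ρ) :
    0 < normF α g :=
  Finset.sum_pos (fun e _ => Real.rpow_pos_of_pos (hgρ.1 e) _) Finset.univ_nonempty

omit [Fintype E] in
theorem integral_density_pos {g : E → ℝ} {ρ : E → ℝ → ℝ} (hgρ : IsMetricDensity g ρ) (e : E) :
    0 < ∫ x in (0 : ℝ)..1, ρ e x :=
  intervalIntegral.integral_pos zero_lt_one (hgρ.2.1 e).continuousOn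
    (fun x hx => (hgρ.2.2 e x ⟨hx.1.le, hx.2⟩).le) ⟨0, by simp, hgρ.2.2 e 0 (by simp)⟩

theorem normH_pos [Nonempty E] (α : ℝ) {g : E → ℝ} {ρ : E → ℝ → ℝ} (hgρ : IsMetricDensity g ρ) :
    0 < normH α g ρ :=
  Finset.sum_pos (fun e _ => mul_pos (Real.rpow_pos_of_pos (hgρ.1 e) _)
    (integral_density_pos hgρ e)) Finset.univ_nonempty

/-- The normalisation `F_α H_α`. -/
noncomputable def normFactor (α : ℝ) (g : E → ℝ) (ρ : E → ℝ → ℝ) : ℝ := normF α g * normH α g ρ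

theorem normFactor_pos [Nonempty E] (α : ℝ) {g : E → ℝ} {ρ : E → ℝ → ℝ}
    (hgρ : IsMetricDensity g ρ) : 0 < normFactor α g ρ :=
  mul_pos (normF_pos α hgρ) (normH_pos α hgρ)

/-- The first variation of `F_α`. -/
noncomputable def normFVar (α : ℝ) (g h : E → ℝ) : ℝ := ∑ e, (1 - α) * g e ^ (-α) * h e

/-- The first variation of `H_α`. -/
noncomputable def normHVar (α : ℝ) (g : E → ℝ) (ρ : E → ℝ → ℝ) (h : E → ℝ) (σ : E → ℝ → ℝ) : ℝ :=
  ∑ e, (α * g e ^ (α - 1) * h e * (∫ x in (0 : ℝ)..1, ρ e x)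
    + g e ^ α * ∫ x in (0 : ℝ)..1, σ e x)

/-- The first variation of `F_α H_α`. -/
noncomputable def normFactorVar (α : ℝ) (g : E → ℝ) (ρ : E → ℝ → ℝ) (h : E → ℝ)
    (σ : E → ℝ → ℝ) : ℝ :=
  normFVar α g h * normH α g ρ + normF α g * normHVar α g ρ h σ

theorem HasFirstVariation.hasDerivAt_normFactor {g : ℝ → E → ℝ} {ρ : ℝ → E → ℝ → ℝ} {h : E → ℝ}
    {σ : E → ℝ → ℝ} (hv : HasFirstVariation g ρ h σ) (α : ℝ) :
    HasDerivAt (fun t => normFactor α (g t) (ρ t)) (normFactorVar α (g 0) (ρ 0) h σ) 0 := by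
  have h0 := hv.mem.self_of_nhds
  refine HasDerivAt.mul ?_ ?_
  · refine HasDerivAt.fun_sum fun e _ => ?_
    have := (hv.metric e).rpow_const (p := 1 - α) (Or.inl (h0.1 e).ne')
    refine this.congr_deriv ?_
    rw [show (1 : ℝ) - α - 1 = -α by ring]
    ring
  · refine HasDerivAt.fun_sum fun e _ => ?_
    have h1 := (hv.metric e).rpow_const (p := α) (Or.inl (h0.1 e).ne')
    have h2 := (hv.density e).hasDerivAt_integral
      (hv.mem.mono fun t ht => (ht.2.1 e).continuousOn) (hv.continuousOn e)
    exact (h1.mul h2).congr_deriv (by ring)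

/-- The first variation of the conductances. -/
noncomputable def conductanceVar (g h : E → ℝ) (e : E) : ℝ := -(h e / (2 * g e * √(g e)))

/-- The first variation of the mass density. -/
noncomputable def massDensityVar (g : E → ℝ) (ρ : E → ℝ → ℝ) (h : E → ℝ) (σ : E → ℝ → ℝ) (e : E)
    (x : ℝ) : ℝ :=
  h e / (2 * √(g e)) * ρ e x + √(g e) * σ e x

omit [Fintype E] in
theorem HasFirstVariation.hasDerivAt_conductance {g : ℝ → E → ℝ} {ρ : ℝ → E → ℝ → ℝ} {h : E → ℝ}
    {σ : E → ℝ → ℝ} (hv : HasFirstVariation g ρ h σ) (e : E) :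
    HasDerivAt (fun t => conductance (g t) e) (conductanceVar (g 0) h e) 0 := by
  have h0 := hv.mem.self_of_nhds.1 e
  have h2 := Real.sqrt_pos.2 h0
  have h1 := ((hv.metric e).sqrt h0.ne').inv h2.ne'
  refine h1.congr_deriv ?_
  rw [conductanceVar, Real.sq_sqrt h0.le]
  field_simp

omit [Fintype E] in
theorem HasFirstVariation.hasUniformDerivAtZero_massDensity {g : ℝ → E → ℝ} {ρ : ℝ → E → ℝ → ℝ}
    {h : E → ℝ} {σ : E → ℝ → ℝ} (hv : HasFirstVariation g ρ h σ) (e : E) :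
    HasUniformDerivAtZero (fun t => massDensity (g t) (ρ t) e)
      (massDensityVar (g 0) (ρ 0) h σ e) :=
  (hv.density e).smul ((hv.metric e).sqrt (hv.mem.self_of_nhds.1 e).ne')
    (hv.mem.self_of_nhds.2.1 e).continuousOn (hv.continuousOn e)

omit [Fintype E] in
theorem continuousOn_massDensityVar {g : E → ℝ} {ρ : E → ℝ → ℝ} (hgρ : IsMetricDensity g ρ)
    {h : E → ℝ} {σ : E → ℝ → ℝ} (hσ : ∀ e, ContinuousOn (σ e) (Icc 0 1)) (e : E) :
    ContinuousOn (massDensityVar g ρ h σ e) (Icc 0 1) :=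
  (continuousOn_const.mul (hgρ.2.1 e).continuousOn).add (continuousOn_const.mul (hσ e))

/-- The first variation, on the eigenspace of `Λ / (F_α H_α)`, of the normalised forms
`F_α H_α a - Λ b`. -/
noncomputable def variationQuad {G : DiscreteGraph V E} (α Λ : ℝ) (g : E → ℝ) (ρ : E → ℝ → ℝ)
    (h : E → ℝ) (σ : E → ℝ → ℝ) (f : testSpace G) : ℝ :=
  coefQuad (fun e => normFactorVar α g ρ h σ * conductance g e
    + normFactor α g ρ * conductanceVar g h e) (fun e x => Λ * massDensityVar g ρ h σ e x) f

end FirstVariation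

/-! ### One-sided bounds for the normalised eigenvalue along a family. -/

section Perturbation

variable {V E : Type*} {G : DiscreteGraph V E} [Fintype E]

theorem gradForm_smul (c : ℝ) (p : E → ℝ) (f h : testSpace G) :
    gradForm G (fun e => c * p e) f h = c * gradForm G p f h := by
  simp only [gradForm_apply, Finset.mul_sum, mul_assoc]

theorem massForm_smul (c : ℝ) {m : E → ℝ → ℝ} (hm : ∀ e, ContinuousOn (m e) (Icc 0 1))
    (hm' : ∀ e, ContinuousOn (fun x => c * m e x) (Icc 0 1)) (f h : testSpace G) :
    massForm G (fun e x => c * m e x) hm' f h = c * massForm G m hm f h := by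
  simp only [massForm_apply, Finset.mul_sum, mul_assoc, intervalIntegral.integral_const_mul]

theorem massForm_add {m m₁ : E → ℝ → ℝ} (hm : ∀ e, ContinuousOn (m e) (Icc 0 1))
    (hm₁ : ∀ e, ContinuousOn (m₁ e) (Icc 0 1))
    (hm' : ∀ e, ContinuousOn (fun x => m e x + m₁ e x) (Icc 0 1)) (f h : testSpace G) :
    massForm G (fun e x => m e x + m₁ e x) hm' f h = massForm G m hm f h + massForm G m₁ hm₁ f h := by
  simp only [massForm_apply, ← Finset.sum_add_distrib]
  refine Finset.sum_congr rfl fun e _ => ?_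
  rw [← intervalIntegral.integral_add (intervalIntegrable_Icc (continuousOn_mass_mul hm _ _ e))
    (intervalIntegrable_Icc (continuousOn_mass_mul hm₁ _ _ e))]
  exact integral_congr_Icc fun x _ => by ring

theorem coefQuad_mul (c d : ℝ) (p : E → ℝ) {m : E → ℝ → ℝ}
    (hm : ∀ e, ContinuousOn (m e) (Icc 0 1)) (f : testSpace G) :
    coefQuad (fun e => c * p e) (fun e x => d * m e x) f =
      c * gradForm G p f f - d * massForm G m hm f f := by
  have hd : ∀ e, ContinuousOn (fun x => d * m e x) (Icc 0 1) :=
    fun e => continuousOn_const.mul (hm e)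
  rw [coefQuad_eq _ hd, gradForm_smul, massForm_smul d hm]

variable [Fintype V] [DecidableEq V] [Nonempty E]

omit [Nonempty E] in
theorem normalizedEigenvalue_eq {g : E → ℝ} {ρ : E → ℝ → ℝ} (hgρ : IsMetricDensity g ρ)
    {e : ℕ → testSpace G} {lam : ℕ → ℝ}
    (h : IsSpectralSequence (gradForm G (conductance g))
      (massForm G (massDensity g ρ) (continuousOn_massDensity hgρ)) e lam) (k : ℕ) (α : ℝ) :
    normalizedEigenvalue G k α g ρ = lam k * normFactor α g ρ := by
  rw [normalizedEigenvalue, eigenvalue_eq hgρ h, normFactor, mul_assoc]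

omit [Fintype V] [DecidableEq V] in
-- This specialises the abstract perturbation lemma. At `t = 0` the form is `τ N₀ (a - lam b)`, null
-- on `A` and coercive on `B`; its `t`-derivative on `A` is `τ` times the first variation minus `c
-- b`. The sign `τ` lets the same statement serve lower and upper bounds.
theorem HasFirstVariation.eventually_nonneg {g : ℝ → E → ℝ} {ρ : ℝ → E → ℝ → ℝ} {h : E → ℝ}
    {σ : E → ℝ → ℝ} (hv : HasFirstVariation g ρ h σ) (hgρ : IsMetricDensity (g 0) (ρ 0))
    (α τ c : ℝ) {lam γ ε : ℝ} (hlam : 0 ≤ lam) (hγ : 0 < γ) (hε : 0 < ε)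
    {A B : Set (testSpace G)}
    (hA : ∀ u ∈ A, ∀ x, gradForm G (conductance (g 0)) u x =
      lam * massForm G (massDensity (g 0) (ρ 0)) (continuousOn_massDensity hgρ) u x)
    (hA' : ∀ u ∈ A, ε * massForm G (massDensity (g 0) (ρ 0)) (continuousOn_massDensity hgρ) u u ≤
      τ * (variationQuad α (lam * normFactor α (g 0) (ρ 0)) (g 0) (ρ 0) h σ u
        - c * massForm G (massDensity (g 0) (ρ 0)) (continuousOn_massDensity hgρ) u u))
    (hB : ∀ v ∈ B, γ * (gradForm G (conductance (g 0)) v v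
        + massForm G (massDensity (g 0) (ρ 0)) (continuousOn_massDensity hgρ) v v) ≤
      τ * (gradForm G (conductance (g 0)) v v
        - lam * massForm G (massDensity (g 0) (ρ 0)) (continuousOn_massDensity hgρ) v v)) :
    ∀ᶠ t in 𝓝[>] (0 : ℝ), ∀ u ∈ A, ∀ v ∈ B,
      0 ≤ τ * coefQuad (fun e => normFactor α (g t) (ρ t) * conductance (g t) e)
        (fun e x => (lam * normFactor α (g 0) (ρ 0) + c * t) * massDensity (g t) (ρ t) e x)
        (u + v) := by
  set hm := continuousOn_massDensity hgρ
  have hm0 := massDensity_pos hgρ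
  have hp0 := conductance_pos hgρ
  set a := gradForm G (conductance (g 0))
  set b := massForm G (massDensity (g 0) (ρ 0)) hm
  set N₀ := normFactor α (g 0) (ρ 0)
  have hN₀ : 0 < N₀ := normFactor_pos α hgρ
  have ha0 : ∀ f, 0 ≤ a f f := gradForm_nonneg fun e => (hp0 e).le
  have hb0 : ∀ f, 0 ≤ b f f := massForm_nonneg fun e x hx => (hm0 e x hx).le
  set p' : E → ℝ := fun e => normFactorVar α (g 0) (ρ 0) h σ * conductance (g 0) e
    + N₀ * conductanceVar (g 0) h e
  set m' : E → ℝ → ℝ := fun e x => c * massDensity (g 0) (ρ 0) e x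
    + (lam * N₀) * massDensityVar (g 0) (ρ 0) h σ e x
  have hvc := continuousOn_massDensityVar hgρ (h := h) hv.continuousOn
  have hm'c : ∀ e, ContinuousOn (m' e) (Icc 0 1) := fun e =>
    (continuousOn_const.mul (hm e)).add (continuousOn_const.mul (hvc e))
  have hp : ∀ e, HasDerivAt (fun t => normFactor α (g t) (ρ t) * conductance (g t) e) (p' e) 0 :=
    fun e => (hv.hasDerivAt_normFactor α).mul (hv.hasDerivAt_conductance e)
  have hmd : ∀ e, HasUniformDerivAtZero
      (fun t x => (lam * N₀ + c * t) * massDensity (g t) (ρ t) e x) (m' e) := by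
    intro e
    have hs : HasDerivAt (fun t : ℝ => lam * N₀ + c * t) c 0 := by
      simpa using ((hasDerivAt_id (0 : ℝ)).const_mul c).const_add (lam * N₀)
    have := (hv.hasUniformDerivAtZero_massDensity e).smul hs (hm e) (hvc e)
    simpa only [mul_zero, add_zero] using this
  have hmc : ∀ᶠ t in 𝓝 (0 : ℝ), ∀ e, ContinuousOn
      (fun x => (lam * N₀ + c * t) * massDensity (g t) (ρ t) e x) (Icc 0 1) :=
    hv.mem.mono fun t ht e => continuousOn_const.mul (continuousOn_massDensity ht e)
  have hΛc : ∀ e, ContinuousOn (fun x => (lam * N₀) * massDensity (g 0) (ρ 0) e x) (Icc 0 1) :=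
    fun e => continuousOn_const.mul (hm e)
  have hΛc' : ∀ e, ContinuousOn (fun x => (lam * N₀) * massDensityVar (g 0) (ρ 0) h σ e x)
    (Icc 0 1) := fun e => continuousOn_const.mul (hvc e)
  obtain ⟨C, hC⟩ := exists_abs_coefQuad_le (G := G) (p := p') hm'c hm hp0 hm0
  have hcc : ∀ e, ContinuousOn (fun x => c * massDensity (g 0) (ρ 0) e x) (Icc 0 1) :=
    fun e => continuousOn_const.mul (hm e)
  have hT : ∀ f, coefQuad p' m' f = variationQuad α (lam * N₀) (g 0) (ρ 0) h σ f - c * b f f := by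
    intro f
    rw [variationQuad, coefQuad_eq p' hm'c, coefQuad_eq _ hΛc',
      massForm_add hcc hΛc' hm'c, massForm_smul c hm]
    ring
  have hS : ∀ f x, (gradForm G (fun e => N₀ * conductance (g 0) e)
      - massForm G _ hΛc) f x = N₀ * (a f x - lam * b f x) := by
    intro f x
    rw [LinearMap.sub_apply, LinearMap.sub_apply, gradForm_smul, massForm_smul _ hm]
    ring
  -- The reference norm is `a + b`, which equals `(1 + lam) b` on `A`; this is why the positivity
  -- constant becomes `ε / (1 + lam)`.
  refine eventually_nonneg_of_expansion (n := a + b)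
    (S₀ := τ • (gradForm G (fun e => N₀ * conductance (g 0) e) - massForm G _ hΛc))
    (T := τ • (gradForm G p' - massForm G m' hm'c)) (C := |τ| * C) (γ := N₀ * γ)
    (ε := ε / (1 + lam))
    (S := fun t f => τ * coefQuad (fun e => normFactor α (g t) (ρ t) * conductance (g t) e)
        (fun e x => (lam * N₀ + c * t) * massDensity (g t) (ρ t) e x) f)
    (fun x y => ?_) (fun x => add_nonneg (ha0 x) (hb0 x)) (fun x y => ?_) (fun x y => ?_)
    (by positivity) (by positivity) (fun η hη => ?_) (fun x => ?_) (fun u hu x => ?_)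
    (fun u hu => ?_) (fun v hv => ?_)
  · simp only [LinearMap.add_apply, a, b, gradForm_comm _ x, massForm_comm _ _ x]
  · simp only [LinearMap.smul_apply, LinearMap.sub_apply, gradForm_comm _ x, massForm_comm _ _ x]
  · simp only [LinearMap.smul_apply, LinearMap.sub_apply, gradForm_comm _ x, massForm_comm _ _ x]
  · have key := coefQuad_expansion (G := G) hm hp0 hm0 hp hmd hmc hm'c
      (show 0 < η / (|τ| + 1) by positivity)
    refine (key.filter_mono nhdsWithin_le_nhds).mono fun t ht f => ?_
    have h1 := ht f
    have h2 : (τ • (gradForm G (fun e => N₀ * conductance (g 0) e) - massForm G _ hΛc)) f f =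
        τ * coefQuad (fun e => N₀ * conductance (g 0) e)
          (fun e x => (lam * N₀ + c * 0) * massDensity (g 0) (ρ 0) e x) f := by
      simp only [mul_zero, add_zero]
      rfl
    have h3 : (τ • (gradForm G p' - massForm G m' hm'c)) f f = τ * coefQuad p' m' f := rfl
    rw [h2, h3]
    have h4 : ∀ A B C : ℝ, τ * A - τ * B - t * (τ * C) = τ * (A - B - t * C) :=
      fun A B C => by ring
    rw [h4, abs_mul]
    have hn : 0 ≤ |t| * (a f f + b f f) := mul_nonneg (abs_nonneg _) (add_nonneg (ha0 f) (hb0 f))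
    calc |τ| * _ ≤ |τ| * (η / (|τ| + 1) * |t| * (a f f + b f f)) :=
          mul_le_mul_of_nonneg_left h1 (abs_nonneg _)
      _ = (|τ| * (η / (|τ| + 1))) * (|t| * (a f f + b f f)) := by ring
      _ ≤ η * (|t| * (a f f + b f f)) := by
          refine mul_le_mul_of_nonneg_right ?_ hn
          rw [← mul_div_assoc, div_le_iff₀ (by positivity)]
          nlinarith [abs_nonneg τ]
      _ = η * |t| * (a + b) f f := by rw [mul_assoc]; rfl
  · have h3 : (τ • (gradForm G p' - massForm G m' hm'c)) x x = τ * coefQuad p' m' x := rfl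
    rw [h3, abs_mul, mul_assoc]
    exact mul_le_mul_of_nonneg_left (hC x) (abs_nonneg _)
  · rw [LinearMap.smul_apply, LinearMap.smul_apply, hS, hA u hu, sub_self, mul_zero, smul_zero]
  · have h3 : (τ • (gradForm G p' - massForm G m' hm'c)) u u = τ * coefQuad p' m' u := rfl
    have h4 : (a + b) u u = (1 + lam) * b u u := by
      rw [LinearMap.add_apply, LinearMap.add_apply, hA u hu]; ring
    rw [h3, hT, h4, ← mul_assoc, div_mul_cancel₀ _ (by positivity)]
    exact hA' u hu
  · rw [LinearMap.smul_apply, LinearMap.smul_apply, hS, smul_eq_mul]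
    have h5 := mul_le_mul_of_nonneg_left (hB v hv) hN₀.le
    rw [LinearMap.add_apply, LinearMap.add_apply]
    linarith

/-- A lower bound for the normalised eigenvalue along a family. -/
theorem HasFirstVariation.eventually_le_normalizedEigenvalue {g : ℝ → E → ℝ} {ρ : ℝ → E → ℝ → ℝ}
    {h : E → ℝ} {σ : E → ℝ → ℝ} {g₀ : E → ℝ} {ρ₀ : E → ℝ → ℝ}
    (hv : HasFirstVariation g ρ h σ) (hg₀ : g 0 = g₀) (hρ₀ : ρ 0 = ρ₀)
    (hgρ : IsMetricDensity g₀ ρ₀) (α : ℝ) {c c₁ : ℝ} (hc : c < c₁)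
    {e : ℕ → testSpace G} {lam : ℕ → ℝ}
    (hs : IsSpectralSequence (gradForm G (conductance g₀))
      (massForm G (massDensity g₀ ρ₀) (continuousOn_massDensity hgρ)) e lam) {k N : ℕ}
    (hk : 0 ≤ lam k) (hN : lam k < lam N) {A : Set (testSpace G)}
    (hA : ∀ u ∈ A, ∀ x, gradForm G (conductance g₀) u x =
      lam k * massForm G (massDensity g₀ ρ₀) (continuousOn_massDensity hgρ) u x)
    (hA' : ∀ u ∈ A, c₁ * massForm G (massDensity g₀ ρ₀) (continuousOn_massDensity hgρ) u u ≤
      variationQuad α (lam k * normFactor α g₀ ρ₀) g₀ ρ₀ h σ u)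
    (hsel : ∀ w : Fin (k + 1) → testSpace G, ∃ d : Fin (k + 1) → ℝ, d ≠ 0 ∧ ∃ u ∈ A, ∀ i < N,
      massForm G (massDensity g₀ ρ₀) (continuousOn_massDensity hgρ) (e i)
        (∑ j, d j • w j - u) = 0) :
    ∀ᶠ t in 𝓝[>] (0 : ℝ), normalizedEigenvalue G k α g₀ ρ₀ + c * t ≤
      normalizedEigenvalue G k α (g t) (ρ t) := by
  subst hg₀ hρ₀
  set hm := continuousOn_massDensity hgρ
  set a := gradForm G (conductance (g 0))
  set b := massForm G (massDensity (g 0) (ρ 0)) hm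
  have hb0 : ∀ f, 0 ≤ b f f := massForm_nonneg fun e x hx => (massDensity_pos hgρ e x hx).le
  have hN1 : 0 < lam N + 1 := by linarith
  -- For `v` orthogonal to the first `N` modes, `a v v ≥ lam N * b v v`, and this `γ` is the
  -- resulting coercivity constant of `a - lam k * b` relative to `a + b`.
  have key := hv.eventually_nonneg hgρ α 1 c hk (γ := (lam N - lam k) / (lam N + 1))
    (div_pos (sub_pos.2 hN) hN1) (sub_pos.2 hc) hA
    (B := {v | ∀ i < N, b (e i) v = 0}) (fun u hu => by have := hA' u hu; linarith)
    (fun v hv => by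
      have h1 := hs.minimal N v hv
      rw [one_mul, div_mul_eq_mul_div, div_le_iff₀ hN1]
      nlinarith [hb0 v])
  filter_upwards [key, hv.mem.filter_mono nhdsWithin_le_nhds] with t ht hgt
  obtain ⟨et, lamt, hst⟩ := exists_isSpectralSequence G hgt
  rw [normalizedEigenvalue_eq hgρ hs, normalizedEigenvalue_eq hgt hst]
  -- The span of the first `k + 1` modes at time `t` meets `A + B` nontrivially. On that vector the
  -- nonnegative form is at most the difference between the eigenvalue at time `t` and the claimed
  -- bound, times a positive mass.
  obtain ⟨d, hd, u, hu, hdu⟩ := hsel fun i => et i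
  have h1 := ht u hu _ hdu
  rw [add_sub_cancel, one_mul, coefQuad_mul _ _ _ (continuousOn_massDensity hgt)] at h1
  have h2 := hst.energy_le d
  have h3 := hst.mass_pos hd
  have h4 := mul_le_mul_of_nonneg_left h2 (normFactor_pos α hgt).le
  refine le_of_mul_le_mul_right ?_ h3
  linarith

/-- An upper bound for the normalised eigenvalue along a family. -/
theorem HasFirstVariation.eventually_normalizedEigenvalue_le {g : ℝ → E → ℝ} {ρ : ℝ → E → ℝ → ℝ}
    {h : E → ℝ} {σ : E → ℝ → ℝ} {g₀ : E → ℝ} {ρ₀ : E → ℝ → ℝ}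
    (hv : HasFirstVariation g ρ h σ) (hg₀ : g 0 = g₀) (hρ₀ : ρ 0 = ρ₀)
    (hgρ : IsMetricDensity g₀ ρ₀) (α : ℝ) {c c₁ : ℝ} (hc : c₁ < c)
    {e : ℕ → testSpace G} {lam : ℕ → ℝ}
    (hs : IsSpectralSequence (gradForm G (conductance g₀))
      (massForm G (massDensity g₀ ρ₀) (continuousOn_massDensity hgρ)) e lam) {k : ℕ}
    (hk : 0 ≤ lam k) {A : Set (testSpace G)}
    (hA : ∀ u ∈ A, ∀ x, gradForm G (conductance g₀) u x =
      lam k * massForm G (massDensity g₀ ρ₀) (continuousOn_massDensity hgρ) u x)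
    (hA' : ∀ u ∈ A, variationQuad α (lam k * normFactor α g₀ ρ₀) g₀ ρ₀ h σ u ≤
      c₁ * massForm G (massDensity g₀ ρ₀) (continuousOn_massDensity hgρ) u u)
    {w : Fin (k + 1) → testSpace G}
    (hw : ∀ d : Fin (k + 1) → ℝ, d ≠ 0 → 0 < massForm G (massDensity g₀ ρ₀)
      (continuousOn_massDensity hgρ) (∑ j, d j • w j) (∑ j, d j • w j))
    (hsel : ∀ d : Fin (k + 1) → ℝ, ∃ u ∈ A, ∃ c : ℕ → ℝ, ∑ j, d j • w j =
      u + ∑ i ∈ (Finset.range k).filter (fun i => lam i < lam k), c i • e i) :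
    ∀ᶠ t in 𝓝[>] (0 : ℝ), normalizedEigenvalue G k α (g t) (ρ t) ≤
      normalizedEigenvalue G k α g₀ ρ₀ + c * t := by
  subst hg₀ hρ₀
  set hm := continuousOn_massDensity hgρ
  set a := gradForm G (conductance (g 0))
  set b := massForm G (massDensity (g 0) (ρ 0)) hm
  set s := (Finset.range k).filter (fun i => lam i < lam k)
  obtain ⟨γ, hγ, hγs⟩ : ∃ γ > 0, ∀ i ∈ s, γ * (lam i + 1) ≤ lam k - lam i := by
    rcases s.eq_empty_or_nonempty with h0 | h0
    · exact ⟨1, one_pos, by simp [h0]⟩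
    · obtain ⟨i₀, hi₀, hmin⟩ := s.exists_min_image (fun i => lam k - lam i) h0
      have hp : 0 < lam k - lam i₀ := sub_pos.2 (Finset.mem_filter.1 hi₀).2
      -- The smallest gap below `lam k`, divided by a bound for `lam i + 1`.
      refine ⟨(lam k - lam i₀) / (lam k + 1), by positivity, fun i hi => ?_⟩
      rw [div_mul_eq_mul_div, div_le_iff₀ (by positivity)]
      have h1 := hmin i hi
      have h2 := (Finset.mem_filter.1 hi).2
      nlinarith
  have key := hv.eventually_nonneg hgρ α (-1) c hk hγ (sub_pos.2 hc) hA
    (B := {v | ∃ c : ℕ → ℝ, v = ∑ i ∈ s, c i • e i}) (fun u hu => by have := hA' u hu; linarith)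
    (by
      rintro _ ⟨c, rfl⟩
      rw [hs.energy_sum_self, hs.mass_sum_self, ← Finset.sum_add_distrib, Finset.mul_sum,
        Finset.mul_sum, ← Finset.sum_sub_distrib, Finset.mul_sum]
      refine Finset.sum_le_sum fun i hi => ?_
      nlinarith [mul_le_mul_of_nonneg_right (hγs i hi) (sq_nonneg (c i))])
  filter_upwards [key, hv.mem.filter_mono nhdsWithin_le_nhds] with t ht hgt
  obtain ⟨et, lamt, hst⟩ := exists_isSpectralSequence G hgt
  rw [normalizedEigenvalue_eq hgρ hs, normalizedEigenvalue_eq hgt hst]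
  have hNt := normFactor_pos α hgt
  rw [← le_div_iff₀ hNt]
  -- The span of `w` lies in `A + B`, where the perturbed form is nonpositive, so it is a test space
  -- for the min-max bound at time `t`.
  refine hst.le_of_test (w := w) (fun d hd => ?_) fun d => ?_
  · refine (massForm_nonneg (fun e x hx => (massDensity_pos hgt e x hx).le) _).lt_of_ne' fun h0 => ?_
    exact (hw d hd).ne' (massForm_eq_zero_of_vanish
      (fun e x hx => massForm_eq_zero (massDensity_pos hgt) h0 e hx) _)
  · obtain ⟨u, hu, c', hc'⟩ := hsel d
    have h1 := ht u hu _ ⟨c', rfl⟩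
    rw [← hc', coefQuad_mul _ _ _ (continuousOn_massDensity hgt)] at h1
    rw [div_mul_eq_mul_div, le_div_iff₀ hNt]
    linarith

end Perturbation

/-! ### The first variation in terms of its metric and density gradients. -/

section VariationFormula

variable {V E : Type*} {G : DiscreteGraph V E} [Fintype E]

/-- The first variation of the normalised forms, as a bilinear form. -/
noncomputable def variationForm (G : DiscreteGraph V E) (α Λ : ℝ) {g : E → ℝ} {ρ : E → ℝ → ℝ}
    (hgρ : IsMetricDensity g ρ) (h : E → ℝ) {σ : E → ℝ → ℝ}
    (hσ : ∀ e, ContinuousOn (σ e) (Icc 0 1)) : testSpace G →ₗ[ℝ] testSpace G →ₗ[ℝ] ℝ :=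
  gradForm G (fun e => normFactorVar α g ρ h σ * conductance g e
    + normFactor α g ρ * conductanceVar g h e)
  - massForm G (fun e x => Λ * massDensityVar g ρ h σ e x)
    (fun e => continuousOn_const.mul (continuousOn_massDensityVar hgρ hσ e))

theorem variationForm_self (α Λ : ℝ) {g : E → ℝ} {ρ : E → ℝ → ℝ}
    (hgρ : IsMetricDensity g ρ) (h : E → ℝ) {σ : E → ℝ → ℝ}
    (hσ : ∀ e, ContinuousOn (σ e) (Icc 0 1)) (f : testSpace G) :
    variationForm G α Λ hgρ h hσ f f = variationQuad α Λ g ρ h σ f := rfl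

/-- The derivative of the normalised forms with respect to the metric of an edge. -/
noncomputable def metricGradient (α Λ : ℝ) (g : E → ℝ) (ρ : E → ℝ → ℝ) (f f' : testSpace G)
    (e : E) : ℝ :=
  gradForm G (conductance g) f f' * ((1 - α) * g e ^ (-α) * normH α g ρ
      + normF α g * (α * g e ^ (α - 1) * ∫ x in (0 : ℝ)..1, ρ e x))
    - normFactor α g ρ / (2 * g e * √(g e)) *
      (∫ x in (0 : ℝ)..1, edgeDeriv f.1 e x * edgeDeriv f'.1 e x)
    - Λ / (2 * √(g e)) * ∫ x in (0 : ℝ)..1, ρ e x * (f.1 e x * f'.1 e x)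

/-- The derivative of the normalised forms with respect to the density. -/
noncomputable def densityGradient (α Λ : ℝ) (g : E → ℝ) (f f' : testSpace G) (e : E)
    (x : ℝ) : ℝ :=
  gradForm G (conductance g) f f' * (normF α g * g e ^ α)
    - Λ * √(g e) * (f.1 e x * f'.1 e x)

theorem continuousOn_densityGradient (α Λ : ℝ) (g : E → ℝ) (f f' : testSpace G) (e : E) :
    ContinuousOn (densityGradient α Λ g f f' e) (Icc 0 1) :=
  continuousOn_const.sub
    (continuousOn_const.mul ((testSpace_continuousOn f e).mul (testSpace_continuousOn f' e)))

theorem variationForm_apply (α Λ : ℝ) {g : E → ℝ} {ρ : E → ℝ → ℝ}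
    (hgρ : IsMetricDensity g ρ) (h : E → ℝ) {σ : E → ℝ → ℝ}
    (hσ : ∀ e, ContinuousOn (σ e) (Icc 0 1)) (f f' : testSpace G) :
    variationForm G α Λ hgρ h hσ f f' = ∑ e, (h e * metricGradient α Λ g ρ f f' e
      + ∫ x in (0 : ℝ)..1, σ e x * densityGradient α Λ g f f' e x) := by
  have hρ := fun e => (hgρ.2.1 e).continuousOn
  have e1 : ∀ e, ∫ x in (0 : ℝ)..1, Λ * massDensityVar g ρ h σ e x * (f.1 e x * f'.1 e x) =
      Λ * (h e / (2 * √(g e))) * (∫ x in (0 : ℝ)..1, ρ e x * (f.1 e x * f'.1 e x))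
      + Λ * √(g e) * ∫ x in (0 : ℝ)..1, σ e x * (f.1 e x * f'.1 e x) := by
    intro e
    rw [← intervalIntegral.integral_const_mul, ← intervalIntegral.integral_const_mul,
      ← intervalIntegral.integral_add]
    · exact integral_congr_Icc fun x _ => by rw [massDensityVar]; ring
    · exact (intervalIntegrable_Icc (continuousOn_mass_mul hρ f f' e)).const_mul _
    · exact (intervalIntegrable_Icc (continuousOn_mass_mul hσ f f' e)).const_mul _
  have e2 : ∀ e, ∫ x in (0 : ℝ)..1, σ e x * densityGradient α Λ g f f' e x =
      gradForm G (conductance g) f f' * (normF α g * g e ^ α) * (∫ x in (0 : ℝ)..1, σ e x)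
      - Λ * √(g e) * ∫ x in (0 : ℝ)..1, σ e x * (f.1 e x * f'.1 e x) := by
    intro e
    rw [← intervalIntegral.integral_const_mul, ← intervalIntegral.integral_const_mul,
      ← intervalIntegral.integral_sub]
    · exact integral_congr_Icc fun x _ => by rw [densityGradient]; ring
    · exact (intervalIntegrable_Icc (hσ e)).const_mul _
    · exact (intervalIntegrable_Icc (continuousOn_mass_mul hσ f f' e)).const_mul _
  have e3 : gradForm G (fun e => normFactorVar α g ρ h σ * conductance g e
      + normFactor α g ρ * conductanceVar g h e) f f' =
      ∑ e, (gradForm G (conductance g) f f' * ((1 - α) * g e ^ (-α) * h e * normH α g ρ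
        + normF α g * (α * g e ^ (α - 1) * h e * (∫ x in (0 : ℝ)..1, ρ e x)
          + g e ^ α * ∫ x in (0 : ℝ)..1, σ e x))
        + normFactor α g ρ * conductanceVar g h e *
          ∫ x in (0 : ℝ)..1, edgeDeriv f.1 e x * edgeDeriv f'.1 e x) := by
    have e4 : normFactorVar α g ρ h σ = ∑ e, ((1 - α) * g e ^ (-α) * h e * normH α g ρ
        + normF α g * (α * g e ^ (α - 1) * h e * (∫ x in (0 : ℝ)..1, ρ e x)
          + g e ^ α * ∫ x in (0 : ℝ)..1, σ e x)) := by
      rw [normFactorVar, normFVar, normHVar, Finset.sum_mul, Finset.mul_sum,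
        ← Finset.sum_add_distrib]
    rw [Finset.sum_add_distrib, ← Finset.mul_sum, ← e4, gradForm_apply, gradForm_apply,
      Finset.sum_mul, ← Finset.sum_add_distrib]
    exact Finset.sum_congr rfl fun e _ => by ring
  rw [variationForm, LinearMap.sub_apply, LinearMap.sub_apply, e3, massForm_apply,
    ← Finset.sum_sub_distrib]
  refine Finset.sum_congr rfl fun e _ => ?_
  rw [e1, e2, metricGradient, conductanceVar]
  ring

theorem variationQuad_neg (α Λ : ℝ) {g : E → ℝ} {ρ : E → ℝ → ℝ}
    (hgρ : IsMetricDensity g ρ) (h : E → ℝ) {σ : E → ℝ → ℝ}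
    (hσ : ∀ e, ContinuousOn (σ e) (Icc 0 1)) (f : testSpace G) :
    variationQuad α Λ g ρ (fun e => -h e) (fun e x => -σ e x) f = -variationQuad α Λ g ρ h σ f := by
  have hσn : ∀ e, ContinuousOn (fun x => -σ e x) (Icc 0 1) := fun e => (hσ e).neg
  rw [← variationForm_self (σ := fun e x => -σ e x) α Λ hgρ _ hσn,
    ← variationForm_self α Λ hgρ h hσ,
    variationForm_apply, variationForm_apply, ← Finset.sum_neg_distrib]
  refine Finset.sum_congr rfl fun e _ => ?_
  simp only [neg_mul, intervalIntegral.integral_neg]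
  ring

end VariationFormula

/-! ### Convex separation and annihilating vectors. -/

section Separation

theorem isCompact_convexJoin {F : Type*} [NormedAddCommGroup F] [NormedSpace ℝ F] {s t : Set F}
    (hs : IsCompact s) (ht : IsCompact t) : IsCompact (convexJoin ℝ s t) := by
  have h := ((isCompact_Icc (a := (0 : ℝ)) (b := 1)).prod (hs.prod ht)).image
    (f := fun q : ℝ × F × F => (1 - q.1) • q.2.1 + q.1 • q.2.2) (by fun_prop)
  convert h using 1
  ext z
  simp only [mem_convexJoin, segment_eq_image, mem_image, mem_prod, Prod.exists]
  constructor
  · rintro ⟨x, hx, y, hy, c, hc, hz⟩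
    exact ⟨c, x, y, ⟨hc, hx, hy⟩, hz⟩
  · rintro ⟨c, x, y, ⟨hc, hx, hy⟩, hz⟩
    exact ⟨x, hx, y, hy, c, hc, hz⟩

/-- By Carathéodory the hull is a finite union of iterated joins of `K` with itself, as many as the
dimension allows, and joins of compact sets are compact. -/
theorem isCompact_convexHull {F : Type*} [NormedAddCommGroup F] [NormedSpace ℝ F]
    [FiniteDimensional ℝ F] {K : Set F} (hK : IsCompact K) : IsCompact (convexHull ℝ K) := by
  let S : ℕ → Set F := fun n => Nat.rec K (fun _ T => convexJoin ℝ K T) n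
  have hS1 : ∀ n, S (n + 1) = convexJoin ℝ K (S n) := fun n => rfl
  have hSc : ∀ n, IsCompact (S n) := by
    intro n
    induction n with
    | zero => exact hK
    | succ n ih => exact isCompact_convexJoin hK ih
  have hSs : ∀ n, S n ⊆ convexHull ℝ K := by
    intro n
    induction n with
    | zero => exact subset_convexHull ℝ K
    | succ n ih =>
      rw [hS1]
      exact convexJoin_subset (subset_convexHull ℝ K) ih (convex_convexHull ℝ K)
  have hSt : ∀ (n : ℕ) (t : Finset F), (t : Set F) ⊆ K → t.card = n + 1 →
      convexHull ℝ (t : Set F) ⊆ S n := by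
    classical
    intro n
    induction n with
    | zero =>
      intro t ht hc
      obtain ⟨x, rfl⟩ := Finset.card_eq_one.1 hc
      simpa [S] using ht
    | succ n ih =>
      intro t ht hc
      obtain ⟨x, u, hxu, rfl, hu⟩ := Finset.card_eq_succ.1 hc
      rw [Finset.coe_insert] at ht ⊢
      have hne : (u : Set F).Nonempty := by
        rw [Finset.coe_nonempty, ← Finset.card_pos]; omega
      rw [convexHull_insert hne, hS1]
      exact (convexJoin_mono_left (singleton_subset_iff.2 (ht (mem_insert _ _)))).trans
        (convexJoin_mono_right (ih u ((subset_insert _ _).trans ht) hu))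
  have h : convexHull ℝ K = ⋃ n ∈ Finset.range (Module.finrank ℝ F + 1), S n := by
    refine subset_antisymm ?_ (iUnion₂_subset fun n _ => hSs n)
    rw [convexHull_eq_union]
    refine iUnion_subset fun t => iUnion₂_subset fun ht hind => ?_
    rcases t.eq_empty_or_nonempty with rfl | hne
    · simp
    · obtain ⟨n, hn⟩ := Nat.exists_eq_succ_of_ne_zero hne.card_pos.ne'
      have h1 := hind.card_le_finrank_succ
      have h2 := Submodule.finrank_le (vectorSpan ℝ (range ((↑) : t → F)))
      rw [Fintype.card_coe] at h1
      refine (hSt n t ht hn).trans (subset_iUnion₂_of_subset n ?_ subset_rfl)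
      rw [Finset.mem_range]; omega
  rw [h]
  exact Finset.isCompact_biUnion _ fun n _ => hSc n

/-- If no combination of finitely many continuous functions is positive on a compact set, then a
convex combination of evaluations at points of the set annihilates all of them. -/
theorem exists_weights_of_not_pos {X : Type*} [TopologicalSpace X] {K : Set X} (hK : IsCompact K)
    {d : ℕ} {Ψ : X → Fin d → ℝ} (hΨ : Continuous Ψ)
    (h : ∀ c : Fin d → ℝ, ¬ ∃ ε > 0, ∀ v ∈ K, ε ≤ ∑ l, c l * Ψ v l) :
    ∃ (n : ℕ) (v : Fin n → X) (w : Fin n → ℝ), 0 < n ∧ (∀ i, v i ∈ K) ∧ (∀ i, 0 < w i) ∧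
      ∀ l, ∑ i, w i * Ψ (v i) l = 0 := by
  -- If `0` were outside the hull of the image, a separating functional would be a combination
  -- bounded below by a positive constant on `K`.
  have h0 : (0 : Fin d → ℝ) ∈ convexHull ℝ (Ψ '' K) := by
    by_contra hne
    have hc : IsClosed (convexHull ℝ (Ψ '' K)) := (isCompact_convexHull (hK.image hΨ)).isClosed
    obtain ⟨f, u, hu, hb⟩ := geometric_hahn_banach_point_closed (convex_convexHull ℝ _) hc hne
    rw [map_zero] at hu
    refine h (fun l => f (Pi.single l 1)) ⟨u, hu, fun v hv => ?_⟩
    have h1 := hb (Ψ v) (subset_convexHull ℝ _ ⟨v, hv, rfl⟩)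
    have h2 : f (Ψ v) = ∑ l, f (Pi.single l 1) * Ψ v l := by
      conv_lhs => rw [pi_eq_sum_univ' (Ψ v), map_sum]
      refine Finset.sum_congr rfl fun l _ => ?_
      rw [map_smul, smul_eq_mul, mul_comm]
    rw [← h2]
    exact h1.le
  obtain ⟨ι, hι, z, w, hz, -, hw, hw1, hsum⟩ := eq_pos_convex_span_of_mem_convexHull h0
  choose x hxK hx using fun i => hz ⟨i, rfl⟩
  have eq := Fintype.equivFin ι
  refine ⟨Fintype.card ι, fun i => x (eq.symm i), fun i => w (eq.symm i), ?_, fun i => hxK _,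
    fun i => hw _, fun l => ?_⟩
  · rw [Fintype.card_pos_iff]
    by_contra hemp
    rw [not_nonempty_iff] at hemp
    simp at hw1
  · have h3 := congrFun hsum l
    rw [Finset.sum_apply] at h3
    simp only [Pi.smul_apply, smul_eq_mul, Pi.zero_apply] at h3
    simp only [hx]
    rw [eq.symm.sum_comp fun i => w i * z i l]
    exact h3

/-- If no member of a linear family of quadratic forms is positive definite, then the family is
annihilated by a positive combination of evaluations at unit vectors. -/
theorem exists_annihilating_vectors {P J : Type*} [AddCommGroup P] [Module ℝ P] [Fintype J]
    (M : P →ₗ[ℝ] (J → J → ℝ))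
    (h : ∀ p, ¬ ∃ ε > 0, ∀ v : J → ℝ, ε * ∑ i, v i ^ 2 ≤ ∑ i, ∑ j, M p i j * (v i * v j)) :
    ∃ (n : ℕ) (v : Fin n → J → ℝ), 0 < n ∧ (∀ i, v i ≠ 0) ∧
      ∀ p, ∑ l, ∑ i, ∑ j, M p i j * (v l i * v l j) = 0 := by
  -- The parameter space is infinite-dimensional but its image is a finite-dimensional space of
  -- matrices; it suffices to annihilate a basis of the image, testing on the unit sphere.
  set R := LinearMap.range M
  let B := Module.finBasis ℝ R
  choose p hp using fun l => (B l).2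
  set K : Set (J → ℝ) := {v | ∑ i, v i ^ 2 = 1}
  have hK : IsCompact K := by
    refine Metric.isCompact_of_isClosed_isBounded
      (isClosed_eq (by fun_prop) continuous_const) ?_
    refine (Metric.isBounded_closedBall (x := (0 : J → ℝ)) (r := 1)).subset fun v hv => ?_
    rw [mem_closedBall_zero_iff, pi_norm_le_iff_of_nonneg zero_le_one]
    intro i
    have h1 : v i ^ 2 ≤ 1 := (Finset.single_le_sum (f := fun i => v i ^ 2)
      (fun i _ => sq_nonneg _) (Finset.mem_univ i)).trans_eq hv
    exact abs_le_one_iff_mul_self_le_one.2 (by rwa [← pow_two])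
  have hscale : ∀ (q : P) (c : ℝ) (v : J → ℝ),
      ∑ i, ∑ j, M q i j * ((c * v i) * (c * v j)) = c ^ 2 * ∑ i, ∑ j, M q i j * (v i * v j) := by
    intro q c v
    simp only [Finset.mul_sum]
    exact Finset.sum_congr rfl fun i _ => Finset.sum_congr rfl fun j _ => by ring
  obtain ⟨n, v, w, hn, hvK, hw, hsum⟩ := exists_weights_of_not_pos hK
    (Ψ := fun v l => ∑ i, ∑ j, M (p l) i j * (v i * v j)) (by fun_prop) (by
      rintro c ⟨ε, hε, hpos⟩
      have hlin : ∀ v : J → ℝ, ∑ l, c l * ∑ i, ∑ j, M (p l) i j * (v i * v j) =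
          ∑ i, ∑ j, M (∑ l, c l • p l) i j * (v i * v j) := by
        intro v
        simp only [map_sum, map_smul, Finset.sum_apply, Pi.smul_apply, smul_eq_mul,
          Finset.sum_mul, Finset.mul_sum]
        rw [Finset.sum_comm]
        refine Finset.sum_congr rfl fun i _ => ?_
        rw [Finset.sum_comm]
        exact Finset.sum_congr rfl fun j _ => Finset.sum_congr rfl fun l _ => by ring
      refine h (∑ l, c l • p l) ⟨ε, hε, fun v => ?_⟩
      have hnn : 0 ≤ ∑ i, v i ^ 2 := Finset.sum_nonneg fun i _ => sq_nonneg _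
      rcases hnn.eq_or_lt' with h0 | h0
      · have hv0 : ∀ i, v i = 0 := fun i => by
          have := (Finset.sum_eq_zero_iff_of_nonneg fun i _ => sq_nonneg (v i)).1 h0 i
            (Finset.mem_univ i)
          exact pow_eq_zero_iff two_ne_zero |>.1 this
        simp [hv0]
      · set s := √(∑ i, v i ^ 2)
        have hs : 0 < s := Real.sqrt_pos.2 h0
        have hs2 : s ^ 2 = ∑ i, v i ^ 2 := Real.sq_sqrt h0.le
        have h1 := hpos (fun i => s⁻¹ * v i) (by
          change ∑ i, (s⁻¹ * v i) ^ 2 = 1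
          simp only [mul_pow, ← Finset.mul_sum, ← hs2]
          field_simp)
        rw [hlin, hscale, inv_pow, inv_mul_eq_div, le_div_iff₀ (by positivity), hs2] at h1
        exact h1)
  -- The weights are absorbed into the vectors, the forms being quadratic.
  refine ⟨n, fun l i => √(w l) * v l i, hn, fun l h0 => ?_, fun q => ?_⟩
  · have h1 : ∀ i, v l i = 0 := fun i =>
      (mul_eq_zero.1 (congrFun h0 i)).resolve_left (Real.sqrt_pos.2 (hw l)).ne'
    have h2 : ∑ i, v l i ^ 2 = 1 := hvK l
    simp [h1] at h2
  · simp only [hscale, Real.sq_sqrt (hw _).le]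
    have hq : M q = ∑ l, B.repr ⟨M q, LinearMap.mem_range_self M q⟩ l • M (p l) := by
      have h3 := congrArg Subtype.val (B.sum_repr ⟨M q, LinearMap.mem_range_self M q⟩)
      rw [AddSubmonoidClass.coe_finsetSum] at h3
      refine h3.symm.trans ?_
      exact Finset.sum_congr rfl fun l _ => by rw [hp l]; rfl
    set r := fun l => B.repr ⟨M q, LinearMap.mem_range_self M q⟩ l
    have hval : ∀ i j, M q i j = ∑ l, r l * M (p l) i j := fun i j => by
      rw [hq]; simp only [Finset.sum_apply, Pi.smul_apply, smul_eq_mul, r]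
    have h4 : ∀ l, w l * ∑ i, ∑ j, M q i j * (v l i * v l j) =
        ∑ m, r m * (w l * ∑ i, ∑ j, M (p m) i j * (v l i * v l j)) := by
      intro l
      simp only [hval, Finset.sum_mul, Finset.mul_sum]
      conv_rhs => rw [Finset.sum_comm]
      refine Finset.sum_congr rfl fun i _ => ?_
      conv_rhs => rw [Finset.sum_comm]
      exact Finset.sum_congr rfl fun j _ => Finset.sum_congr rfl fun m _ => by ring
    simp only [h4]
    rw [Finset.sum_comm]
    refine Finset.sum_eq_zero fun m _ => ?_
    rw [← Finset.mul_sum, hsum m, mul_zero]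

end Separation

/-! ### Constants on connected graphs and positivity of higher eigenvalues. -/

section Constancy

variable {V E : Type*} {G : DiscreteGraph V E}

theorem eq_of_hasDerivWithinAt_zero {F F' : ℝ → ℝ}
    (h : ∀ z ∈ Icc (0 : ℝ) 1, HasDerivWithinAt F (F' z) (Icc 0 1) z)
    (h0 : ∀ z ∈ Icc (0 : ℝ) 1, F' z = 0) {x : ℝ} (hx : x ∈ Icc (0 : ℝ) 1) : F x = F 0 := by
  have h1 := integral_deriv_Icc (F' := fun _ => 0) le_rfl hx.1 hx.2
    (fun z hz => (h z hz).congr_deriv (h0 z hz)) continuousOn_const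
  rw [intervalIntegral.integral_zero] at h1
  linarith

theorem deriv_eq_zero_of_const {F F' : ℝ → ℝ} {c : ℝ}
    (h : ∀ z ∈ Icc (0 : ℝ) 1, HasDerivWithinAt F (F' z) (Icc 0 1) z)
    (hc : ∀ z ∈ Icc (0 : ℝ) 1, F z = c) {x : ℝ} (hx : x ∈ Icc (0 : ℝ) 1) : F' x = 0 := by
  rw [← derivWithin_Icc_eq hx (h x hx),
    derivWithin_Icc_eq hx ((hasDerivWithinAt_const x (Icc 0 1) c).congr hc (hc x hx))]

/-- On a connected graph, a function that is continuous at the vertices and constant on every edge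
is constant. -/
theorem IsConnected.exists_eq_const [Nonempty E] (hG : G.IsConnected) {P : E → ℝ → ℝ}
    (hP : ∃ φ : V → ℝ, ∀ e, P e 0 = φ (G.src e) ∧ P e 1 = φ (G.tgt e))
    (hc : ∀ e, ∀ x ∈ Icc (0 : ℝ) 1, P e x = P e 0) :
    ∃ C, ∀ e, ∀ x ∈ Icc (0 : ℝ) 1, P e x = C := by
  obtain ⟨φ, hφ⟩ := hP
  have hv : ∀ u v, φ u = φ v := by
    intro u v
    induction hG u v with
    | rel a b hab =>
      obtain ⟨e, rfl, rfl⟩ := hab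
      rw [← (hφ e).1, ← (hφ e).2, hc e 1 (by simp)]
    | refl a => rfl
    | symm a b _ ih => exact ih.symm
    | trans a b c _ _ ih ih' => exact ih.trans ih'
  inhabit E
  exact ⟨φ (G.src default), fun e x hx => by rw [hc e x hx, (hφ e).1]; exact hv _ _⟩

variable [Fintype E]

theorem IsSpectralSequence.eigenvalue_nonneg {g : E → ℝ} {ρ : E → ℝ → ℝ}
    (hgρ : IsMetricDensity g ρ) {e : ℕ → testSpace G} {lam : ℕ → ℝ}
    (hs : IsSpectralSequence (gradForm G (conductance g))
      (massForm G (massDensity g ρ) (continuousOn_massDensity hgρ)) e lam) (i : ℕ) :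
    0 ≤ lam i := by
  have h1 := gradForm_nonneg (fun e => (conductance_pos hgρ e).le) (e i)
  rwa [hs.weak, hs.orthonormal, if_pos rfl, mul_one] at h1

/-- If `lam k = 0`, then modes `0` and `1` both have eigenvalue zero, hence no energy, hence are
constant on the connected graph; two constants cannot be orthonormal. -/
theorem IsSpectralSequence.eigenvalue_pos [Nonempty E] (hG : G.IsConnected) {g : E → ℝ}
    {ρ : E → ℝ → ℝ} (hgρ : IsMetricDensity g ρ) {e : ℕ → testSpace G} {lam : ℕ → ℝ}
    (hs : IsSpectralSequence (gradForm G (conductance g))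
      (massForm G (massDensity g ρ) (continuousOn_massDensity hgρ)) e lam) {k : ℕ} (hk : 1 ≤ k) :
    0 < lam k := by
  refine (hs.eigenvalue_nonneg hgρ k).lt_of_ne' fun h0 => ?_
  have h1 : ∀ i ≤ 1, lam i = 0 := fun i hi =>
    le_antisymm ((hs.mono (hi.trans hk)).trans_eq h0) (hs.eigenvalue_nonneg hgρ i)
  have h2 : ∀ i ≤ 1, ∃ C, ∀ e', ∀ x ∈ Icc (0 : ℝ) 1, (e i).1 e' x = C := by
    intro i hi
    have h3 : gradForm G (conductance g) (e i) (e i) = 0 := by rw [hs.weak, h1 i hi, zero_mul]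
    exact hG.exists_eq_const (e i).2.2 fun e' x hx =>
      eq_of_hasDerivWithinAt_zero (fun z hz => testSpace_hasDerivWithinAt (e i) e' hz)
        (fun z hz => gradForm_eq_zero (conductance_pos hgρ) h3 e' hz) hx
  obtain ⟨C₀, hC₀⟩ := h2 0 zero_le_one
  obtain ⟨C₁, hC₁⟩ := h2 1 le_rfl
  have h4 : C₀ = 0 := by
    have h5 := massForm_eq_zero_of_vanish (hm := continuousOn_massDensity hgρ)
      (f := C₁ • e 0 - C₀ • e 1) (fun e' x hx => by
        change C₁ * (e 0).1 e' x - C₀ * (e 1).1 e' x = 0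
        rw [hC₀ e' x hx, hC₁ e' x hx]; ring) (e 1)
    rw [map_sub, map_smul, map_smul, LinearMap.sub_apply, LinearMap.smul_apply,
      LinearMap.smul_apply, hs.orthonormal, hs.orthonormal] at h5
    simpa using h5
  have h6 := massForm_eq_zero_of_vanish (hm := continuousOn_massDensity hgρ)
    (f := e 0) (fun e' x hx => by rw [hC₀ e' x hx, h4]) (e 0)
  rw [hs.orthonormal, if_pos rfl] at h6
  exact one_ne_zero h6

end Constancy

/-! ### Differential identities and gradients for sums of squares of eigenfunctions. -/

section EigenfunctionSums

variable {V E : Type*} {G : DiscreteGraph V E} [Fintype E]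

section Derivatives

variable [DecidableEq V] {g : E → ℝ} {ρ : E → ℝ → ℝ} {μ : ℝ} {n : ℕ} {f : Fin n → E → ℝ → ℝ}

/-- With `P = ∑ f_i²`, `M = ∑ f_i f_i'`, `K = ∑ f_i'²`, this and the two theorems that follow form a
closed system: `P' = 2M`, `M' = K - g μ ρ P`, `K' = -2 g μ ρ M`. -/
theorem hasDerivWithinAt_sum_sq (hgρ : IsMetricDensity g ρ)
    (hf : ∀ i, IsEigenfunction G g ρ μ (f i)) (e : E) {x : ℝ} (hx : x ∈ Icc (0 : ℝ) 1) :
    HasDerivWithinAt (fun x => ∑ i, f i e x ^ 2) (2 * ∑ i, f i e x * edgeDeriv (f i) e x)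
      (Icc 0 1) x := by
  rw [Finset.mul_sum]
  refine HasDerivWithinAt.fun_sum fun i _ => ?_
  exact (((strong_of_isEigenfunction hgρ (hf i)).1 e x hx).pow 2).congr_deriv (by push_cast; ring)

theorem hasDerivWithinAt_sum_mul_edgeDeriv (hgρ : IsMetricDensity g ρ)
    (hf : ∀ i, IsEigenfunction G g ρ μ (f i)) (e : E) {x : ℝ} (hx : x ∈ Icc (0 : ℝ) 1) :
    HasDerivWithinAt (fun x => ∑ i, f i e x * edgeDeriv (f i) e x)
      ((∑ i, edgeDeriv (f i) e x ^ 2) - g e * μ * ρ e x * ∑ i, f i e x ^ 2) (Icc 0 1) x := by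
  rw [Finset.mul_sum, ← Finset.sum_sub_distrib]
  refine HasDerivWithinAt.fun_sum fun i _ => ?_
  have h := strong_of_isEigenfunction hgρ (hf i)
  exact ((h.1 e x hx).mul (h.2 e x hx)).congr_deriv (by ring)

theorem hasDerivWithinAt_sum_edgeDeriv_sq (hgρ : IsMetricDensity g ρ)
    (hf : ∀ i, IsEigenfunction G g ρ μ (f i)) (e : E) {x : ℝ} (hx : x ∈ Icc (0 : ℝ) 1) :
    HasDerivWithinAt (fun x => ∑ i, edgeDeriv (f i) e x ^ 2)
      (-(2 * g e * μ * ρ e x) * ∑ i, f i e x * edgeDeriv (f i) e x) (Icc 0 1) x := by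
  rw [Finset.mul_sum]
  refine HasDerivWithinAt.fun_sum fun i _ => ?_
  exact (((strong_of_isEigenfunction hgρ (hf i)).2 e x hx).pow 2).congr_deriv (by push_cast; ring)

omit [Fintype E] [DecidableEq V] in
theorem exists_vertex_values_sum_sq {f : Fin n → E → ℝ → ℝ}
    (hf : ∀ i, ∃ φ : V → ℝ, ∀ e, f i e 0 = φ (G.src e) ∧ f i e 1 = φ (G.tgt e)) :
    ∃ φ : V → ℝ, ∀ e, ∑ i, f i e 0 ^ 2 = φ (G.src e) ∧ ∑ i, f i e 1 ^ 2 = φ (G.tgt e) := by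
  choose φ hφ using hf
  exact ⟨fun v => ∑ i, φ i v ^ 2, fun e => ⟨Finset.sum_congr rfl fun i _ => by rw [(hφ i e).1],
    Finset.sum_congr rfl fun i _ => by rw [(hφ i e).2]⟩⟩

end Derivatives

variable {g : E → ℝ} {ρ : E → ℝ → ℝ} {n : ℕ}

theorem sum_densityGradient (α Λ : ℝ) (f : Fin n → testSpace G) (e : E) (x : ℝ) :
    ∑ i, densityGradient α Λ g (f i) (f i) e x =
      (∑ i, gradForm G (conductance g) (f i) (f i)) * (normF α g * g e ^ α)
        - Λ * √(g e) * ∑ i, (f i).1 e x ^ 2 := by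
  rw [Finset.sum_mul, Finset.mul_sum, ← Finset.sum_sub_distrib]
  exact Finset.sum_congr rfl fun i _ => by rw [densityGradient]; ring

omit [Fintype E] in
theorem integral_sum_edgeDeriv_sq (f : Fin n → testSpace G) (e : E) :
    ∫ x in (0 : ℝ)..1, ∑ i, edgeDeriv (f i).1 e x ^ 2 =
      ∑ i, ∫ x in (0 : ℝ)..1, edgeDeriv (f i).1 e x * edgeDeriv (f i).1 e x := by
  simp only [pow_two]
  exact intervalIntegral.integral_finsetSum fun i _ => intervalIntegrable_Icc
    ((testSpace_continuousOn_edgeDeriv _ e).mul (testSpace_continuousOn_edgeDeriv _ e))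

theorem sum_metricGradient (hρ : ∀ e, ContinuousOn (ρ e) (Icc 0 1)) (α Λ : ℝ)
    (f : Fin n → testSpace G) (e : E) :
    ∑ i, metricGradient α Λ g ρ (f i) (f i) e =
      (∑ i, gradForm G (conductance g) (f i) (f i)) * ((1 - α) * g e ^ (-α) * normH α g ρ
        + normF α g * (α * g e ^ (α - 1) * ∫ x in (0 : ℝ)..1, ρ e x))
      - normFactor α g ρ / (2 * g e * √(g e)) *
        (∫ x in (0 : ℝ)..1, ∑ i, edgeDeriv (f i).1 e x ^ 2)
      - Λ / (2 * √(g e)) * ∫ x in (0 : ℝ)..1, ρ e x * ∑ i, (f i).1 e x ^ 2 := by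
  have h2 : ∫ x in (0 : ℝ)..1, ρ e x * ∑ i, (f i).1 e x ^ 2 =
      ∑ i, ∫ x in (0 : ℝ)..1, ρ e x * ((f i).1 e x * (f i).1 e x) := by
    simp only [Finset.mul_sum, pow_two]
    exact intervalIntegral.integral_finsetSum fun i _ => intervalIntegrable_Icc
      (continuousOn_mass_mul hρ _ _ e)
  rw [integral_sum_edgeDeriv_sq, h2, Finset.sum_mul, Finset.mul_sum, Finset.mul_sum, ← Finset.sum_sub_distrib,
    ← Finset.sum_sub_distrib]
  exact Finset.sum_congr rfl fun i _ => by rw [metricGradient]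

theorem sum_variationQuad (α Λ : ℝ) (hgρ : IsMetricDensity g ρ) (h : E → ℝ) {σ : E → ℝ → ℝ}
    (hσ : ∀ e, ContinuousOn (σ e) (Icc 0 1)) (f : Fin n → testSpace G) :
    ∑ i, variationQuad α Λ g ρ h σ (f i) =
      ∑ e, (h e * (∑ i, metricGradient α Λ g ρ (f i) (f i) e)
        + ∫ x in (0 : ℝ)..1, σ e x * ∑ i, densityGradient α Λ g (f i) (f i) e x) := by
  simp only [← variationForm_self α _ hgρ h hσ, variationForm_apply]
  rw [Finset.sum_comm]
  refine Finset.sum_congr rfl fun e _ => ?_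
  have h1 : ∫ x in (0 : ℝ)..1, σ e x * ∑ i, densityGradient α Λ g (f i) (f i) e x =
      ∑ i, ∫ x in (0 : ℝ)..1, σ e x * densityGradient α Λ g (f i) (f i) e x := by
    simp only [Finset.mul_sum]
    exact intervalIntegral.integral_finsetSum fun i _ => intervalIntegrable_Icc
      ((hσ e).mul (continuousOn_densityGradient _ _ _ _ _ e))
  rw [Finset.sum_add_distrib, ← Finset.mul_sum, h1]

end EigenfunctionSums

/-! ### Power identities. -/

section PowerIdentities

theorem rpow_neg_add_half {γ : ℝ} (hγ : 0 < γ) (α : ℝ) :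
    γ ^ (-α + 1 / 2) = √γ / γ ^ α := by
  rw [Real.rpow_add hγ, Real.rpow_neg hγ.le, ← Real.sqrt_eq_rpow, inv_mul_eq_div]

theorem rpow_sub_half {γ : ℝ} (hγ : 0 < γ) (α : ℝ) : γ ^ (α - 1 / 2) = γ ^ α / √γ := by
  rw [Real.rpow_sub hγ, ← Real.sqrt_eq_rpow]

theorem rpow_one_sub' {γ : ℝ} (hγ : 0 < γ) (α : ℝ) : γ ^ (1 - α) = γ / γ ^ α := by
  rw [Real.rpow_sub hγ, Real.rpow_one]

theorem rpow_sub_one' {γ : ℝ} (hγ : 0 < γ) (α : ℝ) : γ ^ (α - 1) = γ ^ α / γ := by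
  rw [Real.rpow_sub hγ, Real.rpow_one]

end PowerIdentities

/-! ### Equivalence of vanishing gradients with the two pointwise identities. -/

variable {V E : Type*} {G : DiscreteGraph V E} [Fintype E] [DecidableEq V] [Nonempty E]
  {g : E → ℝ} {ρ : E → ℝ → ℝ} {μ : ℝ} {n : ℕ}

/-- If the first variations of the normalised forms cancel on some eigenfunctions, then the edges
have equal lengths, the density is constant, and a multiple of the eigenfunctions satisfies the
two pointwise identities of a generating family. -/
theorem rigidity_of_gradient_eq_zero (hG : G.IsConnected) (hgρ : IsMetricDensity g ρ) {α : ℝ}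
    (hα₁ : α ≠ 1 / 2) (hα₂ : α ≠ 1) (hμ : 0 < μ) {f : Fin n → testSpace G}
    (hf : ∀ i, IsEigenfunction G g ρ μ (f i).1)
    (hB : 0 < ∑ i, gradForm G (conductance g) (f i) (f i))
    (hd : ∀ e, ∀ x ∈ Icc (0 : ℝ) 1,
      ∑ i, densityGradient α (μ * normFactor α g ρ) g (f i) (f i) e x = 0)
    (hm : ∀ e, ∑ i, metricGradient α (μ * normFactor α g ρ) g ρ (f i) (f i) e = 0) :
    ∃ γ r s : ℝ, s ≠ 0 ∧ (∀ e, g e = γ) ∧ (∀ e, ∀ x ∈ Icc (0 : ℝ) 1, ρ e x = r) ∧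
      (∀ e, ∀ x ∈ Icc (0 : ℝ) 1, s ^ 2 * (∑ i, edgeDeriv (f i).1 e x ^ 2) / g e = 1) ∧
      ∀ e, ∀ x ∈ Icc (0 : ℝ) 1, μ * (s ^ 2 * ∑ i, (f i).1 e x ^ 2) =
        g e ^ (α - 1 / 2) * normF α g / (2 * (1 - α) * g e ^ (-α + 1 / 2) * normH α g ρ
          + (2 * α - 1) * ρ e x * g e ^ (α - 1 / 2) * normF α g) := by
  have hF := normF_pos α hgρ
  have hH := normH_pos α hgρ
  simp only [sum_densityGradient, sum_metricGradient fun e => (hgρ.2.1 e).continuousOn,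
    normFactor] at hd hm
  set B := ∑ i, gradForm G (conductance g) (f i) (f i)
  set F := normF α g
  set H := normH α g ρ
  have hq : ∀ e, 0 < √(g e) := fun e => Real.sqrt_pos.2 (hgρ.1 e)
  have hA : ∀ e, 0 < g e ^ α := fun e => Real.rpow_pos_of_pos (hgρ.1 e) _
  -- The density gradient expresses `∑ f_i²` on an edge through `g e` alone. Its continuity at the
  -- vertices makes it one constant `C`, so `g e ^ (α - 1/2)` does not depend on the edge.
  have hP : ∀ e, ∀ x ∈ Icc (0 : ℝ) 1,
      ∑ i, (f i).1 e x ^ 2 = B * g e ^ α / (μ * H * √(g e)) := by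
    intro e x hx
    have := hq e
    rw [eq_div_iff (by positivity)]
    refine mul_left_cancel₀ hF.ne' ?_
    linear_combination -(hd e x hx)
  obtain ⟨C, hC⟩ := hG.exists_eq_const (P := fun e x => ∑ i, (f i).1 e x ^ 2)
    (exists_vertex_values_sum_sq fun i => (hf i).continuous)
    (fun e x hx => by rw [hP e x hx, hP e 0 (by simp)])
  have hBC : ∀ e, B * g e ^ α = μ * H * √(g e) * C := fun e => by
    have := hq e
    have h1 := (hP e 0 (by simp)).symm.trans (hC e 0 (by simp))
    rw [div_eq_iff (by positivity)] at h1
    linear_combination h1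
  inhabit E
  set e₀ : E := default
  have hC0 : 0 < C := by
    have h1 := hBC e₀
    have h2 := mul_pos hB (hA e₀)
    rw [h1] at h2
    exact pos_of_mul_pos_right h2 (by have := hq e₀; positivity)
  have hg : ∀ e, g e = g e₀ := by
    intro e
    have h1 : g e ^ (α - 1 / 2) = g e₀ ^ (α - 1 / 2) := by
      have h2 : ∀ e, g e ^ (α - 1 / 2) = μ * H * C / B := fun e => by
        have := hq e
        rw [rpow_sub_half (hgρ.1 e), div_eq_div_iff this.ne' hB.ne']
        linear_combination hBC e
      rw [h2, h2]
    exact Real.rpow_left_injOn (sub_ne_zero.2 hα₁) (hgρ.1 e).le (hgρ.1 e₀).le h1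
  set γ := g e₀
  have hγ : 0 < γ := hgρ.1 e₀
  set q := √γ with hqdef
  set A := γ ^ α with hAdef
  have hq0 : 0 < q := hq e₀
  have hA0 : 0 < A := hA e₀
  have hqq : q * q = γ := Real.mul_self_sqrt hγ.le
  have hM : ∀ e, ∀ x ∈ Icc (0 : ℝ) 1, ∑ i, (f i).1 e x * edgeDeriv (f i).1 e x = 0 := by
    intro e x hx
    have := deriv_eq_zero_of_const (fun z hz => hasDerivWithinAt_sum_sq hgρ hf e hz) (hC e) hx
    linarith
  have hK : ∀ e, ∀ x ∈ Icc (0 : ℝ) 1,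
      ∑ i, edgeDeriv (f i).1 e x ^ 2 = γ * μ * ρ e x * C := by
    intro e x hx
    have := deriv_eq_zero_of_const
      (fun z hz => hasDerivWithinAt_sum_mul_edgeDeriv hgρ hf e hz) (hM e) hx
    rw [hC e x hx, hg e] at this
    linarith
  -- From `M = 0` it follows that `K' = 0`, while `M' = 0` reads `K = γ μ ρ C`; so `ρ` is constant
  -- on each edge.
  have hρ : ∀ e, ∀ x ∈ Icc (0 : ℝ) 1, ρ e x = ρ e 0 := by
    intro e x hx
    have h1 := eq_of_hasDerivWithinAt_zero
      (fun z hz => hasDerivWithinAt_sum_edgeDeriv_sq hgρ hf e hz)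
      (fun z hz => by rw [hM e z hz, mul_zero]) hx
    rw [hK e x hx, hK e 0 (by simp)] at h1
    have : (γ * μ * C) * ρ e x = (γ * μ * C) * ρ e 0 := by linear_combination h1
    exact mul_left_cancel₀ (by positivity) this
  -- After substituting the constants, the metric gradient is a nonzero multiple of `(1 - α) (γ H -
  -- F ρ_e A²)`. This determines `ρ_e` by quantities common to all edges.
  have hr : ∀ e, γ * H = F * ρ e 0 * A ^ 2 := by
    intro e
    have h1 := hm e
    have h2 : ∫ x in (0 : ℝ)..1, ρ e x = ρ e 0 := by
      rw [integral_congr_Icc (hρ e)]; simp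
    have h3 : ∫ x in (0 : ℝ)..1, ∑ i, edgeDeriv (f i).1 e x ^ 2 = γ * μ * ρ e 0 * C := by
      rw [integral_congr_Icc fun x hx => by rw [hK e x hx, hρ e x hx]]; simp
    have h4 : ∫ x in (0 : ℝ)..1, ρ e x * ∑ i, (f i).1 e x ^ 2 = ρ e 0 * C := by
      rw [integral_congr_Icc fun x hx => by rw [hC e x hx, hρ e x hx]]; simp
    rw [h2, h3, h4, hg e, Real.rpow_neg hγ.le, rpow_sub_one' hγ, ← hAdef, ← hqdef] at h1
    have h5 : B = μ * H * q * C / A := by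
      rw [eq_div_iff hA0.ne']; exact hBC e₀
    rw [h5] at h1
    have h6 : (1 - α) * (γ * H - F * ρ e 0 * A ^ 2) = 0 := by
      have h7 : μ * H * q * C / A * ((1 - α) * A⁻¹ * H + F * (α * (A / γ) * ρ e 0)) -
          F * H / (2 * γ * q) * (γ * μ * ρ e 0 * C) - μ * (F * H) / (2 * q) * (ρ e 0 * C) =
          μ * H * C / (q * A ^ 2) * ((1 - α) * (γ * H - F * ρ e 0 * A ^ 2)) := by
        rw [← hqq]
        field_simp
        ring
      rw [h7] at h1
      exact (mul_eq_zero.1 h1).resolve_left (by positivity)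
    exact sub_eq_zero.1 ((mul_eq_zero.1 h6).resolve_left (sub_ne_zero.2 hα₂.symm))
  set r := ρ e₀ 0
  have hr0 : 0 < r := hgρ.2.2 e₀ 0 (by simp)
  have hρr : ∀ e, ∀ x ∈ Icc (0 : ℝ) 1, ρ e x = r := by
    intro e x hx
    rw [hρ e x hx]
    have : (F * A ^ 2) * ρ e 0 = (F * A ^ 2) * r := by linear_combination hr e₀ - hr e
    exact mul_left_cancel₀ (by positivity) this
  -- The squared gradients sum to `K / γ = μ r C`, so this scale normalises them to `1`.
  have hs : √(μ * r * C)⁻¹ ^ 2 = (μ * r * C)⁻¹ := Real.sq_sqrt (by positivity)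
  refine ⟨γ, r, √(μ * r * C)⁻¹, (Real.sqrt_pos.2 (by positivity)).ne', hg, hρr,
    fun e x hx => ?_, fun e x hx => ?_⟩
  · rw [hs, hK e x hx, hg e, hρr e x hx]
    field_simp
  · have h1 : q / A * H = F * r * A / q := by
      rw [div_mul_eq_mul_div, div_eq_div_iff hA0.ne' hq0.ne']
      linear_combination hr e₀ + H * hqq
    rw [hs, hC e x hx, hg e, hρr e x hx, rpow_sub_half hγ, rpow_neg_add_half hγ, ← hAdef, ← hqdef,
      mul_assoc (2 * (1 - α)), h1]
    field_simp
    rw [eq_div_iff (by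
      have : 2 * (1 - α) + (2 * α - 1) ≠ 0 := by ring_nf; norm_num
      exact this)]
    ring

/-- The first variations of the normalised forms cancel on a generating family. -/
theorem gradient_eq_zero_of_isGeneratingFamily (hG : G.IsConnected) (hgρ : IsMetricDensity g ρ)
    {α : ℝ} (hα₁ : α ≠ 1 / 2) (hα₂ : α ≠ 1) (hμ : 0 < μ) {f : Fin n → testSpace G}
    (hf : ∀ i, IsEigenfunction G g ρ μ (f i).1)
    (hgrad : ∀ e, ∀ x ∈ Icc (0 : ℝ) 1, ∑ i, gradSq g (f i).1 e x = 1)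
    (hval : ∀ e, ∀ x ∈ Icc (0 : ℝ) 1, μ * ∑ i, (f i).1 e x ^ 2 =
      g e ^ (α - 1 / 2) * normF α g / (2 * (1 - α) * g e ^ (-α + 1 / 2) * normH α g ρ
        + (2 * α - 1) * ρ e x * g e ^ (α - 1 / 2) * normF α g)) :
    (∀ e, ∀ x ∈ Icc (0 : ℝ) 1,
      ∑ i, densityGradient α (μ * normFactor α g ρ) g (f i) (f i) e x = 0) ∧
    ∀ e, ∑ i, metricGradient α (μ * normFactor α g ρ) g ρ (f i) (f i) e = 0 := by
  have hF := normF_pos α hgρ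
  have hH := normH_pos α hgρ
  simp only [sum_densityGradient, sum_metricGradient fun e => (hgρ.2.1 e).continuousOn,
    normFactor]
  have hK : ∀ e, ∀ x ∈ Icc (0 : ℝ) 1, ∑ i, edgeDeriv (f i).1 e x ^ 2 = g e := by
    intro e x hx
    have h1 := hgrad e x hx
    simp only [gradSq] at h1
    rwa [← Finset.sum_div, div_eq_one_iff_eq (hgρ.1 e).ne'] at h1
  -- The differential system is now run from the gradient identity: `K = g` is constant on the edge,
  -- so `M = 0`, so `P` is constant, and `M' = 0` gives `μ C ρ = 1`.
  have hM : ∀ e, ∀ x ∈ Icc (0 : ℝ) 1, ∑ i, (f i).1 e x * edgeDeriv (f i).1 e x = 0 := by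
    intro e x hx
    have h1 := deriv_eq_zero_of_const
      (fun z hz => hasDerivWithinAt_sum_edgeDeriv_sq hgρ hf e hz) (hK e) hx
    have h2 := hgρ.1 e
    have h3 := hgρ.2.2 e x hx
    exact (mul_eq_zero.1 h1).resolve_left (neg_ne_zero.2 (by positivity))
  obtain ⟨C, hC⟩ := hG.exists_eq_const (P := fun e x => ∑ i, (f i).1 e x ^ 2)
    (exists_vertex_values_sum_sq fun i => (hf i).continuous)
    (fun e x hx => eq_of_hasDerivWithinAt_zero
      (fun z hz => hasDerivWithinAt_sum_sq hgρ hf e hz)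
      (fun z hz => by rw [hM e z hz, mul_zero]) hx)
  have hρC : ∀ e, ∀ x ∈ Icc (0 : ℝ) 1, μ * C * ρ e x = 1 := by
    intro e x hx
    have h1 := deriv_eq_zero_of_const
      (fun z hz => hasDerivWithinAt_sum_mul_edgeDeriv hgρ hf e hz) (hM e) hx
    rw [hK e x hx, hC e x hx] at h1
    refine mul_left_cancel₀ (hgρ.1 e).ne' ?_
    linear_combination -h1
  inhabit E
  set e₀ : E := default
  have hX : 0 < μ * C := by
    have h1 := hρC e₀ 0 (by simp)
    exact pos_of_mul_pos_left (h1 ▸ one_pos) (hgρ.2.2 e₀ 0 (by simp)).le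
  set X := μ * C
  have hρX : ∀ e, ∀ x ∈ Icc (0 : ℝ) 1, ρ e x = X⁻¹ := fun e x hx =>
    eq_inv_of_mul_eq_one_right (hρC e x hx)
  have hpow : ∀ e, g e ^ (α - 1 / 2) * g e ^ (α - 1 / 2) = X * normH α g ρ / normF α g := by
    intro e
    have hge := hgρ.1 e
    have h1 := hval e 0 (by simp)
    rw [hC e 0 (by simp), hρX e 0 (by simp)] at h1
    have h0 : g e ^ (-α + 1 / 2) = (g e ^ (α - 1 / 2))⁻¹ := by
      rw [← Real.rpow_neg hge.le]; congr 1; ring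
    rw [h0] at h1
    have hy : 0 < g e ^ (α - 1 / 2) := Real.rpow_pos_of_pos hge _
    set y := g e ^ (α - 1 / 2)
    -- A zero denominator would make the quotient `0` by convention, while the left side `μ C` is
    -- positive.
    have hden : 2 * (1 - α) * y⁻¹ * normH α g ρ + (2 * α - 1) * X⁻¹ * y * normF α g ≠ 0 := by
      intro h2
      rw [h2, div_zero] at h1
      exact hX.ne' h1
    change X = _ at h1
    rw [eq_div_iff hden] at h1
    field_simp at h1
    rw [eq_div_iff hF.ne']
    refine mul_left_cancel₀ (mul_ne_zero two_ne_zero (sub_ne_zero.2 hα₂.symm)) ?_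
    linear_combination -h1
  have hg : ∀ e, g e = g e₀ := by
    intro e
    have h1 := (hpow e).trans (hpow e₀).symm
    rw [mul_self_inj (Real.rpow_nonneg (hgρ.1 e).le _) (Real.rpow_nonneg (hgρ.1 e₀).le _)] at h1
    exact Real.rpow_left_injOn (sub_ne_zero.2 hα₁) (hgρ.1 e).le (hgρ.1 e₀).le h1
  set γ := g e₀
  have hγ : 0 < γ := hgρ.1 e₀
  have hA0 : 0 < γ ^ α := Real.rpow_pos_of_pos hγ _
  have hq0 : 0 < √γ := Real.sqrt_pos.2 hγ
  have hqq : √γ * √γ = γ := Real.mul_self_sqrt hγ.le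
  have hint : ∀ e, ∫ x in (0 : ℝ)..1, ρ e x = X⁻¹ := fun e => by
    rw [integral_congr_Icc (hρX e)]; simp
  have hintK : ∀ e, ∫ x in (0 : ℝ)..1, ∑ i, edgeDeriv (f i).1 e x ^ 2 = γ := fun e => by
    rw [integral_congr_Icc fun x hx => (hK e x hx).trans (hg e)]; simp
  have hintP : ∀ e, ∫ x in (0 : ℝ)..1, ρ e x * ∑ i, (f i).1 e x ^ 2 = X⁻¹ * C := fun e => by
    rw [integral_congr_Icc fun x hx => by rw [hC e x hx, hρX e x hx]]; simp
  -- All data are now constant on the graph, so both gradients can be evaluated explicitly in terms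
  -- of the number of edges.
  set m : ℝ := ((Finset.univ : Finset E).card : ℝ)
  have hFv : normF α g = m * (γ / γ ^ α) := by
    rw [normF, Finset.sum_congr rfl fun e _ => by rw [hg e, rpow_one_sub' hγ], Finset.sum_const,
      nsmul_eq_mul]
  have hHv : normH α g ρ = m * (γ ^ α * X⁻¹) := by
    rw [normH, Finset.sum_congr rfl fun e _ => by rw [hg e, hint e], Finset.sum_const,
      nsmul_eq_mul]
  have hBv : ∑ i, gradForm G (conductance g) (f i) (f i) = m * √γ := by
    simp only [gradForm_apply]
    rw [Finset.sum_comm]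
    have : ∀ e, ∑ i, conductance g e *
        ∫ x in (0 : ℝ)..1, edgeDeriv (f i).1 e x * edgeDeriv (f i).1 e x = √γ := by
      intro e
      rw [← Finset.mul_sum, ← integral_sum_edgeDeriv_sq, hintK, conductance, hg e, inv_mul_eq_div, Real.div_sqrt]
    rw [Finset.sum_congr rfl fun e _ => this e, Finset.sum_const, nsmul_eq_mul]
  have hXC : μ * C = X := rfl
  refine ⟨fun e x hx => ?_, fun e => ?_⟩
  · rw [hBv, hFv, hHv, hC e x hx, hg e]
    have h1 : μ * (m * (γ / γ ^ α) * (m * (γ ^ α * X⁻¹))) * √γ * C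
        = (μ * C) * X⁻¹ * (m * (γ / γ ^ α) * (m * γ ^ α)) * √γ := by ring
    rw [h1, hXC, mul_inv_cancel₀ hX.ne']
    ring
  · rw [hBv, hFv, hHv, hg e, hint e, hintK e, hintP e, Real.rpow_neg hγ.le, rpow_sub_one' hγ]
    have h1 : ∀ z : ℝ, μ * z / (2 * √γ) * (X⁻¹ * C) = z / (2 * √γ) := fun z => by
      have : μ * z / (2 * √γ) * (X⁻¹ * C) = (μ * C) * X⁻¹ * z / (2 * √γ) := by ring
      rw [this, hXC, mul_inv_cancel₀ hX.ne', one_mul]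
    rw [h1]
    set q := √γ
    set A := γ ^ α
    rw [← hqq]
    field_simp
    ring

/-! ### Independence of the density outside the closed edges. -/

section Congruence

variable {V E : Type*} [Fintype E] [DecidableEq V] {G : DiscreteGraph V E} {g : E → ℝ}
  {ρ ρ' : E → ℝ → ℝ}

theorem IsEigenfunction.congr_density (h : ∀ e, EqOn (ρ e) (ρ' e) (Icc 0 1)) {μ : ℝ}
    {f : E → ℝ → ℝ} (hf : IsEigenfunction G g ρ μ f) : IsEigenfunction G g ρ' μ f :=
  ⟨hf.nonzero, hf.smooth, hf.continuous, fun e x hx => by rw [hf.equation e x hx, h e hx],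
    hf.vertex⟩

theorem eigenvalue_congr (h : ∀ e, EqOn (ρ e) (ρ' e) (Icc 0 1)) (k : ℕ) :
    eigenvalue G k g ρ = eigenvalue G k g ρ' := by
  have h1 : ∀ μ f, IsEigenfunction G g ρ μ f ↔ IsEigenfunction G g ρ' μ f := fun μ f =>
    ⟨IsEigenfunction.congr_density h, IsEigenfunction.congr_density fun e => (h e).symm⟩
  simp only [eigenvalue, h1]

omit [DecidableEq V] in
theorem normH_congr (h : ∀ e, EqOn (ρ e) (ρ' e) (Icc 0 1)) (α : ℝ) :
    normH α g ρ = normH α g ρ' :=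
  Finset.sum_congr rfl fun e _ => by rw [integral_congr_Icc (h e)]

theorem normalizedEigenvalue_congr (h : ∀ e, EqOn (ρ e) (ρ' e) (Icc 0 1)) (k : ℕ) (α : ℝ) :
    normalizedEigenvalue G k α g ρ = normalizedEigenvalue G k α g ρ' := by
  rw [normalizedEigenvalue, normalizedEigenvalue, eigenvalue_congr h, normH_congr h]

theorem IsGeneratingFamily.congr_density (h : ∀ e, EqOn (ρ e) (ρ' e) (Icc 0 1)) {k : ℕ} {α : ℝ}
    {n : ℕ} {f : Fin n → E → ℝ → ℝ} (hf : IsGeneratingFamily G k α g ρ f) :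
    IsGeneratingFamily G k α g ρ' f := by
  refine ⟨fun i => ?_, hf.2.1, fun e x hx => ?_⟩
  · rw [← eigenvalue_congr h]; exact (hf.1 i).congr_density h
  · rw [← eigenvalue_congr h, ← normH_congr h, ← h e hx]; exact hf.2.2 e x hx

end Congruence

/-! ### Sufficiency: one-sided bounds from a spectral gap. -/

section OneSided

theorem exists_isLittleO_of_eventually_le {Φ : ℝ → ℝ} {Φ₀ : ℝ} (h0 : Φ 0 = Φ₀)
    (h₁ : ∀ c > 0, ∀ᶠ t in 𝓝[>] (0 : ℝ), Φ t ≤ Φ₀ + c * t)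
    (h₂ : ∀ c > 0, ∀ᶠ t in 𝓝[>] (0 : ℝ), Φ (-t) ≤ Φ₀ + c * t) :
    ∃ r : ℝ → ℝ, r =o[𝓝 0] (fun t : ℝ => t) ∧ ∀ᶠ t in 𝓝 (0 : ℝ), Φ t ≤ Φ₀ + r t := by
  -- The remainder is the positive part of the increment; the two hypotheses bound it by `c * |t|`
  -- on either side of `0`.
  refine ⟨fun t => max (Φ t - Φ₀) 0, isLittleO_iff.2 fun c hc => ?_,
    Eventually.of_forall fun t => by linarith [le_max_left (Φ t - Φ₀) 0]⟩
  have hneg : Tendsto (fun t : ℝ => -t) (𝓝 0) (𝓝 0) := by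
    simpa using continuous_neg.tendsto (0 : ℝ)
  filter_upwards [eventually_nhdsWithin_iff.1 (h₁ c hc),
    hneg.eventually (eventually_nhdsWithin_iff.1 (h₂ c hc))] with t ht ht'
  rw [Real.norm_of_nonneg (le_max_right _ _), Real.norm_eq_abs]
  refine max_le ?_ (by positivity)
  rcases lt_trichotomy t 0 with h | rfl | h
  · have := ht' (neg_pos.2 h)
    rw [neg_neg] at this
    rw [abs_of_neg h]
    linarith
  · simp [h0]
  · have := ht h
    rw [abs_of_pos h]
    linarith

theorem exists_isLittleO_of_eventually_ge {Φ : ℝ → ℝ} {Φ₀ : ℝ} (h0 : Φ 0 = Φ₀)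
    (h₁ : ∀ c > 0, ∀ᶠ t in 𝓝[>] (0 : ℝ), Φ₀ + -c * t ≤ Φ t)
    (h₂ : ∀ c > 0, ∀ᶠ t in 𝓝[>] (0 : ℝ), Φ₀ + -c * t ≤ Φ (-t)) :
    ∃ r : ℝ → ℝ, r =o[𝓝 0] (fun t : ℝ => t) ∧ ∀ᶠ t in 𝓝 (0 : ℝ), Φ₀ + r t ≤ Φ t := by
  obtain ⟨r, hr, hr'⟩ := exists_isLittleO_of_eventually_le (Φ := fun t => -Φ t) (Φ₀ := -Φ₀)
    (by rw [h0]) (fun c hc => (h₁ c hc).mono fun t ht => by linarith)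
    (fun c hc => (h₂ c hc).mono fun t ht => by linarith)
  exact ⟨fun t => -r t, hr.neg_left, hr'.mono fun t ht => by linarith⟩

variable {V E : Type*} {G : DiscreteGraph V E} [Fintype V] [Fintype E] [DecidableEq V] [Nonempty E]
  {g : ℝ → E → ℝ} {ρ : ℝ → E → ℝ → ℝ} {h : E → ℝ} {σ : E → ℝ → ℝ} {g₀ : E → ℝ} {ρ₀ : E → ℝ → ℝ}
  {e : ℕ → testSpace G} {lam : ℕ → ℝ}

omit [Fintype V] [DecidableEq V] [Nonempty E] in
theorem variationQuad_smul (α Λ : ℝ) (hgρ : IsMetricDensity g₀ ρ₀) (h : E → ℝ)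
    (hσ : ∀ e, ContinuousOn (σ e) (Icc 0 1)) (c : ℝ) (f : testSpace G) :
    variationQuad α Λ g₀ ρ₀ h σ (c • f) = c ^ 2 * variationQuad α Λ g₀ ρ₀ h σ f := by
  rw [← variationForm_self α Λ hgρ h hσ, ← variationForm_self α Λ hgρ h hσ, map_smul, map_smul,
    LinearMap.smul_apply, smul_eq_mul, smul_eq_mul]
  ring

/-- Thanks to the gap, the modes `0, …, k` all lie strictly below, so together with a single
eigenfunction `u` they form a test space of dimension `k + 2`. Only the variation on the line of `u`
then matters, not that on the whole eigenspace. -/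
theorem HasFirstVariation.eventually_le_of_gap_below (hv : HasFirstVariation g ρ h σ)
    (hg₀ : g 0 = g₀) (hρ₀ : ρ 0 = ρ₀) (hgρ : IsMetricDensity g₀ ρ₀) (α : ℝ)
    (hs : IsSpectralSequence (gradForm G (conductance g₀))
      (massForm G (massDensity g₀ ρ₀) (continuousOn_massDensity hgρ)) e lam) {k : ℕ}
    (hgap : lam k < lam (k + 1)) {u : testSpace G}
    (hu : u ∈ weakEigenspace G (conductance g₀) (massDensity g₀ ρ₀) (continuousOn_massDensity hgρ)
      (lam (k + 1)))
    (hu0 : 0 < massForm G (massDensity g₀ ρ₀) (continuousOn_massDensity hgρ) u u)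
    (hQ : variationQuad α (lam (k + 1) * normFactor α g₀ ρ₀) g₀ ρ₀ h σ u ≤ 0) {c : ℝ}
    (hc : 0 < c) :
    ∀ᶠ t in 𝓝[>] (0 : ℝ), normalizedEigenvalue G (k + 1) α (g t) (ρ t) ≤
      normalizedEigenvalue G (k + 1) α g₀ ρ₀ + c * t := by
  rw [mem_weakEigenspace] at hu
  set b := massForm G (massDensity g₀ ρ₀) (continuousOn_massDensity hgρ) with hb
  have hbc : ∀ x y, b x y = b y x := massForm_comm _ _
  have hlt : ∀ i ≤ k, lam i < lam (k + 1) := fun i hi => (hs.mono hi).trans_lt hgap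
  have horth : ∀ i ≤ k, b (e i) u = 0 := by
    intro i hi
    have h1 := hs.weak i u
    rw [gradForm_comm, hu, hbc u] at h1
    have h2 : (lam (k + 1) - lam i) * b (e i) u = 0 := by linarith
    exact (mul_eq_zero.1 h2).resolve_left (sub_pos.2 (hlt i hi)).ne'
  have hsum : ∀ d : Fin (k + 2) → ℝ,
      ∑ j, d j • (Fin.snoc (α := fun _ => testSpace G) (fun i : Fin (k + 1) => e i) u :
        Fin (k + 2) → testSpace G) j =
      (∑ i : Fin (k + 1), d i.castSucc • e i) + d (Fin.last _) • u := by
    intro d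
    rw [Fin.sum_univ_castSucc]
    simp only [Fin.snoc_castSucc, Fin.snoc_last]
  refine hv.eventually_normalizedEigenvalue_le hg₀ hρ₀ hgρ α hc hs
    (hs.eigenvalue_nonneg hgρ (k + 1)) (A := {x | ∃ a : ℝ, x = a • u}) ?_ ?_
    (w := Fin.snoc (α := fun _ => testSpace G) (fun i : Fin (k + 1) => e i) u)
    (fun d hd => ?_) (fun d => ?_)
  · rintro _ ⟨a, rfl⟩ x
    rw [map_smul, map_smul, LinearMap.smul_apply, LinearMap.smul_apply, hu, smul_eq_mul,
      smul_eq_mul]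
    ring
  · rintro _ ⟨a, rfl⟩
    rw [variationQuad_smul α _ hgρ h hv.continuousOn, zero_mul]
    exact mul_nonpos_of_nonneg_of_nonpos (sq_nonneg a) hQ
  · rw [hsum]
    set S := ∑ i : Fin (k + 1), d i.castSucc • e i with hS
    have hSu : b S u = 0 := by
      rw [hS, map_sum, LinearMap.sum_apply]
      refine Finset.sum_eq_zero fun i _ => ?_
      rw [map_smul, LinearMap.smul_apply, horth i (Nat.lt_succ_iff.1 i.2), smul_zero]
    have hval : b (S + d (Fin.last _) • u) (S + d (Fin.last _) • u) =
        b S S + d (Fin.last _) ^ 2 * b u u := by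
      simp only [map_add, map_smul, LinearMap.add_apply, LinearMap.smul_apply, smul_eq_mul,
        hbc u S, hSu]
      ring
    rw [hval]
    have hSS : 0 ≤ b S S := massForm_nonneg (fun e x hx => (massDensity_pos hgρ e x hx).le) S
    by_cases hl : d (Fin.last _) = 0
    · have hd' : (fun i : Fin (k + 1) => d i.castSucc) ≠ 0 := by
        intro h0
        refine hd (funext fun j => ?_)
        induction j using Fin.lastCases with
        | last => exact hl
        | cast i => exact congrFun h0 i
      have := hs.mass_pos hd'
      rw [hl]
      have h3 : 0 < b S S := this
      linarith
    · positivity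
  · refine ⟨d (Fin.last _) • u, ⟨_, rfl⟩,
      fun i => if hi : i < k + 1 then d (Fin.castSucc ⟨i, hi⟩) else 0, ?_⟩
    rw [hsum, add_comm, Finset.filter_true_of_mem fun i hi =>
      hlt i (Nat.lt_succ_iff.1 (Finset.mem_range.1 hi)), Finset.sum_range]
    congr 1
    exact Finset.sum_congr rfl fun i _ => by simp only [i.2, dif_pos]

/-- Dual to the upper bound. Any `k + 1` vectors together with `u` satisfy a relation modulo the
complement of the first `k + 1` modes, so their span contains a vector equal to a multiple of `u`
plus a vector coercive by the gap. -/
theorem HasFirstVariation.eventually_ge_of_gap_above (hv : HasFirstVariation g ρ h σ)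
    (hg₀ : g 0 = g₀) (hρ₀ : ρ 0 = ρ₀) (hgρ : IsMetricDensity g₀ ρ₀) (α : ℝ)
    (hs : IsSpectralSequence (gradForm G (conductance g₀))
      (massForm G (massDensity g₀ ρ₀) (continuousOn_massDensity hgρ)) e lam) {k : ℕ}
    (hgap : lam k < lam (k + 1)) {u : testSpace G}
    (hu : u ∈ weakEigenspace G (conductance g₀) (massDensity g₀ ρ₀) (continuousOn_massDensity hgρ)
      (lam k))
    (hu0 : 0 < massForm G (massDensity g₀ ρ₀) (continuousOn_massDensity hgρ) u u)
    (hQ : 0 ≤ variationQuad α (lam k * normFactor α g₀ ρ₀) g₀ ρ₀ h σ u) {c : ℝ}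
    (hc : 0 < c) :
    ∀ᶠ t in 𝓝[>] (0 : ℝ), normalizedEigenvalue G k α g₀ ρ₀ + -c * t ≤
      normalizedEigenvalue G k α (g t) (ρ t) := by
  rw [mem_weakEigenspace] at hu
  set b := massForm G (massDensity g₀ ρ₀) (continuousOn_massDensity hgρ) with hb
  refine hv.eventually_le_normalizedEigenvalue hg₀ hρ₀ hgρ α (neg_lt_zero.2 hc) hs
    (hs.eigenvalue_nonneg hgρ k) hgap (A := {x | ∃ a : ℝ, x = a • u}) ?_ ?_ fun w => ?_
  · rintro _ ⟨a, rfl⟩ x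
    rw [map_smul, map_smul, LinearMap.smul_apply, LinearMap.smul_apply, hu, smul_eq_mul,
      smul_eq_mul]
    ring
  · rintro _ ⟨a, rfl⟩
    rw [variationQuad_smul α _ hgρ h hv.continuousOn, zero_mul]
    exact mul_nonneg (sq_nonneg a) hQ
  · obtain ⟨D, hD, hD0⟩ := exists_ne_zero_sum_mul_eq_zero fun i (j : Fin (k + 1)) =>
      b (e j) ((Fin.snoc (α := fun _ => testSpace G) w u : Fin (k + 2) → testSpace G) i)
    have hD1 : ∀ j < k + 1, (∑ i : Fin (k + 1), D i.castSucc * b (e j) (w i))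
        + D (Fin.last _) * b (e j) u = 0 := by
      intro j hj
      have := hD0 ⟨j, hj⟩
      rw [Fin.sum_univ_castSucc] at this
      simpa only [Fin.snoc_castSucc, Fin.snoc_last] using this
    refine ⟨fun i => D i.castSucc, fun h0 => ?_, -D (Fin.last _) • u, ⟨_, rfl⟩, fun i hi => ?_⟩
    · have h1 : ∀ i : Fin (k + 1), D i.castSucc = 0 := congrFun h0
      have hl : D (Fin.last _) ≠ 0 := by
        intro hl
        refine hD (funext fun j => ?_)
        induction j using Fin.lastCases with
        | last => exact hl
        | cast i => exact h1 i
      have h2 := hs.minimal (k + 1) u fun j hj => by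
        have := hD1 j hj
        simp only [h1, zero_mul, Finset.sum_const_zero, zero_add] at this
        exact (mul_eq_zero.1 this).resolve_left hl
      rw [hu] at h2
      exact absurd (le_of_mul_le_mul_right h2 hu0) (not_le.2 hgap)
    · have := hD1 i hi
      simp only [map_sub, map_sum, map_smul, smul_eq_mul]
      linarith

omit [Fintype V] [Nonempty E] in
theorem IsEigenfunction.massForm_pos (hgρ : IsMetricDensity g₀ ρ₀) {μ : ℝ} {f : testSpace G}
    (hf : IsEigenfunction G g₀ ρ₀ μ f.1) :
    0 < massForm G (massDensity g₀ ρ₀) (continuousOn_massDensity hgρ) f f := by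
  refine (massForm_nonneg (fun e x hx => (massDensity_pos hgρ e x hx).le) f).lt_of_ne' fun h0 => ?_
  obtain ⟨e, x, hx, hne⟩ := hf.nonzero
  exact hne (massForm_eq_zero (massDensity_pos hgρ) h0 e hx)

/-- A pair with a generating family and a spectral gap is extremal. -/
theorem isExtremal_of_isGeneratingFamily (hG : G.IsConnected) {k : ℕ} (hk : 1 ≤ k) {α : ℝ}
    (hα₁ : α ≠ 1 / 2) (hα₂ : α ≠ 1) (hgρ : IsMetricDensity g₀ ρ₀) {n : ℕ}
    {f : Fin n → E → ℝ → ℝ} (hf : IsGeneratingFamily G k α g₀ ρ₀ f)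
    (hgap : eigenvalue G (k - 1) g₀ ρ₀ < eigenvalue G k g₀ ρ₀ ∨
      eigenvalue G k g₀ ρ₀ < eigenvalue G (k + 1) g₀ ρ₀) :
    IsExtremal (normalizedEigenvalue G k α) g₀ ρ₀ := by
  refine ⟨hgρ, fun δ g ρ hδ hfam => ?_⟩
  obtain ⟨h, σ, hv⟩ := hfam.exists_hasFirstVariation hδ
  -- The family meets `ρ₀` only on the closed edges, so `ρ₀` is replaced throughout by `ρ 0`.
  have hEq : ∀ e, EqOn (ρ₀ e) (ρ 0 e) (Icc 0 1) := fun e => (hfam.density_zero e).symm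
  have hgρ' := hfam.mem 0 ⟨neg_lt_zero.2 hδ, hδ⟩
  have hg0 := hfam.metric_zero
  rw [hg0] at hgρ'
  rw [normalizedEigenvalue_congr hEq]
  rw [eigenvalue_congr hEq, eigenvalue_congr hEq, eigenvalue_congr hEq] at hgap
  replace hf := hf.congr_density hEq
  clear hEq hgρ hfam
  obtain ⟨ρ₁, hρ₁⟩ : ∃ ρ₁, ρ 0 = ρ₁ := ⟨_, rfl⟩
  rw [hρ₁] at hgρ' hgap hf ⊢
  obtain ⟨e, lam, hs⟩ := exists_isSpectralSequence G hgρ'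
  obtain ⟨hf1, hf2, hf3⟩ := hf
  simp only [eigenvalue_eq hgρ' hs] at hf1 hf3 hgap
  have hμ := hs.eigenvalue_pos hG hgρ' hk
  set F : Fin n → testSpace G := fun i => (hf1 i).toTest
  have hF : ∀ i, F i ∈ weakEigenspace G (conductance g₀) (massDensity g₀ ρ₁)
      (continuousOn_massDensity hgρ') (lam k) := fun i => (hf1 i).mem_weakEigenspace hgρ'
  have hFpos : ∀ i, 0 < massForm G (massDensity g₀ ρ₁) (continuousOn_massDensity hgρ') (F i) (F i) :=
    fun i => IsEigenfunction.massForm_pos (μ := lam k) hgρ' (hf1 i)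
  obtain ⟨hd, hm⟩ := gradient_eq_zero_of_isGeneratingFamily (f := F) hG hgρ' hα₁ hα₂ hμ hf1 hf2 hf3
  have hQ : ∑ i, variationQuad α (lam k * normFactor α g₀ ρ₁) g₀ ρ₁ h σ (F i) = 0 := by
    rw [sum_variationQuad _ _ hgρ' h hv.continuousOn]
    refine Finset.sum_eq_zero fun e' _ => ?_
    rw [hm, mul_zero, zero_add,
      integral_congr_Icc (w' := fun _ => 0) fun x hx => by rw [hd e' x hx, mul_zero]]
    simp
  have hn : (Finset.univ : Finset (Fin n)).Nonempty := by
    rw [Finset.nonempty_iff_ne_empty]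
    intro h0
    inhabit E
    have := hf2 default 0 (by simp)
    rw [h0, Finset.sum_empty] at this
    exact zero_ne_one this
  -- The variations over the nonempty family sum to zero, so one is nonpositive and one nonnegative.
  -- Reversing time changes the sign of the variation and exchanges the roles of the two functions.
  obtain ⟨i, hi⟩ : ∃ i, variationQuad α (lam k * normFactor α g₀ ρ₁) g₀ ρ₁ h σ (F i) ≤ 0 := by
    by_contra! hne
    exact (Finset.sum_pos (fun i _ => hne i) hn).ne' hQ
  obtain ⟨j, hj⟩ : ∃ j, 0 ≤ variationQuad α (lam k * normFactor α g₀ ρ₁) g₀ ρ₁ h σ (F j) := by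
    by_contra! hne
    exact (Finset.sum_neg (fun i _ => hne i) hn).ne hQ
  have hg0' : g (-0) = g₀ := by rw [neg_zero, hg0]
  have hρ0' : ρ (-0) = ρ₁ := by rw [neg_zero, hρ₁]
  have hΦ0 : normalizedEigenvalue G k α (g 0) (ρ 0) = normalizedEigenvalue G k α g₀ ρ₁ := by
    rw [hg0, hρ₁]
  rcases hgap with hgap | hgap
  · obtain ⟨k, rfl⟩ : ∃ k', k = k' + 1 := ⟨k - 1, by omega⟩
    rw [Nat.add_sub_cancel] at hgap
    refine Or.inl (exists_isLittleO_of_eventually_le hΦ0 (fun c hc => ?_) fun c hc => ?_)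
    · exact hv.eventually_le_of_gap_below hg0 hρ₁ hgρ' α hs hgap (hF i) (hFpos i) hi hc
    · refine hv.comp_neg.eventually_le_of_gap_below hg0' hρ0' hgρ' α hs hgap (hF j) (hFpos j) ?_ hc
      rw [variationQuad_neg _ _ hgρ' h hv.continuousOn]
      exact neg_nonpos.2 hj
  · refine Or.inr (exists_isLittleO_of_eventually_ge hΦ0 (fun c hc => ?_) fun c hc => ?_)
    · exact hv.eventually_ge_of_gap_above hg0 hρ₁ hgρ' α hs hgap (hF j) (hFpos j) hj hc
    · refine hv.comp_neg.eventually_ge_of_gap_above hg0' hρ0' hgρ' α hs hgap (hF i) (hFpos i) ?_ hc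
      rw [variationQuad_neg _ _ hgρ' h hv.continuousOn]
      exact neg_nonneg.2 hi

end OneSided

/-! ### Linear families in a prescribed direction. -/

section LinearFamily

variable {V E : Type*} [Fintype E] {g : E → ℝ} {ρ : E → ℝ → ℝ}

theorem exists_isSmoothFamily_linear (hgρ : IsMetricDensity g ρ) (h : E → ℝ) {σ : E → ℝ → ℝ}
    (hσ : ∀ e, ContDiff ℝ (⊤ : ℕ∞) (σ e)) : ∃ δ > 0,
    IsSmoothFamily δ (fun t e => g e + t * h e) (fun t e x => ρ e x + t * σ e x) g ρ := by
  obtain ⟨s, hs, hsg, hsρ⟩ := exists_pos_lower_bound hgρ.1 (fun e => (hgρ.2.1 e).continuousOn)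
    hgρ.2.2
  choose R hR0 hR using fun e => exists_bound_Icc (hσ e).continuous.continuousOn
  set T := ∑ e, (R e + |h e|)
  have hT : ∀ e, R e + |h e| ≤ T := fun e =>
    Finset.single_le_sum (f := fun e => R e + |h e|)
      (fun e _ => add_nonneg (hR0 e).le (abs_nonneg _)) (Finset.mem_univ e)
  have hT0 : 0 ≤ T := Finset.sum_nonneg fun e _ => add_nonneg (hR0 e).le (abs_nonneg _)
  -- `s` bounds metric and density below and `T` bounds the direction, so `|t| < s / (T + 1)`
  -- preserves positivity.
  have hpos : ∀ t ∈ Ioo (-(s / (T + 1))) (s / (T + 1)), ∀ y z : ℝ, s ≤ y → |z| ≤ T →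
      0 < y + t * z := by
    intro t ht y z hy hz
    have h1 : |t| < s / (T + 1) := abs_lt.2 ht
    rw [lt_div_iff₀ (by positivity)] at h1
    have h2 : |t * z| ≤ |t| * T := by
      rw [abs_mul]; exact mul_le_mul_of_nonneg_left hz (abs_nonneg t)
    have h3 := (abs_le.1 h2).1
    nlinarith [abs_nonneg t]
  refine ⟨s / (T + 1), by positivity, fun t ht => ⟨fun e => ?_, fun e => ?_, fun e x hx => ?_⟩,
    fun e => ?_, fun e => ?_, ?_, fun e x _ => ?_⟩
  · exact hpos t ht _ _ (hsg e) (by linarith [hT e, hR0 e])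
  · exact (hgρ.2.1 e).add (contDiff_const.mul (hσ e)).contDiffOn
  · exact hpos t ht _ _ (hsρ e x hx) (by linarith [hT e, hR e x hx, abs_nonneg (h e)])
  · exact (contDiff_const.add (contDiff_id.mul contDiff_const)).contDiffOn
  · refine ((hgρ.2.1 e).comp contDiff_snd.contDiffOn fun p hp => hp.2).add ?_
    exact (contDiff_fst.mul ((hσ e).comp contDiff_snd)).contDiffOn
  · simp
  · simp

theorem hasFirstVariation_linear (hgρ : IsMetricDensity g ρ) (h : E → ℝ) {σ : E → ℝ → ℝ}
    (hσ : ∀ e, ContDiff ℝ (⊤ : ℕ∞) (σ e)) :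
    HasFirstVariation (fun t e => g e + t * h e) (fun t e x => ρ e x + t * σ e x) h σ where
  mem := by
    obtain ⟨δ, hδ, hf⟩ := exists_isSmoothFamily_linear hgρ h hσ
    filter_upwards [Ioo_mem_nhds (neg_lt_zero.2 hδ) hδ] with t ht using hf.mem t ht
  metric e := by
    simpa using ((hasDerivAt_id (0 : ℝ)).mul_const (h e)).const_add (g e)
  density e ε hε := Eventually.of_forall fun t x _ => by
    have : ρ e x + t * σ e x - (ρ e x + 0 * σ e x) - t * σ e x = 0 := by ring
    rw [this, abs_zero]
    positivity
  continuousOn e := (hσ e).continuous.continuousOn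

end LinearFamily

/-! ### Necessity: no definite first variation at an extremal pair. -/

section NotDefinite

variable {V E : Type*} {G : DiscreteGraph V E} [Fintype V] [Fintype E] [DecidableEq V] [Nonempty E]
  {g : E → ℝ} {ρ : E → ℝ → ℝ} {e : ℕ → testSpace G} {lam : ℕ → ℝ}

/-- The indices of the eigenvectors with eigenvalue `lam k`, among the first `N`. -/
noncomputable def eigenIndices (lam : ℕ → ℝ) (k N : ℕ) : Finset ℕ :=
  (Finset.range N).filter fun i => lam i = lam k

/-- At an extremal pair, no first variation of the normalised forms is positive definite on the
eigenspace. -/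
theorem IsExtremal.not_definite {k : ℕ} {α : ℝ}
    (hext : IsExtremal (normalizedEigenvalue G k α) g ρ)
    (hs : IsSpectralSequence (gradForm G (conductance g))
      (massForm G (massDensity g ρ) (continuousOn_massDensity hext.1)) e lam) {N : ℕ}
    (hN : lam k < lam N) (hN' : ∀ i < N, lam i ≤ lam k) (h : E → ℝ) {σ : E → ℝ → ℝ}
    (hσ : ∀ e, ContDiff ℝ (⊤ : ℕ∞) (σ e)) {ε : ℝ} (hε : 0 < ε)
    (hQ : ∀ c : ℕ → ℝ, ε * ∑ i ∈ eigenIndices lam k N, c i ^ 2 ≤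
      variationQuad α (lam k * normFactor α g ρ) g ρ h σ
        (∑ i ∈ eigenIndices lam k N, c i • e i)) : False := by
  have hgρ := hext.1
  set b := massForm G (massDensity g ρ) (continuousOn_massDensity hgρ) with hb
  set J := eigenIndices lam k N
  have hJ : ∀ i, i ∈ J ↔ i < N ∧ lam i = lam k := fun i => by
    simp [J, eigenIndices]
  have hlam := hs.eigenvalue_nonneg hgρ k
  have hkN : k < N := hs.mono.reflect_lt hN
  have hlow : ∀ i, i < N → lam i ≠ lam k → i < k ∧ lam i < lam k := fun i hi hne =>
    have h1 := lt_of_le_of_ne (hN' i hi) hne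
    ⟨hs.mono.reflect_lt h1, h1⟩
  set A : Set (testSpace G) := {u | ∃ c : ℕ → ℝ, u = ∑ i ∈ J, c i • e i}
  have hA : ∀ u ∈ A, ∀ x, gradForm G (conductance g) u x = lam k * b u x := by
    rintro _ ⟨c, rfl⟩ x
    simp only [map_sum, map_smul, LinearMap.sum_apply, LinearMap.smul_apply, hs.weak, smul_eq_mul,
      Finset.mul_sum]
    exact Finset.sum_congr rfl fun i hi => by rw [((hJ i).1 hi).2]; ring
  have hA' : ∀ u ∈ A, ε * b u u ≤ variationQuad α (lam k * normFactor α g ρ) g ρ h σ u := by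
    rintro _ ⟨c, rfl⟩
    rw [hs.mass_sum_self]
    exact hQ c
  have hv := hasFirstVariation_linear hgρ h hσ
  obtain ⟨δ, hδ, hfam⟩ := exists_isSmoothFamily_linear hgρ h hσ
  set gt : ℝ → E → ℝ := fun t e => g e + t * h e
  set ρt : ℝ → E → ℝ → ℝ := fun t e x => ρ e x + t * σ e x
  set Φ := fun t => normalizedEigenvalue G k α (gt t) (ρt t)
  set Φ₀ := normalizedEigenvalue G k α g ρ
  have hg0 : gt 0 = g := by funext e; simp [gt]
  have hρ0 : ρt 0 = ρ := by funext e x; simp [ρt]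
  have small : ∀ r : ℝ → ℝ, r =o[𝓝 0] (fun t : ℝ => t) → ∀ᶠ t in 𝓝 (0 : ℝ), |r t| ≤ ε / 4 * |t| :=
    fun r hr => isLittleO_iff.1 hr (by positivity)
  -- A positive definite variation raises the value by at least `ε/2 * t` at `t > 0` and lowers it
  -- by at least that much at `-t`. The first contradicts the upper alternative, the second the
  -- lower one.
  rcases hext.2 δ gt ρt hδ hfam with ⟨r, hr, hle⟩ | ⟨r, hr, hle⟩
  · have key : ∀ᶠ t in 𝓝[>] (0 : ℝ), Φ₀ + ε / 2 * t ≤ Φ t := by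
      refine hv.eventually_le_normalizedEigenvalue hg0 hρ0 hgρ α (half_lt_self hε) hs hlam hN
        hA hA' fun w => ?_
      obtain ⟨d, hd, hd0⟩ := exists_ne_zero_sum_mul_eq_zero fun i (j : Fin k) => b (e j) (w i)
      -- The vector is made orthogonal to the first `k` modes and its projection to the eigenspace
      -- is taken as `u`. Every index below `N` outside the eigenspace is below `k`, so the
      -- difference is orthogonal to all `N` modes.
      refine ⟨d, hd, _, ⟨fun i => b (e i) (∑ j, d j • w j), rfl⟩, fun i hi => ?_⟩
      rw [map_sub, hs.mass_sum]
      split_ifs with hiJ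
      · exact sub_self _
      · have h1 := hlow i hi fun h2 => hiJ ((hJ i).2 ⟨hi, h2⟩)
        have h2 := hd0 ⟨i, h1.1⟩
        simp only [map_sum, map_smul, smul_eq_mul, sub_zero]
        exact h2
    obtain ⟨t, ht0, h1, h2, h3⟩ := (eventually_mem_nhdsWithin.and
      (key.and ((hle.and (small r hr)).filter_mono nhdsWithin_le_nhds))).exists
    have ht0 : 0 < t := ht0
    rw [abs_of_pos ht0] at h3
    have h2 : Φ t ≤ Φ₀ + r t := h2
    have h4 := (abs_le.1 h3).2
    nlinarith
  · have hgn : gt (-0) = g := by rw [neg_zero, hg0]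
    have hρn : ρt (-0) = ρ := by rw [neg_zero, hρ0]
    have key : ∀ᶠ t in 𝓝[>] (0 : ℝ), Φ (-t) ≤ Φ₀ + -(ε / 2) * t := by
      refine hv.comp_neg.eventually_normalizedEigenvalue_le hgn hρn hgρ α
        (neg_lt_neg (half_lt_self hε)) hs hlam hA (fun u hu => ?_) (w := fun i => e i)
        (fun d hd => hs.mass_pos hd) (fun d => ?_)
      · rw [variationQuad_neg _ _ hgρ h hv.continuousOn, neg_mul]
        exact neg_le_neg (hA' u hu)
      · set c : ℕ → ℝ := fun i => if hi : i < k + 1 then d ⟨i, hi⟩ else 0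
        refine ⟨_, ⟨c, rfl⟩, c, ?_⟩
        have h1 : ∑ j, d j • e j = ∑ i ∈ Finset.range N, c i • e i := by
          rw [← Finset.sum_subset (Finset.range_mono (Nat.succ_le_of_lt hkN)) fun i _ hi => by
            rw [Finset.mem_range] at hi
            simp only [c, dif_neg hi, zero_smul], Finset.sum_range]
          exact Finset.sum_congr rfl fun i _ => by simp only [c, i.2, dif_pos]
        rw [h1, ← Finset.sum_filter_add_sum_filter_not _ (fun i => lam i = lam k)]
        congr 1
        refine Finset.sum_congr ?_ fun _ _ => rfl
        ext i
        simp only [Finset.mem_filter, Finset.mem_range]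
        exact ⟨fun hi => hlow i hi.1 hi.2, fun hi => ⟨hi.1.trans hkN, hi.2.ne⟩⟩
    have hneg : Tendsto (fun t : ℝ => -t) (𝓝[>] 0) (𝓝 0) := by
      refine Tendsto.mono_left ?_ nhdsWithin_le_nhds
      simpa using continuous_neg.tendsto (0 : ℝ)
    obtain ⟨t, ht0, h1, h2, h3⟩ := (eventually_mem_nhdsWithin.and
      (key.and (hneg.eventually (hle.and (small r hr))))).exists
    have ht0 : 0 < t := ht0
    rw [abs_neg, abs_of_pos ht0] at h3
    have h2 : Φ₀ + r (-t) ≤ Φ (-t) := h2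
    have h4 := (abs_le.1 h3).1
    nlinarith

end NotDefinite

/-! ### Density of polynomial test directions. -/

section TestDensities

/-- By Weierstrass, a polynomial close to `w` satisfies `w² ≤ p w + ε` pointwise, so `∫ w² ≤ ε`.
Polynomial directions thus suffice to detect the density gradient. -/
theorem eq_zero_of_integral_polynomial_mul_eq_zero {w : ℝ → ℝ} (hw : ContinuousOn w (Icc 0 1))
    (h : ∀ p : Polynomial ℝ, ∫ x in (0 : ℝ)..1, p.eval x * w x = 0) :
    ∀ x ∈ Icc (0 : ℝ) 1, w x = 0 := by
  obtain ⟨R, hR0, hR⟩ := exists_bound_Icc hw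
  refine eq_zero_of_integral_mul_sq_eq_zero (m := fun _ => 1) continuousOn_const
    (fun _ _ => one_pos) hw ?_
  have hle : ∀ ε > 0, ∫ x in (0 : ℝ)..1, 1 * w x ^ 2 ≤ ε := by
    intro ε hε
    obtain ⟨p, hp⟩ := exists_polynomial_near_of_continuousOn 0 1 w hw (ε / R) (by positivity)
    have hpc : ContinuousOn (fun x => p.eval x * w x) (Icc 0 1) :=
      p.continuous.continuousOn.mul hw
    have h1 : ∫ x in (0 : ℝ)..1, 1 * w x ^ 2 ≤ ∫ x in (0 : ℝ)..1, (p.eval x * w x + ε) := by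
      refine intervalIntegral.integral_mono_on zero_le_one
        (intervalIntegrable_Icc (continuousOn_const.mul (hw.pow 2)))
        (intervalIntegrable_Icc (hpc.add continuousOn_const)) fun x hx => ?_
      have h2 : |(w x - p.eval x) * w x| ≤ ε / R * R := by
        rw [abs_mul, abs_sub_comm]
        exact mul_le_mul (hp x hx).le (hR x hx) (abs_nonneg _) (by positivity)
      rw [div_mul_cancel₀ _ hR0.ne'] at h2
      nlinarith [(abs_le.1 h2).2]
    rw [intervalIntegral.integral_add (intervalIntegrable_Icc hpc)
      (intervalIntegrable_Icc continuousOn_const), h p] at h1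
    simpa using h1
  refine le_antisymm (le_of_forall_pos_le_add fun ε hε => by simpa using hle ε hε) ?_
  exact intervalIntegral.integral_nonneg zero_le_one fun x _ => by positivity

end TestDensities

/-! ### Necessity: from annihilated variations to a generating family. -/

section Necessity

variable {V E : Type*} {G : DiscreteGraph V E} [Fintype E]

/-- The matrix of the first variation of the normalised forms in some test functions, as a linear
function of the variation of the metric and a polynomial variation of the density. -/
noncomputable def variationMatrix (α Λ : ℝ) (g : E → ℝ) (ρ : E → ℝ → ℝ) {J : Type*}
    (f : J → testSpace G) :
    ((E → ℝ) × (E → Polynomial ℝ)) →ₗ[ℝ] (J → J → ℝ) where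
  toFun p i j := ∑ e, (p.1 e * metricGradient α Λ g ρ (f i) (f j) e
    + ∫ x in (0 : ℝ)..1, (p.2 e).eval x * densityGradient α Λ g (f i) (f j) e x)
  map_add' p q := by
    funext i j
    rw [Pi.add_apply, Pi.add_apply, ← Finset.sum_add_distrib]
    refine Finset.sum_congr rfl fun e _ => ?_
    have hc : ∀ p : Polynomial ℝ, ContinuousOn
        (fun x => p.eval x * densityGradient α Λ g (f i) (f j) e x) (Icc 0 1) := fun p =>
      p.continuous.continuousOn.mul (continuousOn_densityGradient α Λ g (f i) (f j) e)
    have h1 : ∫ x in (0 : ℝ)..1, ((p + q).2 e).eval x * densityGradient α Λ g (f i) (f j) e x =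
        (∫ x in (0 : ℝ)..1, (p.2 e).eval x * densityGradient α Λ g (f i) (f j) e x)
        + ∫ x in (0 : ℝ)..1, (q.2 e).eval x * densityGradient α Λ g (f i) (f j) e x := by
      rw [← intervalIntegral.integral_add (intervalIntegrable_Icc (hc _))
        (intervalIntegrable_Icc (hc _))]
      exact integral_congr_Icc fun x _ => by
        rw [Prod.snd_add, Pi.add_apply, Polynomial.eval_add, add_mul]
    rw [h1, Prod.fst_add, Pi.add_apply]
    ring
  map_smul' c p := by
    funext i j
    rw [Pi.smul_apply, Pi.smul_apply, smul_eq_mul, Finset.mul_sum]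
    refine Finset.sum_congr rfl fun e _ => ?_
    have h1 : ∫ x in (0 : ℝ)..1, ((c • p).2 e).eval x * densityGradient α Λ g (f i) (f j) e x =
        c * ∫ x in (0 : ℝ)..1, (p.2 e).eval x * densityGradient α Λ g (f i) (f j) e x := by
      rw [← intervalIntegral.integral_const_mul]
      exact integral_congr_Icc fun x _ => by
        rw [Prod.smul_snd, Pi.smul_apply, Polynomial.eval_smul, smul_eq_mul, mul_assoc]
    rw [h1, Prod.smul_fst, Pi.smul_apply, smul_eq_mul, RingHom.id_apply]
    ring

theorem sum_variationMatrix (α Λ : ℝ) {g : E → ℝ} {ρ : E → ℝ → ℝ} (hgρ : IsMetricDensity g ρ)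
    {J : Type*} [Fintype J] (f : J → testSpace G) (p : (E → ℝ) × (E → Polynomial ℝ)) (v : J → ℝ) :
    ∑ i, ∑ j, variationMatrix α Λ g ρ f p i j * (v i * v j) =
      variationQuad α Λ g ρ p.1 (fun e x => (p.2 e).eval x) (∑ i, v i • f i) := by
  have hσ : ∀ e, ContinuousOn (fun x => (p.2 e).eval x) (Icc 0 1) := fun e =>
    (p.2 e).continuous.continuousOn
  rw [← variationForm_self α Λ hgρ p.1 hσ]
  simp only [map_sum, map_smul, LinearMap.sum_apply, LinearMap.smul_apply, smul_eq_mul,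
    variationForm_apply]
  rw [Finset.sum_comm]
  refine Finset.sum_congr rfl fun i _ => ?_
  rw [Finset.mul_sum]
  refine Finset.sum_congr rfl fun j _ => ?_
  have h1 : variationMatrix α Λ g ρ f p j i =
      ∑ e, (p.1 e * metricGradient α Λ g ρ (f j) (f i) e
        + ∫ x in (0 : ℝ)..1, (p.2 e).eval x * densityGradient α Λ g (f j) (f i) e x) := rfl
  rw [h1]
  ring

theorem eq_zero_of_sum_variationQuad_eq_zero [DecidableEq E] {α Λ : ℝ} {g : E → ℝ}
    {ρ : E → ℝ → ℝ} (hgρ : IsMetricDensity g ρ) {n : ℕ} {f : Fin n → testSpace G}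
    (h : ∀ p : (E → ℝ) × (E → Polynomial ℝ),
      ∑ l, variationQuad α Λ g ρ p.1 (fun e x => (p.2 e).eval x) (f l) = 0) :
    (∀ e, ∀ x ∈ Icc (0 : ℝ) 1, ∑ l, densityGradient α Λ g (f l) (f l) e x = 0) ∧
      ∀ e, ∑ l, metricGradient α Λ g ρ (f l) (f l) e = 0 := by
  simp only [fun p : (E → ℝ) × (E → Polynomial ℝ) => sum_variationQuad α Λ hgρ p.1
    (fun e => (p.2 e).continuous.continuousOn) f] at h
  refine ⟨fun e => ?_, fun e => ?_⟩
  · refine eq_zero_of_integral_polynomial_mul_eq_zero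
      (continuousOn_finsetSum _ fun l _ => continuousOn_densityGradient _ _ _ _ _ e) fun q => ?_
    -- Directions supported on one edge, in the density here and in the metric below, isolate the
    -- two gradients.
    have h1 := h (0, Pi.single e q)
    rw [Finset.sum_eq_single e (fun e' _ hne => by simp [Pi.single_eq_of_ne hne]) (by simp)] at h1
    simpa using h1
  · have h1 := h (Pi.single e 1, 0)
    rw [Finset.sum_eq_single e (fun e' _ hne => by simp [Pi.single_eq_of_ne hne]) (by simp)] at h1
    simpa using h1

/-- An extremal pair has edges of equal lengths, a constant density, and a generating family. -/
theorem exists_isGeneratingFamily_of_isExtremal [Fintype V] [DecidableEq V] [Nonempty E]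
    (hG : G.IsConnected) {k : ℕ} (hk : 1 ≤ k) {α : ℝ} (hα₁ : α ≠ 1 / 2) (hα₂ : α ≠ 1)
    {g : E → ℝ} {ρ : E → ℝ → ℝ} (hext : IsExtremal (normalizedEigenvalue G k α) g ρ) :
    ∃ γ r : ℝ, (∀ e, g e = γ) ∧ (∀ e, ∀ x ∈ Icc (0 : ℝ) 1, ρ e x = r) ∧
      ∃ (n : ℕ) (f : Fin n → E → ℝ → ℝ), IsGeneratingFamily G k α g ρ f := by
  classical
  have hgρ := hext.1
  obtain ⟨e, lam, hs⟩ := exists_isSpectralSequence G hgρ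
  have hμ := hs.eigenvalue_pos hG hgρ hk
  set b := massForm G (massDensity g ρ) (continuousOn_massDensity hgρ) with hb
  have hex : ∃ N, lam k < lam N := (hs.tendsto.eventually_gt_atTop (lam k)).exists
  -- With the least such `N` every index below it has eigenvalue at most `lam k` and all later ones
  -- exceed it, so `J` indexes the full eigenspace.
  set N := Nat.find hex
  set J := eigenIndices lam k N
  have hJ : ∀ i ∈ J, lam i = lam k := fun i hi => (Finset.mem_filter.1 hi).2
  have hext' : ∀ v : J → ℝ, ∃ c : ℕ → ℝ, ∑ i, v i • e i = ∑ i ∈ J, c i • e i ∧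
      ∑ i, v i ^ 2 = ∑ i ∈ J, c i ^ 2 := by
    intro v
    refine ⟨fun i => if hi : i ∈ J then v ⟨i, hi⟩ else 0, ?_, ?_⟩
    · rw [← Finset.sum_coe_sort J]
      exact Finset.sum_congr rfl fun i _ => by simp only [i.2, dif_pos]
    · rw [← Finset.sum_coe_sort J]
      exact Finset.sum_congr rfl fun i _ => by simp only [i.2, dif_pos]
  obtain ⟨n, v, hn, hv0, hv⟩ := exists_annihilating_vectors
    (variationMatrix α (lam k * normFactor α g ρ) g ρ fun i : J => e i) (by
      rintro p ⟨ε, hε, hpos⟩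
      refine hext.not_definite hs (Nat.find_spec hex) (fun i hi => not_lt.1 (Nat.find_min hex hi))
        p.1 (σ := fun e x => (p.2 e).eval x) (fun e => by simpa using (p.2 e).contDiff_aeval (𝕜 := ℝ) (⊤ : ℕ∞)) hε fun c => ?_
      have h1 := hpos fun i => c i
      rw [sum_variationMatrix _ _ hgρ] at h1
      rw [← Finset.sum_coe_sort (eigenIndices lam k N) fun i => c i ^ 2,
        ← Finset.sum_coe_sort (eigenIndices lam k N) fun i => c i • e i]
      exact h1)
  simp only [sum_variationMatrix _ _ hgρ] at hv
  set f : Fin n → testSpace G := fun l => ∑ i, v l i • e i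
  have hweak : ∀ l, f l ∈ weakEigenspace G (conductance g) (massDensity g ρ)
      (continuousOn_massDensity hgρ) (lam k) := fun l =>
    Submodule.sum_mem _ fun i _ => Submodule.smul_mem _ _
      (mem_weakEigenspace.2 fun x => by rw [hs.weak, hJ i i.2])
  have hmass : ∀ l, 0 < b (f l) (f l) := by
    intro l
    obtain ⟨c, hc, hc2⟩ := hext' (v l)
    change 0 < b (∑ i, v l i • e i) (∑ i, v l i • e i)
    rw [hc, hs.mass_sum_self, ← hc2]
    obtain ⟨i, hi⟩ := Function.ne_iff.1 (hv0 l)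
    have hi : v l i ≠ 0 := hi
    exact Finset.sum_pos' (fun _ _ => sq_nonneg _) ⟨i, Finset.mem_univ i, by positivity⟩
  have hne : ∀ l, ∃ e, ∃ x ∈ Icc (0 : ℝ) 1, (f l).1 e x ≠ 0 := by
    intro l
    by_contra! h0
    exact (hmass l).ne' (massForm_eq_zero_of_vanish h0 _)
  have hf : ∀ l, IsEigenfunction G g ρ (lam k) (f l).1 := fun l =>
    isEigenfunction_of_mem_weakEigenspace hgρ (hweak l) (hne l)
  have hB : 0 < ∑ l, gradForm G (conductance g) (f l) (f l) := by
    refine Finset.sum_pos (fun l _ => ?_) ⟨⟨0, hn⟩, Finset.mem_univ _⟩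
    rw [mem_weakEigenspace.1 (hweak l)]
    exact mul_pos hμ (hmass l)
  obtain ⟨hd, hm⟩ := eq_zero_of_sum_variationQuad_eq_zero hgρ hv
  obtain ⟨γ, r, s, hs0, hg, hρ, h1, h2⟩ :=
    rigidity_of_gradient_eq_zero hG hgρ hα₁ hα₂ hμ hf hB hd hm
  refine ⟨γ, r, hg, hρ, n, fun l => (s • f l).1, fun l => ?_, fun e' x hx => ?_, fun e' x hx => ?_⟩
  · rw [eigenvalue_eq hgρ hs]
    obtain ⟨e', x, hx, hne'⟩ := hne l
    exact isEigenfunction_of_mem_weakEigenspace hgρ (Submodule.smul_mem _ s (hweak l))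
      ⟨e', x, hx, mul_ne_zero hs0 hne'⟩
  · rw [← h1 e' x hx, Finset.mul_sum, Finset.sum_div]
    refine Finset.sum_congr rfl fun l _ => ?_
    rw [gradSq, edgeDeriv_smul s (f l) e' hx, mul_pow]
  · rw [eigenvalue_eq hgρ hs, ← h2 e' x hx, Finset.mul_sum (a := s ^ 2)]
    congr 1
    exact Finset.sum_congr rfl fun l _ => mul_pow s ((f l).1 e' x) 2

end Necessity

end DiscreteGraph

theorem theorem1p3 {V E : Type*} [Fintype V] [Fintype E] [Nonempty E] [DecidableEq V]
    (G : DiscreteGraph V E) (hG : G.IsConnected) (k : ℕ) (hk : 1 ≤ k)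
    (α : ℝ) (hα₁ : α ≠ 1 / 2) (hα₂ : α ≠ 1) :
    (∀ (g : E → ℝ) (ρ : E → ℝ → ℝ),
      DiscreteGraph.IsExtremal (G.normalizedEigenvalue k α) g ρ →
        (∀ e e' : E, √(g e) = √(g e')) ∧
        (∃ c : ℝ, ∀ e, ∀ x ∈ Icc (0 : ℝ) 1, ρ e x = c) ∧
        ∃ (n : ℕ) (f : Fin n → E → ℝ → ℝ), G.IsGeneratingFamily k α g ρ f) ∧
    (∀ (g : E → ℝ) (ρ : E → ℝ → ℝ), DiscreteGraph.IsMetricDensity g ρ →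
      (∃ (n : ℕ) (f : Fin n → E → ℝ → ℝ), G.IsGeneratingFamily k α g ρ f) →
      (G.eigenvalue (k - 1) g ρ < G.eigenvalue k g ρ ∨
        G.eigenvalue k g ρ < G.eigenvalue (k + 1) g ρ) →
      DiscreteGraph.IsExtremal (G.normalizedEigenvalue k α) g ρ) := by
  refine ⟨fun g ρ hext => ?_, fun g ρ hgρ ⟨n, f, hf⟩ hgap =>
    DiscreteGraph.isExtremal_of_isGeneratingFamily hG hk hα₁ hα₂ hgρ hf hgap⟩
  obtain ⟨γ, r, hg, hρ, hf⟩ :=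
    DiscreteGraph.exists_isGeneratingFamily_of_isExtremal hG hk hα₁ hα₂ hext
  exact ⟨fun e e' => by rw [hg, hg], ⟨r, hρ⟩, hf⟩
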